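/- A convex polyhedron is the convex hull $P$ of finitely many points of $\mathbb{R}^3$ with nonempty interior; its faces, edges and vertices are its nonempty intersections with supporting planes that have dimension $2$, $1$ and $0$ respectively, and the degree of a vertex is the number of edges containing it. Let $e(P)$ be the sum of the lengths of all edges of $P$, let $v(P)$ be its volume, and let $m(P)=e(P)^3/v(P)$ be its Melzak ratio. Construct a sequence $(P_n)_{n\ge 1}$ of convex polyhedra as follows. $P_1$ is a regular tetrahedron. Given $P_n$, if some convex polyhedron $Q$ satisfies $m(Q)<m(P_n)$, let $k$ be the least number of faces of such a $Q$, and let $P_{n+1}$ be a convex polyhedron with $k$ faces whose Melzak ratio is least among all convex polyhedra with $k$ faces; if there is no such $Q$, let $P_{n+1}=P_n$. Such a sequence exists, and every sequence so constructed has the following three properties: (i) $m(P_n)\to\inf_Q m(Q)$ as $n\to\infty$, where $Q$ ranges over all convex polyhedra; (ii) if $P_{n+1}$ is not a scaled copy $cP_n$ ($c>0$) of $P_n$, then $P_n$ has fewer faces than $P_{n+1}$; (iii) every $P_n$ minimizes the Melzak ratio among all convex polyhedra with the same number of faces as $P_n$. Moreover, for every sequence $(P_n)$ of convex polyhedra with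 the properties (i), (ii), (iii), and so in particular for every sequence constructed as above, every vertex of every $P_n$ has degree exactly $3$. -/

import Mathlib

namespace Melzak

/-- Euclidean three-space. -/
abbrev E3 : Type := EuclideanSpace ℝ (Fin 3)

/-- A convex polyhedron: the convex hull of finitely many points of Euclidean three-space, with
nonempty interior. -/
structure ConvexPolyhedron where
  carrier : Set E3
  isHull : ∃ s : Set E3, s.Finite ∧ carrier = convexHull ℝ s
  solid : (interior carrier).Nonempty

namespace ConvexPolyhedron

/-- The `d`-dimensional faces of `P`: the nonempty intersections of `P` with supporting planes
whose affine span has dimension `d`. -/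
def facesOfDim (P : ConvexPolyhedron) (d : ℕ) : Set (Set E3) :=
  {F | F.Nonempty ∧ IsExposed ℝ P.carrier F ∧ Module.finrank ℝ (vectorSpan ℝ F) = d}

/-- The (two-dimensional) faces of `P`. -/
def faces (P : ConvexPolyhedron) : Set (Set E3) := P.facesOfDim 2

/-- The edges of `P`, as segments. -/
def edges (P : ConvexPolyhedron) : Set (Set E3) := P.facesOfDim 1

/-- The vertices of `P`. -/
def vertices (P : ConvexPolyhedron) : Set E3 := P.carrier.extremePoints ℝ

/-- A polyhedron has only finitely many faces of each dimension, so that the counts and the sum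
below are taken over finite sets. -/
theorem facesOfDim_finite (P : ConvexPolyhedron) (d : ℕ) : (P.facesOfDim d).Finite := by
  obtain ⟨s, hs, hP⟩ := P.isHull
  refine (hs.finite_subsets.image (fun t => convexHull ℝ t)).subset ?_
  rintro F ⟨hne, hexp, -⟩
  have hc : IsCompact P.carrier := by rw [hP]; exact hs.isCompact_convexHull ℝ
  have hconv : Convex ℝ P.carrier := by rw [hP]; exact convex_convexHull ℝ s
  have hFc : IsCompact F := hexp.isCompact hc
  have hFconv : Convex ℝ F := hexp.convex hconv
  have hext : F.extremePoints ℝ ⊆ s := by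
    intro x hx
    have h1 : x ∈ P.carrier.extremePoints ℝ :=
      hexp.isExtreme.extremePoints_subset_extremePoints hx
    rw [hP] at h1
    exact extremePoints_convexHull_subset h1
  refine ⟨F.extremePoints ℝ, hext, ?_⟩
  have h2 := closure_convexHull_extremePoints hFc hFconv
  have h3 : IsClosed (convexHull ℝ (F.extremePoints ℝ)) :=
    ((hs.subset hext).isCompact_convexHull ℝ).isClosed
  rw [h3.closure_eq] at h2
  exact h2

/-- The number of faces of `P`. -/
noncomputable def numFaces (P : ConvexPolyhedron) : ℕ := P.faces.ncard

/-- The degree of a point `v` (used for vertices) in `P`: the number of edges containing `v`. -/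
noncomputable def degree (P : ConvexPolyhedron) (v : E3) : ℕ := {e ∈ P.edges | v ∈ e}.ncard

/-- The total edge length of `P`; the length of a segment is its diameter. -/
noncomputable def edgeLength (P : ConvexPolyhedron) : ℝ := ∑ᶠ e ∈ P.edges, Metric.diam e

/-- The volume of `P`. -/
noncomputable def vol (P : ConvexPolyhedron) : ℝ := MeasureTheory.volume.real P.carrier

/-- The Melzak ratio: the cube of the total edge length divided by the volume. -/
noncomputable def melzakRatio (P : ConvexPolyhedron) : ℝ := P.edgeLength ^ 3 / P.vol

/-- `P` minimizes the Melzak ratio among convex polyhedra with as many faces as `P`. -/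
def IsMinimizerForFaces (P : ConvexPolyhedron) : Prop :=
  ∀ Q : ConvexPolyhedron, Q.numFaces = P.numFaces → P.melzakRatio ≤ Q.melzakRatio

/-- `P` is a regular tetrahedron: the hull of four points at equal positive mutual distances. -/
def IsRegularTetrahedron (P : ConvexPolyhedron) : Prop :=
  ∃ (p : Fin 4 → E3) (a : ℝ), 0 < a ∧ (∀ i j, i ≠ j → dist (p i) (p j) = a) ∧
    P.carrier = convexHull ℝ (Set.range p)

/-- `Q` is a scaled copy of `P`. -/
def IsScaling (P Q : ConvexPolyhedron) : Prop :=
  ∃ c : ℝ, 0 < c ∧ Q.carrier = (fun x => c • x) '' P.carrier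

end ConvexPolyhedron

/-- The recursive construction: start with a regular tetrahedron. If some convex polyhedron has
smaller Melzak ratio than the current one, let `k` be the least number of faces of such a
polyhedron; the next term has `k` faces and minimizes the Melzak ratio among convex polyhedra
with `k` faces. If there is no such polyhedron, the next term is the current one. -/
structure IsConstructedSequence (P : ℕ → ConvexPolyhedron) : Prop where
  start : (P 0).IsRegularTetrahedron
  step : ∀ n, (∃ Q : ConvexPolyhedron, Q.melzakRatio < (P n).melzakRatio) →
    IsLeast {k : ℕ | ∃ Q : ConvexPolyhedron,
        Q.melzakRatio < (P n).melzakRatio ∧ Q.numFaces = k} (P (n + 1)).numFaces ∧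
      (P (n + 1)).IsMinimizerForFaces
  stationary : ∀ n, (¬ ∃ Q : ConvexPolyhedron, Q.melzakRatio < (P n).melzakRatio) → P (n + 1) = P n

/-- The properties of the minimizing sequence of the convex Melzak problem. -/
structure IsMinimizingSequence (P : ℕ → ConvexPolyhedron) : Prop where
  tendsto_inf : Filter.Tendsto (fun n => (P n).melzakRatio) Filter.atTop
    (nhds (⨅ Q : ConvexPolyhedron, Q.melzakRatio))
  faces_lt : ∀ n, ¬ (P n).IsScaling (P (n + 1)) → (P n).numFaces < (P (n + 1)).numFaces
  minimizes : ∀ n, (P n).IsMinimizerForFaces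

end Melzak

/-!
The proof rests on an integral formula for the edge length. For almost every plane, the section of
a polyhedron is a polygon with as many vertices as sides, so the plane meets as many edges as
faces (`card_edges_eq_card_faces`). Integrating over parallel planes shows that in every direction
the widths of the edges add up to those of the faces, and integrating over all directions gives
`ConvexPolyhedron.widthConst_mul_edgeLength`: up to a constant, the edge length is the sum of the
mean widths of the faces.

*Vertices have degree three.* At a vertex `v` of another degree there are two faces that have only
`v` in common (`IsRep.exists_facets_inter_eq_singleton`). Move the first of them by `t`, outwards
and inwards, keeping the number of faces. By the Minkowski inequality the mean width of every face
is a concave function of the position; that of the second face does not grow in the outward motion,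
while the inward motion cuts off its corner at `v`. So the edge length has a strictly concave kink
(`IsRep.exists_edgeLength_shift_add_le`), whereas the second difference of the volume is at least
of order `-t ^ 2` (`IsRep.exists_volume_shift_ge`). Therefore the Melzak ratio decreases in one of
the two directions (`false_of_concave_kink`), and `P` is no minimizer.

*Existence of minimizers.* Take a minimizing sequence among the polyhedra with `k` faces, scaled to
edge length one. The edge length bounds the diameter, so that the planes of the faces converge
along a subsequence. The widths of the faces of the limit are not larger than what remains of those
of the approximating faces (`IsConvergentFamily.eventually_width_le`), so the edge length is lower
semicontinuous, and the volume does not drop. The limit may have fewer than `k` faces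
(`exists_numFaces_le_melzakRatio_le`). For the least `k` that admits an improvement on a given
polyhedron this cannot happen, and the recursive construction can always be continued.

*Constructed sequences.* By induction, no polyhedron with at most as many faces as a term has a
smaller ratio (`IsConstructedSequence.numFaces_lt_of_melzakRatio_lt`). So the number of faces grows
strictly as long as the ratio can be improved, and the ratios tend to the infimum. The induction
starts with the optimality of the regular tetrahedron among the polyhedra with four faces. For two
opposite edges of a tetrahedron, a reflection reduces the inequality between edge length and volume
to the case in which the segment between their midpoints is orthogonal to both of them, where it
follows from the inequality between arithmetic and geometric means (`mul_det3_sq_le`).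
-/

namespace Melzak

open Set Module MeasureTheory Filter Topology
open scoped InnerProductSpace

/-! ### Faces of convex polyhedra -/

namespace ConvexPolyhedron

variable (P : ConvexPolyhedron)

theorem convex : Convex ℝ P.carrier := by
  obtain ⟨s, -, hP⟩ := P.isHull
  rw [hP]; exact convex_convexHull ℝ s

theorem isCompact : IsCompact P.carrier := by
  obtain ⟨s, hs, hP⟩ := P.isHull
  rw [hP]; exact hs.isCompact_convexHull ℝ

theorem nonempty : P.carrier.Nonempty := P.solid.mono interior_subset

theorem vol_pos : 0 < P.vol :=
  ENNReal.toReal_pos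
    ((isOpen_interior.measure_pos volume P.solid).trans_le (measure_mono interior_subset)).ne'
    P.isCompact.measure_lt_top.ne

theorem finite_vertices : P.vertices.Finite := by
  obtain ⟨s, hs, hP⟩ := P.isHull
  refine hs.subset ?_
  rw [vertices, hP]
  exact extremePoints_convexHull_subset

end ConvexPolyhedron

theorem vectorSpan_le_ker {F : Set E3} (l : StrongDual ℝ E3)
    (h : ∀ x ∈ F, ∀ y ∈ F, l x = l y) : vectorSpan ℝ F ≤ LinearMap.ker (l : E3 →ₗ[ℝ] ℝ) := by
  rw [vectorSpan, Submodule.span_le]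
  rintro _ ⟨x, hx, y, hy, rfl⟩
  simp [h x hx y hy]

theorem finrank_ker_eq_two {l : StrongDual ℝ E3} (hl : l ≠ 0) :
    finrank ℝ (LinearMap.ker (l : E3 →ₗ[ℝ] ℝ)) = 2 := by
  have h0 : (l : E3 →ₗ[ℝ] ℝ) ≠ 0 := fun h => hl (by
    ext x; exact congrArg (fun m : E3 →ₗ[ℝ] ℝ => m x) h)
  have h := Module.Dual.finrank_ker_add_one_of_ne_zero h0
  have h3 : finrank ℝ E3 = 3 := by simp
  omega

/-- An exposed face is the intersection of the ambient set with its affine span, so a face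
contained in another one of no larger dimension coincides with it. -/
theorem IsExposed.eq_of_subset_of_finrank_le {A F G : Set E3} (hF : IsExposed ℝ A F)
    (hG : IsExposed ℝ A G) (hne : G.Nonempty) (hGF : G ⊆ F)
    (hd : finrank ℝ (vectorSpan ℝ F) ≤ finrank ℝ (vectorSpan ℝ G)) : F = G := by
  have hs : vectorSpan ℝ G = vectorSpan ℝ F :=
    Submodule.eq_of_le_of_finrank_le (vectorSpan_mono ℝ hGF) hd
  obtain ⟨l, hl⟩ := hG hne
  have hconst : ∀ x ∈ G, ∀ y ∈ G, l x = l y := by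
    intro x hx y hy
    rw [hl] at hx hy
    exact le_antisymm (hy.2 x hx.1) (hx.2 y hy.1)
  have hker := vectorSpan_le_ker l hconst
  obtain ⟨g, hg⟩ := hne
  refine Subset.antisymm (fun x hx => ?_) hGF
  have h1 : x -ᵥ g ∈ vectorSpan ℝ F := vsub_mem_vectorSpan ℝ hx (hGF hg)
  have h2 : l (x - g) = 0 := hker (hs ▸ h1)
  rw [hl] at hg ⊢
  refine ⟨hF.subset hx, fun y hy => ?_⟩
  have := hg.2 y hy
  rw [map_sub] at h2
  linarith

theorem finrank_vectorSpan_of_interior_nonempty {A : Set E3} (h : (interior A).Nonempty) :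
    finrank ℝ (vectorSpan ℝ A) = 3 := by
  have h1 : affineSpan ℝ A = ⊤ :=
    affineSpan_eq_top_of_nonempty_interior (h.mono (interior_mono (subset_convexHull ℝ A)))
  have h2 : vectorSpan ℝ A = ⊤ := by
    rw [← direction_affineSpan, h1, AffineSubspace.direction_top]
  rw [h2, finrank_top]; simp

/-! ### Facet representations -/

/-- The intersection of the closed half-spaces `⟪a i, x⟫ ≤ b i`. -/
def halfspaces {ι : Type*} (a : ι → E3) (b : ι → ℝ) : Set E3 := {x | ∀ i, ⟪a i, x⟫_ℝ ≤ b i}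

/-- The part of `halfspaces a b` in the `i`-th bounding plane. -/
def facet {ι : Type*} (a : ι → E3) (b : ι → ℝ) (i : ι) : Set E3 :=
  {x ∈ halfspaces a b | ⟪a i, x⟫_ℝ = b i}

/-- An irredundant description of `P` by half-spaces with unit outer normals: each bounding plane
has a point satisfying all other inequalities strictly. -/
structure IsRep {ι : Type*} (P : ConvexPolyhedron) (a : ι → E3) (b : ι → ℝ) : Prop where
  carrier_eq : P.carrier = halfspaces a b
  norm_eq : ∀ i, ‖a i‖ = 1
  exists_relint : ∀ i, ∃ x, ⟪a i, x⟫_ℝ = b i ∧ ∀ j, j ≠ i → ⟪a j, x⟫_ℝ < b j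

theorem convex_halfspaces {ι : Type*} (a : ι → E3) (b : ι → ℝ) : Convex ℝ (halfspaces a b) := by
  have : halfspaces a b = ⋂ i, {x | innerSL ℝ (a i) x ≤ b i} := by
    ext x; simp [halfspaces]
  rw [this]
  exact convex_iInter fun i => convex_halfSpace_le (innerSL ℝ (a i)).toLinearMap.isLinear _

theorem isClosed_halfspaces {ι : Type*} (a : ι → E3) (b : ι → ℝ) :
    IsClosed (halfspaces a b) := by
  have : halfspaces a b = ⋂ i, {x | ⟪a i, x⟫_ℝ ≤ b i} := by
    ext x; simp [halfspaces]
  rw [this]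
  exact isClosed_iInter fun i => isClosed_le (by fun_prop) continuous_const

theorem isExposed_facet {ι : Type*} (a : ι → E3) (b : ι → ℝ) (i : ι) :
    IsExposed ℝ (halfspaces a b) (facet a b i) := by
  rintro ⟨x, hx⟩
  refine ⟨innerSL ℝ (a i), ?_⟩
  ext y
  simp only [facet, mem_ofPred_eq, innerSL_apply_apply]
  constructor
  · rintro ⟨hy, hyi⟩
    exact ⟨hy, fun z hz => hyi ▸ hz i⟩
  · rintro ⟨hy, h⟩
    exact ⟨hy, le_antisymm (hy i) (hx.2 ▸ h x hx.1)⟩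

/-- A point of a convex set at which every inequality that is strict somewhere on the set is
strict. -/
theorem exists_strict_point {ι : Type*} {F : Set E3} (hF : Convex ℝ F) (hne : F.Nonempty)
    (a : ι → E3) (b : ι → ℝ) (hab : ∀ x ∈ F, ∀ i, ⟪a i, x⟫_ℝ ≤ b i) (s : Finset ι) :
    ∃ x ∈ F, ∀ i ∈ s, (∃ y ∈ F, ⟪a i, y⟫_ℝ < b i) → ⟪a i, x⟫_ℝ < b i := by
  classical
  induction s using Finset.induction_on with
  | empty => obtain ⟨x, hx⟩ := hne; exact ⟨x, hx, by simp⟩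
  | insert i s _ ih =>
    obtain ⟨x, hx, hxs⟩ := ih
    by_cases h : ∃ y ∈ F, ⟪a i, y⟫_ℝ < b i
    · obtain ⟨y, hy, hyi⟩ := h
      refine ⟨(1/2 : ℝ) • x + (1/2 : ℝ) • y,
        hF hx hy (by norm_num) (by norm_num) (by norm_num), fun j hj hj' => ?_⟩
      rw [inner_add_right, inner_smul_right, inner_smul_right]
      rcases Finset.mem_insert.1 hj with rfl | hj
      · linarith [hab x hx j]
      · linarith [hxs j hj hj', hab y hy j]
    · refine ⟨x, hx, fun j hj hj' => ?_⟩
      rcases Finset.mem_insert.1 hj with rfl | hj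
      · exact absurd hj' h
      · exact hxs j hj hj'

/-- A small step from a point of `halfspaces a b` stays in the set if it does not violate the
inequalities that are equalities at the point. -/
theorem exists_pos_add_smul_mem {ι : Type*} [Finite ι] {a : ι → E3} {b : ι → ℝ} {x w : E3}
    (hx : x ∈ halfspaces a b) (hw : ∀ i, ⟪a i, x⟫_ℝ = b i → ⟪a i, w⟫_ℝ ≤ 0) :
    ∃ ε > 0, ∀ τ : ℝ, 0 ≤ τ → τ ≤ ε → x + τ • w ∈ halfspaces a b := by
  have h : ∀ i, ∃ ε > 0, ∀ τ : ℝ, 0 ≤ τ → τ ≤ ε → ⟪a i, x + τ • w⟫_ℝ ≤ b i := by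
    intro i
    rcases (hx i).eq_or_lt with h | h
    · refine ⟨1, one_pos, fun τ h0 _ => ?_⟩
      rw [inner_add_right, inner_smul_right]
      nlinarith [hw i h]
    · refine ⟨(b i - ⟪a i, x⟫_ℝ) / (|⟪a i, w⟫_ℝ| + 1), by
        have : 0 < b i - ⟪a i, x⟫_ℝ := by linarith
        positivity, fun τ h0 h1 => ?_⟩
      rw [le_div_iff₀ (by positivity)] at h1
      rw [inner_add_right, inner_smul_right]
      nlinarith [le_abs_self ⟪a i, w⟫_ℝ]
  choose ε hε h using h
  cases nonempty_fintype ι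
  cases isEmpty_or_nonempty ι
  · exact ⟨1, one_pos, fun τ _ _ i => isEmptyElim i⟩
  · refine ⟨Finset.univ.inf' Finset.univ_nonempty ε, ?_, fun τ h0 h1 i => ?_⟩
    · simpa [Finset.lt_inf'_iff] using hε
    · exact h i τ h0 (h1.trans (Finset.inf'_le _ (Finset.mem_univ i)))

/-- An extreme point `y` is determined by the inequalities that are equalities there: if they are
equalities at another point `x` as well, the segment from `x` to `y` can be prolonged. -/
theorem finite_extremePoints_halfspaces {ι : Type*} [Finite ι] (a : ι → E3) (b : ι → ℝ) :
    ((halfspaces a b).extremePoints ℝ).Finite := by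
  refine Set.Finite.of_finite_image (f := fun x => {i | ⟪a i, x⟫_ℝ = b i}) (Set.toFinite _) ?_
  intro x hx y hy hxy
  by_contra hne
  have hxy : ∀ i, ⟪a i, x⟫_ℝ = b i → ⟪a i, y⟫_ℝ = b i := fun i hi =>
    (Set.ext_iff.1 hxy i).1 hi
  have key := exists_pos_add_smul_mem (w := x - y) hx.1 (fun i hi => by
    rw [inner_sub_right, hi, hxy i hi]; simp)
  obtain ⟨ε, hε, h⟩ := key
  have h1 := h ε hε.le le_rfl
  have := hx.2 hy.1 h1 ?_
  · exact hne this.symm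
  · refine ⟨ε / (1 + ε), 1 / (1 + ε), by positivity, by positivity, by field_simp; ring, ?_⟩
    rw [smul_add, smul_smul, smul_sub]
    match_scalars <;> field_simp
    ring

/-- A bounded intersection of finitely many half-spaces with nonempty interior. -/
def ofHalfspaces {ι : Type*} [Finite ι] (a : ι → E3) (b : ι → ℝ)
    (hb : Bornology.IsBounded (halfspaces a b)) (hs : (interior (halfspaces a b)).Nonempty) :
    ConvexPolyhedron where
  carrier := halfspaces a b
  isHull := by
    have hc : IsCompact (halfspaces a b) :=
      Metric.isCompact_of_isClosed_isBounded (isClosed_halfspaces a b) hb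
    have hfin := finite_extremePoints_halfspaces a b
    refine ⟨_, hfin, ?_⟩
    have h2 := closure_convexHull_extremePoints hc (convex_halfspaces a b)
    rw [(hfin.isCompact_convexHull ℝ).isClosed.closure_eq] at h2
    exact h2.symm
  solid := hs

theorem innerSL_ne_zero {v : E3} (hv : ‖v‖ = 1) : innerSL ℝ v ≠ 0 := by
  intro h
  have : innerSL ℝ v v = 0 := by rw [h]; rfl
  rw [innerSL_apply_apply, real_inner_self_eq_norm_sq, hv] at this
  norm_num at this

theorem finrank_vectorSpan_facet_le {ι : Type*} {a : ι → E3} {b : ι → ℝ} {i : ι}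
    (ha : ‖a i‖ = 1) : finrank ℝ (vectorSpan ℝ (facet a b i)) ≤ 2 := by
  rw [← finrank_ker_eq_two (innerSL_ne_zero ha)]
  refine Submodule.finrank_mono (vectorSpan_le_ker _ fun x hx y hy => ?_)
  simp [hx.2, hy.2]

theorem finrank_vectorSpan_facet {ι : Type*} [Finite ι] {a : ι → E3} {b : ι → ℝ} {i : ι}
    (ha : ‖a i‖ = 1)
    (hx : ∃ x, ⟪a i, x⟫_ℝ = b i ∧ ∀ j, j ≠ i → ⟪a j, x⟫_ℝ < b j) :
    finrank ℝ (vectorSpan ℝ (facet a b i)) = 2 := by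
  refine le_antisymm (finrank_vectorSpan_facet_le ha) ?_
  rw [← finrank_ker_eq_two (innerSL_ne_zero ha)]
  refine Submodule.finrank_mono fun w hw => ?_
  have hw : ⟪a i, w⟫_ℝ = 0 := hw
  obtain ⟨x, hxi, hxj⟩ := hx
  have hxP : x ∈ halfspaces a b := fun j => by
    by_cases hj : j = i
    · subst hj; exact hxi.le
    · exact (hxj j hj).le
  obtain ⟨ε, hε, h⟩ := exists_pos_add_smul_mem (w := w) hxP (fun j hj => by
    by_cases hji : j = i
    · subst hji; exact hw.le
    · exact absurd hj (hxj j hji).ne)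
  have h1 : x + ε • w ∈ facet a b i := ⟨h ε hε.le le_rfl, by
    rw [inner_add_right, inner_smul_right, hw, hxi]; simp⟩
  have h2 := vsub_mem_vectorSpan ℝ h1 (⟨hxP, hxi⟩ : x ∈ facet a b i)
  have h3 : x + ε • w -ᵥ x = ε • w := by simp
  rw [h3] at h2
  have := (vectorSpan ℝ (facet a b i)).smul_mem ε⁻¹ h2
  rwa [smul_smul, inv_mul_cancel₀ hε.ne', one_smul] at this

/-- A proper face lies in one of the bounding planes. -/
theorem exists_subset_facet {ι : Type*} [Finite ι] {a : ι → E3} {b : ι → ℝ}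
    (hs : (interior (halfspaces a b)).Nonempty) {F : Set E3}
    (hF : IsExposed ℝ (halfspaces a b) F) (hne : F.Nonempty)
    (hd : finrank ℝ (vectorSpan ℝ F) ≤ 2) : ∃ i, F ⊆ facet a b i := by
  cases nonempty_fintype ι
  obtain ⟨x, hx, hxs⟩ := exists_strict_point (hF.convex (convex_halfspaces a b)) hne a b
    (fun x hx => hF.subset hx) Finset.univ
  by_contra! hcon
  have hstrict : ∀ i, ⟪a i, x⟫_ℝ < b i := fun i => by
    obtain ⟨y, hy, hyi⟩ := not_subset.1 (hcon i)
    exact hxs i (Finset.mem_univ i) ⟨y, hy, lt_of_le_of_ne (hF.subset hy i)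
      fun h => hyi ⟨hF.subset hy, h⟩⟩
  obtain ⟨l, hl⟩ := hF hne
  have hlz : l = 0 := by
    have hle : ∀ w, l w ≤ 0 := fun w => by
      obtain ⟨ε, hε, h⟩ := exists_pos_add_smul_mem (w := w) (hF.subset hx)
        (fun i hi => absurd hi (hstrict i).ne)
      have h1 := h ε hε.le le_rfl
      rw [hl] at hx
      have h2 := hx.2 _ h1
      rw [map_add, map_smul, smul_eq_mul] at h2
      by_contra! h3
      nlinarith [mul_pos hε h3]
    ext w
    have := hle (-w)
    rw [map_neg] at this
    exact le_antisymm (hle w) (by simpa using this)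
  have hF' : F = halfspaces a b := by rw [hl, hlz]; ext; simp
  rw [hF', finrank_vectorSpan_of_interior_nonempty hs] at hd
  omega

theorem eq_facet_of_finrank_eq_two {ι : Type*} [Finite ι] {a : ι → E3} {b : ι → ℝ}
    (ha : ∀ i, ‖a i‖ = 1)
    (hs : (interior (halfspaces a b)).Nonempty) {F : Set E3}
    (hF : IsExposed ℝ (halfspaces a b) F) (hne : F.Nonempty)
    (hd : finrank ℝ (vectorSpan ℝ F) = 2) : ∃ i, F = facet a b i := by
  obtain ⟨i, hi⟩ := exists_subset_facet hs hF hne hd.le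
  exact ⟨i, (IsExposed.eq_of_subset_of_finrank_le (isExposed_facet a b i) hF hne hi
    (hd ▸ finrank_vectorSpan_facet_le (ha i))).symm⟩

namespace IsRep

variable {ι : Type*} {P : ConvexPolyhedron} {a : ι → E3} {b : ι → ℝ}

theorem solid (h : IsRep P a b) : (interior (halfspaces a b)).Nonempty :=
  h.carrier_eq ▸ P.solid

theorem facet_injective (h : IsRep P a b) : Function.Injective (facet a b) := by
  intro i j hij
  by_contra hne
  obtain ⟨x, hxi, hxj⟩ := h.exists_relint i
  have hx : x ∈ facet a b i := ⟨fun k => by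
    by_cases hk : k = i
    · subst hk; exact hxi.le
    · exact (hxj k hk).le, hxi⟩
  rw [hij] at hx
  exact (hxj j (Ne.symm hne)).ne hx.2

theorem faces_eq [Finite ι] (h : IsRep P a b) : P.faces = range (facet a b) := by
  ext F
  constructor
  · rintro ⟨hne, hexp, hd⟩
    rw [h.carrier_eq] at hexp
    obtain ⟨i, hi⟩ := eq_facet_of_finrank_eq_two h.norm_eq h.solid hexp hne hd
    exact ⟨i, hi.symm⟩
  · rintro ⟨i, rfl⟩
    have hd := finrank_vectorSpan_facet (h.norm_eq i) (h.exists_relint i)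
    refine ⟨?_, h.carrier_eq ▸ isExposed_facet a b i, hd⟩
    rw [nonempty_iff_ne_empty]
    intro he
    rw [he, vectorSpan_empty, finrank_bot] at hd
    omega

theorem numFaces_eq [Finite ι] (h : IsRep P a b) : P.numFaces = Nat.card ι := by
  rw [ConvexPolyhedron.numFaces, h.faces_eq, ← image_univ, ncard_image_of_injective _
    h.facet_injective, ncard_univ]

theorem finsum_faces [Fintype ι] (h : IsRep P a b) (f : Set E3 → ℝ) :
    ∑ᶠ F ∈ P.faces, f F = ∑ i, f (facet a b i) := by
  rw [h.faces_eq, finsum_mem_range h.facet_injective, finsum_eq_sum_of_fintype]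

end IsRep

/-- Supporting functional of a face, normalized to an inner product with a unit vector. -/
theorem exists_unit_normal {P : ConvexPolyhedron} {F : Set E3} (hF : F ∈ P.faces) :
    ∃ (v : E3) (r : ℝ), ‖v‖ = 1 ∧ (∀ x ∈ P.carrier, ⟪v, x⟫_ℝ ≤ r) ∧
      F = {x ∈ P.carrier | ⟪v, x⟫_ℝ = r} := by
  obtain ⟨hne, hexp, hd⟩ := hF
  obtain ⟨l, hl⟩ := hexp hne
  have hl0 : l ≠ 0 := by
    rintro rfl
    have : F = P.carrier := by rw [hl]; ext; simp
    rw [this, finrank_vectorSpan_of_interior_nonempty P.solid] at hd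
    omega
  set v := (InnerProductSpace.toDual ℝ E3).symm l with hv
  have hlv : ∀ x, l x = ⟪v, x⟫_ℝ := fun x => (InnerProductSpace.toDual_symm_apply).symm
  have hv0 : v ≠ 0 := fun h => hl0 (by
    ext x; rw [hlv, h, inner_zero_left]; rfl)
  have hn : 0 < ‖v‖ := norm_pos_iff.2 hv0
  obtain ⟨g, hg⟩ := hne
  have hg' := hg
  rw [hl] at hg'
  have hin : ∀ x, ⟪‖v‖⁻¹ • v, x⟫_ℝ = ‖v‖⁻¹ * l x := fun x => by
    rw [real_inner_smul_left, hlv]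
  refine ⟨‖v‖⁻¹ • v, ‖v‖⁻¹ * l g, ?_, fun x hx => ?_, ?_⟩
  · rw [norm_smul, norm_inv, norm_norm, inv_mul_cancel₀ hn.ne']
  · rw [hin]
    exact mul_le_mul_of_nonneg_left (hg'.2 x hx) (by positivity)
  · ext x
    simp only [mem_ofPred_eq, hin]
    rw [mul_right_inj' (inv_ne_zero hn.ne')]
    constructor
    · intro hx
      rw [hl] at hx
      exact ⟨hx.1, le_antisymm (hg'.2 x hx.1) (hx.2 g hg'.1)⟩
    · rintro ⟨hx, hxg⟩
      rw [hl]
      exact ⟨hx, fun y hy => hxg ▸ hg'.2 y hy⟩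

theorem inner_lt_of_mem_interior {A : Set E3} {v : E3} {r : ℝ} (hv : ‖v‖ = 1)
    (hA : ∀ x ∈ A, ⟪v, x⟫_ℝ ≤ r) {p : E3} (hp : p ∈ interior A) : ⟪v, p⟫_ℝ < r := by
  obtain ⟨ε, hε, hball⟩ := Metric.isOpen_iff.1 isOpen_interior p hp
  have h1 : p + (ε / 2) • v ∈ A := by
    refine interior_subset (hball ?_)
    rw [Metric.mem_ball, dist_eq_norm, add_sub_cancel_left, norm_smul, hv,
      Real.norm_of_nonneg (by positivity)]
    linarith
  have h2 := hA _ h1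
  rw [inner_add_right, inner_smul_right, real_inner_self_eq_norm_sq, hv] at h2
  linarith

/-- A point outside `P` is separated from `P` by the plane of a two-dimensional face. The segment
from it to a generic interior point of `P` avoids the edges and vertices, hence leaves `P` through
a two-dimensional face. -/
theorem exists_face_separating {P : ConvexPolyhedron} {x : E3} (hx : x ∉ P.carrier) :
    ∃ F ∈ P.faces, ∀ (v : E3) (r : ℝ), (‖v‖ = 1) → (∀ y ∈ P.carrier, ⟪v, y⟫_ℝ ≤ r) →
      F = {y ∈ P.carrier | ⟪v, y⟫_ℝ = r} → r < ⟪v, x⟫_ℝ := by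
  set L : Set (Set E3) := P.facesOfDim 0 ∪ P.facesOfDim 1 with hL
  have hLfin : L.Finite := (P.facesOfDim_finite 0).union (P.facesOfDim_finite 1)
  have hnull : volume (⋃ G ∈ L, (affineSpan ℝ (insert x G) : Set E3)) = 0 := by
    rw [measure_biUnion_null_iff hLfin.countable]
    intro G hG
    refine Measure.addHaar_affineSubspace _ _ fun htop => ?_
    have hGd : finrank ℝ (vectorSpan ℝ G) ≤ 1 := by
      rcases hG with h | h
      · exact h.2.2.le.trans (by norm_num)
      · exact h.2.2.le
    have h1 : vectorSpan ℝ (insert x G) = ⊤ := by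
      rw [← direction_affineSpan, htop, AffineSubspace.direction_top]
    have h2 := finrank_vectorSpan_insert_le_set ℝ G x
    rw [h1, finrank_top] at h2
    have h3 : finrank ℝ E3 = 3 := by simp
    omega
  obtain ⟨p, hp, hpL⟩ : ∃ p ∈ interior P.carrier,
      p ∉ ⋃ G ∈ L, (affineSpan ℝ (insert x G) : Set E3) := by
    by_contra! h
    exact (isOpen_interior.measure_pos volume P.solid).ne' (measure_mono_null h hnull)
  have hcl : IsClosed P.carrier := P.isCompact.isClosed
  obtain ⟨y, hy, hyP, hyi⟩ : ∃ y ∈ segment ℝ p x, y ∈ P.carrier ∧ y ∉ interior P.carrier := by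
    by_contra! h
    obtain ⟨z, -, hz1, hz2⟩ := (convex_segment (𝕜 := ℝ) p x).isPreconnected _ _ isOpen_interior
      hcl.isOpen_compl (fun z hz => by
        by_cases hzP : z ∈ P.carrier
        · exact Or.inl (h z hz hzP)
        · exact Or.inr hzP) ⟨p, left_mem_segment ℝ p x, hp⟩ ⟨x, right_mem_segment ℝ p x, hx⟩
    exact hz2 (interior_subset hz1)
  have hyx : y ≠ x := fun h => hx (h ▸ hyP)
  have hyp : y ≠ p := fun h => hyi (h ▸ hp)
  obtain ⟨l, hl⟩ := geometric_hahn_banach_open_point P.convex.interior isOpen_interior hyi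
  have hl' : ∀ z ∈ P.carrier, l z ≤ l y := by
    intro z hz
    have hz' : z ∈ closure (interior P.carrier) := by
      rw [P.convex.closure_interior_eq_closure_of_nonempty_interior P.solid]
      exact subset_closure hz
    exact closure_minimal (fun w hw => (hl w hw).le) (isClosed_le l.continuous continuous_const) hz'
  have hl0 : l ≠ 0 := by
    rintro rfl
    simpa using hl p hp
  set G := l.toExposed P.carrier with hG
  have hGe : IsExposed ℝ P.carrier G := ContinuousLinearMap.toExposed.isExposed
  have hyG : y ∈ G := ⟨hyP, hl'⟩
  have hd : finrank ℝ (vectorSpan ℝ G) ≤ 2 := by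
    rw [← finrank_ker_eq_two hl0]
    exact Submodule.finrank_mono (vectorSpan_le_ker l fun u hu w hw =>
      le_antisymm (hw.2 u hu.1) (hu.2 w hw.1))
  obtain ⟨s, t, hs, ht, hst, hsty⟩ := hy
  have hs0 : s ≠ 0 := by
    rintro rfl
    rw [zero_add] at hst
    rw [hst, zero_smul, one_smul, zero_add] at hsty
    exact hyx hsty.symm
  have ht0 : t ≠ 0 := by
    rintro rfl
    rw [add_zero] at hst
    rw [hst, zero_smul, one_smul, add_zero] at hsty
    exact hyp hsty.symm
  have hd2 : finrank ℝ (vectorSpan ℝ G) = 2 := by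
    by_contra hne
    have hGL : G ∈ L := by
      have : finrank ℝ (vectorSpan ℝ G) = 0 ∨ finrank ℝ (vectorSpan ℝ G) = 1 := by omega
      rcases this with h | h
      · exact Or.inl ⟨⟨y, hyG⟩, hGe, h⟩
      · exact Or.inr ⟨⟨y, hyG⟩, hGe, h⟩
    refine hpL (mem_biUnion hGL ?_)
    have hxm : x ∈ affineSpan ℝ (insert x G) := mem_affineSpan ℝ (mem_insert _ _)
    have hym : y ∈ affineSpan ℝ (insert x G) := mem_affineSpan ℝ (mem_insert_of_mem _ hyG)
    have hp' : p = AffineMap.lineMap x y s⁻¹ := by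
      rw [AffineMap.lineMap_apply, ← hsty, vsub_eq_sub, vadd_eq_add]
      have : t = 1 - s := by linarith
      subst this
      match_scalars <;> field_simp
      ring
    rw [hp']
    exact AffineMap.lineMap_mem _ hxm hym
  refine ⟨G, ⟨⟨y, hyG⟩, hGe, hd2⟩, fun v r hv hle hGv => ?_⟩
  have hpr := inner_lt_of_mem_interior hv hle hp
  rw [hGv] at hyG
  have hyr := hyG.2
  rw [← hsty, inner_add_right, inner_smul_right, inner_smul_right] at hyr
  have hs1 : 0 < s := lt_of_le_of_ne hs (Ne.symm hs0)
  have ht1 : 0 < t := lt_of_le_of_ne ht (Ne.symm ht0)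
  by_contra! hcon
  have h1 : s * ⟪v, p⟫_ℝ < s * r := mul_lt_mul_of_pos_left hpr hs1
  have h2 : t * ⟪v, x⟫_ℝ ≤ t * r := mul_le_mul_of_nonneg_left hcon ht
  have h3 : s * r + t * r = r := by rw [← add_mul, hst, one_mul]
  linarith

/-- A convex polyhedron is the intersection of the half-spaces of its two-dimensional faces. -/
theorem exists_isRep (P : ConvexPolyhedron) :
    ∃ (a : Fin P.numFaces → E3) (b : Fin P.numFaces → ℝ), IsRep P a b := by
  have hfin : P.faces.Finite := P.facesOfDim_finite 2
  have : Finite P.faces := hfin.to_subtype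
  let e : Fin P.numFaces ≃ P.faces := (Finite.equivFinOfCardEq (by
    rw [Nat.card_coe_set_eq]; rfl)).symm
  choose v r hv hle hF using fun F : P.faces => exists_unit_normal F.2
  have hcar : P.carrier = halfspaces (fun i => v (e i)) (fun i => r (e i)) := by
    ext x
    refine ⟨fun hx i => hle _ x hx, fun hx => ?_⟩
    by_contra hxP
    obtain ⟨F, hFf, h⟩ := exists_face_separating hxP
    have h1 := h (v ⟨F, hFf⟩) (r ⟨F, hFf⟩) (hv _) (hle _) (hF ⟨F, hFf⟩)
    have h2 := hx (e.symm ⟨F, hFf⟩)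
    simp only [Equiv.apply_symm_apply] at h2
    linarith
  refine ⟨fun i => v (e i), fun i => r (e i), hcar, fun i => hv _, fun i => ?_⟩
  have hFi := (e i).2
  obtain ⟨x, hx, hxs⟩ := exists_strict_point (hFi.2.1.convex P.convex) hFi.1
    (fun i => v (e i)) (fun i => r (e i)) (fun x hx i => hle _ x (hFi.2.1.subset hx))
    Finset.univ
  refine ⟨x, ?_, fun j hj => hxs j (Finset.mem_univ j) ?_⟩
  · rw [hF] at hx
    exact hx.2
  · by_contra! hcon
    have hFj := (e j).2
    have hsub : ((e i : P.faces) : Set E3) ⊆ (e j : P.faces) := by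
      intro y hy
      have h1 := hcon y hy
      have h2 := hFi.2.1.subset hy
      rw [hF (e j)]
      exact ⟨h2, le_antisymm (hle _ y h2) h1⟩
    have := IsExposed.eq_of_subset_of_finrank_le hFj.2.1 hFi.2.1 hFi.1 hsub
      (hFj.2.2.le.trans hFi.2.2.ge)
    exact hj (e.injective (Subtype.ext this))

/-! ### Incidences between vertices, edges and faces -/

theorem one_le_finrank_vectorSpan {F : Set E3} {x y : E3} (hx : x ∈ F) (hy : y ∈ F)
    (hxy : x ≠ y) : 1 ≤ finrank ℝ (vectorSpan ℝ F) := by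
  rw [Nat.one_le_iff_ne_zero, Ne, Submodule.finrank_eq_zero]
  intro h
  have h1 := vsub_mem_vectorSpan ℝ hx hy
  rw [h, Submodule.mem_bot, vsub_eq_sub, sub_eq_zero] at h1
  exact hxy h1

theorem exists_ne_of_finrank_ne_zero {F : Set E3} (h : finrank ℝ (vectorSpan ℝ F) ≠ 0) :
    ∃ x ∈ F, ∃ y ∈ F, x ≠ y := by
  by_contra! hcon
  have hs : F.Subsingleton := fun x hx y hy => hcon x hx y hy
  rw [vectorSpan_of_subsingleton ℝ hs] at h
  simp at h

namespace ConvexPolyhedron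

variable {P : ConvexPolyhedron}

/-- The relative interior of a segment through a point passes into every face that contains the
point. -/
theorem exists_ne_of_notMem_vertices {p : E3} (hp : p ∈ P.carrier) (hpv : p ∉ P.vertices) :
    ∃ x, x ≠ p ∧ ∀ F, IsExposed ℝ P.carrier F → p ∈ F → x ∈ F := by
  rw [vertices, mem_extremePoints_iff_left] at hpv
  push Not at hpv
  obtain ⟨x, hx, y, hy, hxy, hne⟩ := hpv hp
  exact ⟨x, hne, fun F hF hpF => hF.isExtreme.2 hx hy hpF hxy⟩

theorem edge_eq_of_subset {e G : Set E3} (he : e ∈ P.edges) (hG : IsExposed ℝ P.carrier G)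
    {x y : E3} (hxe : x ∈ e) (hye : y ∈ e) (hxG : x ∈ G) (hyG : y ∈ G) (hxy : x ≠ y) :
    e ⊆ G := by
  have h := IsExposed.eq_of_subset_of_finrank_le he.2.1 (he.2.1.inter hG) ⟨x, hxe, hxG⟩
    inter_subset_left (he.2.2.le.trans (one_le_finrank_vectorSpan (⟨hxe, hxG⟩ : x ∈ e ∩ G)
      ⟨hye, hyG⟩ hxy))
  rw [h]
  exact inter_subset_right

theorem edge_eq_edge {e e' : Set E3} (he : e ∈ P.edges) (he' : e' ∈ P.edges)
    {x y : E3} (hxe : x ∈ e) (hye : y ∈ e) (hxe' : x ∈ e') (hye' : y ∈ e') (hxy : x ≠ y) :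
    e = e' :=
  (edge_eq_of_subset he he'.2.1 hxe hye hxe' hye' hxy).antisymm
    (edge_eq_of_subset he' he.2.1 hxe' hye' hxe hye hxy)

theorem edge_eq_edge_of_notMem_vertices {e e' : Set E3} (he : e ∈ P.edges) (he' : e' ∈ P.edges)
    {p : E3} (hp : p ∈ e) (hp' : p ∈ e') (hpv : p ∉ P.vertices) : e = e' := by
  obtain ⟨x, hxp, hx⟩ := exists_ne_of_notMem_vertices (he.2.1.subset hp) hpv
  exact edge_eq_edge he he' (hx e he.2.1 hp) hp (hx e' he'.2.1 hp') hp' hxp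

theorem inter_mem_edges {F F' : Set E3} (hF : F ∈ P.faces) (hF' : F' ∈ P.faces) (hne : F ≠ F')
    {x y : E3} (hx : x ∈ F ∩ F') (hy : y ∈ F ∩ F') (hxy : x ≠ y) : F ∩ F' ∈ P.edges := by
  have hexp := hF.2.1.inter hF'.2.1
  refine ⟨⟨x, hx⟩, hexp, le_antisymm ?_ (one_le_finrank_vectorSpan hx hy hxy)⟩
  by_contra! hcon
  refine hne ?_
  have h1 := IsExposed.eq_of_subset_of_finrank_le hF.2.1 hexp ⟨x, hx⟩ inter_subset_left
    (hF.2.2.le.trans hcon)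
  have h2 := IsExposed.eq_of_subset_of_finrank_le hF'.2.1 hexp ⟨x, hx⟩ inter_subset_right
    (hF'.2.2.le.trans hcon)
  rw [h1, ← h2]

theorem exists_mem_vertices {F : Set E3} (hF : IsExposed ℝ P.carrier F) (hne : F.Nonempty) :
    ∃ v ∈ F, v ∈ P.vertices := by
  obtain ⟨v, hv⟩ := (hF.isCompact P.isCompact).extremePoints_nonempty hne
  exact ⟨v, hv.1, hF.isExtreme.extremePoints_subset_extremePoints hv⟩

/-- An edge on which a linear form takes a value at two points is contained in a level set, and
hence has a vertex in it. -/
theorem exists_vertex_of_two_points {e : Set E3} (he : e ∈ P.edges) {u p q : E3}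
    (hp : p ∈ e) (hq : q ∈ e) (hpq : p ≠ q) (h : ⟪u, p⟫_ℝ = ⟪u, q⟫_ℝ) :
    ∃ v ∈ P.vertices, ⟪u, v⟫_ℝ = ⟪u, p⟫_ℝ := by
  obtain ⟨v, hve, hv⟩ := exists_mem_vertices he.2.1 he.1
  refine ⟨v, hv, ?_⟩
  have h1 := vsub_mem_vectorSpan ℝ hq hp
  have h2 := vsub_mem_vectorSpan ℝ hve hp
  obtain ⟨c, hc⟩ := (finrank_eq_one_iff_of_nonzero' (⟨_, h1⟩ : vectorSpan ℝ e) (by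
    intro h0
    rw [Submodule.mk_eq_zero, vsub_eq_sub, sub_eq_zero] at h0
    exact hpq h0.symm)).1 he.2.2 ⟨_, h2⟩
  have hc' : c • (q - p) = v - p := congrArg Subtype.val hc
  have h3 : ⟪u, v - p⟫_ℝ = 0 := by
    rw [← hc', inner_smul_right, inner_sub_right, h, sub_self, mul_zero]
  rw [inner_sub_right] at h3
  linarith

theorem exists_mem_edge_notMem_vertices {e : Set E3} (he : e ∈ P.edges) :
    ∃ p ∈ e, p ∉ P.vertices := by
  obtain ⟨x, hx, y, hy, hxy⟩ := exists_ne_of_finrank_ne_zero (F := e) (by rw [he.2.2]; norm_num)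
  have hm : midpoint ℝ x y ∈ openSegment ℝ x y := by
    refine ⟨1/2, 1/2, by norm_num, by norm_num, by norm_num, ?_⟩
    rw [midpoint_eq_smul_add]
    simp
  refine ⟨midpoint ℝ x y, he.2.1.convex P.convex |>.midpoint_mem hx hy, fun h => hxy ?_⟩
  have h1 := h.2 (he.2.1.subset hx) (he.2.1.subset hy) hm
  rwa [left_eq_midpoint_iff] at h1

end ConvexPolyhedron

/-- A `3 × 3` matrix with zero diagonal and negative entries off the diagonal is nonsingular. -/
theorem eq_zero_of_neg_relations {c₁ c₂ c₃ r₁₂ r₁₃ r₂₁ r₂₃ r₃₁ r₃₂ : ℝ}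
    (h₁₂ : r₁₂ < 0) (h₁₃ : r₁₃ < 0) (h₂₁ : r₂₁ < 0) (h₂₃ : r₂₃ < 0) (h₃₁ : r₃₁ < 0)
    (h₃₂ : r₃₂ < 0) (e₁ : c₂ * r₁₂ + c₃ * r₁₃ = 0) (e₂ : c₁ * r₂₁ + c₃ * r₂₃ = 0)
    (e₃ : c₁ * r₃₁ + c₂ * r₃₂ = 0) : c₁ = 0 ∧ c₂ = 0 ∧ c₃ = 0 := by
  have h1 : c₁ = 0 := by
    rcases lt_trichotomy c₁ 0 with h | h | h
    · have : 0 < c₃ := by by_contra! h'; nlinarith [mul_pos_of_neg_of_neg h h₂₁]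
      have : 0 < c₂ := by by_contra! h'; nlinarith [mul_pos_of_neg_of_neg h h₃₁]
      nlinarith
    · exact h
    · have : c₃ < 0 := by by_contra! h'; nlinarith [mul_neg_of_pos_of_neg h h₂₁]
      have : c₂ < 0 := by by_contra! h'; nlinarith [mul_neg_of_pos_of_neg h h₃₁]
      nlinarith
  subst h1
  refine ⟨rfl, ?_, ?_⟩
  · have : c₂ * r₃₂ = 0 := by linarith
    exact (mul_eq_zero.1 this).resolve_right h₃₂.ne
  · have : c₃ * r₂₃ = 0 := by linarith
    exact (mul_eq_zero.1 this).resolve_right h₂₃.ne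

/-- Four vectors of three-space are linearly dependent. -/
theorem exists_relation (z₁ z₂ z₃ w : E3) : ∃ c₁ c₂ c₃ c₄ : ℝ,
    c₁ • z₁ + c₂ • z₂ + c₃ • z₃ + c₄ • w = 0 ∧ ¬ (c₁ = 0 ∧ c₂ = 0 ∧ c₃ = 0 ∧ c₄ = 0) := by
  have h : ¬ LinearIndependent ℝ ![z₁, z₂, z₃, w] := fun h => by
    have := h.fintype_card_le_finrank
    simp at this
  rw [Fintype.not_linearIndependent_iff] at h
  obtain ⟨g, hg, i, hi⟩ := h
  refine ⟨g 0, g 1, g 2, g 3, by simpa [Fin.sum_univ_four] using hg, ?_⟩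
  rintro ⟨h0, h1, h2, h3⟩
  fin_cases i <;> simp_all

namespace IsRep

variable {ι : Type*} {P : ConvexPolyhedron} {a : ι → E3} {b : ι → ℝ}

theorem facet_mem_faces [Finite ι] (h : IsRep P a b) (i : ι) : facet a b i ∈ P.faces := by
  rw [h.faces_eq]; exact mem_range_self i

/-- Three faces have at most one point in common: two common points would span a line `d`, and
modulo `d` the faces would be three extreme rays of a convex cone in a plane. -/
theorem not_three_facets (h : IsRep P a b) {i j k : ι} (hij : i ≠ j) (hik : i ≠ k) (hjk : j ≠ k)
    {x y : E3} (hxy : x ≠ y) (hxi : ⟪a i, x⟫_ℝ = b i) (hxj : ⟪a j, x⟫_ℝ = b j)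
    (hxk : ⟪a k, x⟫_ℝ = b k) (hyi : ⟪a i, y⟫_ℝ = b i) (hyj : ⟪a j, y⟫_ℝ = b j)
    (hyk : ⟪a k, y⟫_ℝ = b k) : False := by
  obtain ⟨zi, hi, hi'⟩ := h.exists_relint i
  obtain ⟨zj, hj, hj'⟩ := h.exists_relint j
  obtain ⟨zk, hk, hk'⟩ := h.exists_relint k
  obtain ⟨c₁, c₂, c₃, c₄, hc, hne⟩ := exists_relation (zi - x) (zj - x) (zk - x) (y - x)
  have key : ∀ m, ⟪a m, x⟫_ℝ = b m → ⟪a m, y⟫_ℝ = b m →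
      c₁ * (⟪a m, zi⟫_ℝ - b m) + c₂ * (⟪a m, zj⟫_ℝ - b m) + c₃ * (⟪a m, zk⟫_ℝ - b m) = 0 := by
    intro m hx hy
    have := congrArg (fun w => ⟪a m, w⟫_ℝ) hc
    simp only [inner_add_right, inner_smul_right, inner_sub_right, hx, hy, inner_zero_right] at this
    linarith
  obtain ⟨h1, h2, h3⟩ := eq_zero_of_neg_relations (c₁ := c₁) (c₂ := c₂) (c₃ := c₃)
    (sub_neg.2 (hj' i hij)) (sub_neg.2 (hk' i hik)) (sub_neg.2 (hi' j hij.symm))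
    (sub_neg.2 (hk' j hjk)) (sub_neg.2 (hi' k hik.symm)) (sub_neg.2 (hj' k hjk.symm))
    (by have := key i hxi hyi; rw [hi] at this; linarith)
    (by have := key j hxj hyj; rw [hj] at this; linarith)
    (by have := key k hxk hyk; rw [hk] at this; linarith)
  subst h1 h2 h3
  have h4 : c₄ • (y - x) = 0 := by simpa using hc
  rcases smul_eq_zero.1 h4 with h5 | h5
  · exact hne ⟨rfl, rfl, rfl, h5⟩
  · exact hxy (sub_eq_zero.1 h5).symm

/-- At most two edges of a face pass through a given point. -/
theorem not_three_edges (h : IsRep P a b) {i j k l : ι} (hij : i ≠ j) (hik : i ≠ k) (hil : i ≠ l)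
    (hjk : j ≠ k) (hjl : j ≠ l) (hkl : k ≠ l) {v : E3} (hvi : v ∈ facet a b i)
    (hvj : ⟪a j, v⟫_ℝ = b j) (hvk : ⟪a k, v⟫_ℝ = b k) (hvl : ⟪a l, v⟫_ℝ = b l)
    (hj : ∃ y, y ≠ v ∧ y ∈ facet a b i ∧ ⟪a j, y⟫_ℝ = b j)
    (hk : ∃ y, y ≠ v ∧ y ∈ facet a b i ∧ ⟪a k, y⟫_ℝ = b k)
    (hl : ∃ y, y ≠ v ∧ y ∈ facet a b i ∧ ⟪a l, y⟫_ℝ = b l) : False := by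
  obtain ⟨yj, hj0, hj1, hj2⟩ := hj
  obtain ⟨yk, hk0, hk1, hk2⟩ := hk
  obtain ⟨yl, hl0, hl1, hl2⟩ := hl
  have strict : ∀ {m n : ι} {y : E3}, i ≠ m → i ≠ n → m ≠ n → ⟪a m, v⟫_ℝ = b m →
      ⟪a n, v⟫_ℝ = b n → y ≠ v → y ∈ facet a b i → ⟪a n, y⟫_ℝ = b n → ⟪a m, y⟫_ℝ - b m < 0 := by
    intro m n y him hin hmn hm hn hy0 hy1 hy2
    rw [sub_neg]
    refine lt_of_le_of_ne (hy1.1 m) fun hy3 => ?_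
    exact h.not_three_facets him hin hmn hy0 hy1.2 hy3 hy2 hvi.2 hm hn
  obtain ⟨c₁, c₂, c₃, c₄, hc, hne⟩ := exists_relation (yj - v) (yk - v) (yl - v) (a i)
  have h4 : c₄ = 0 := by
    have := congrArg (fun w => ⟪a i, w⟫_ℝ) hc
    simp only [inner_add_right, inner_smul_right, inner_sub_right, hj1.2, hk1.2, hl1.2, hvi.2,
      inner_zero_right, real_inner_self_eq_norm_sq, h.norm_eq] at this
    linarith
  have key : ∀ m, ⟪a m, v⟫_ℝ = b m →
      c₁ * (⟪a m, yj⟫_ℝ - b m) + c₂ * (⟪a m, yk⟫_ℝ - b m) + c₃ * (⟪a m, yl⟫_ℝ - b m) = 0 := by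
    intro m hv
    have := congrArg (fun w => ⟪a m, w⟫_ℝ) hc
    simp only [inner_add_right, inner_smul_right, inner_sub_right, hv, inner_zero_right, h4] at this
    linarith
  obtain ⟨h1, h2, h3⟩ := eq_zero_of_neg_relations (c₁ := c₁) (c₂ := c₂) (c₃ := c₃)
    (strict hij hik hjk hvj hvk hk0 hk1 hk2) (strict hij hil hjl hvj hvl hl0 hl1 hl2)
    (strict hik hij hjk.symm hvk hvj hj0 hj1 hj2) (strict hik hil hkl hvk hvl hl0 hl1 hl2)
    (strict hil hij hjl.symm hvl hvj hj0 hj1 hj2) (strict hil hik hkl.symm hvl hvk hk0 hk1 hk2)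
    (by have := key j hvj; rw [hj2] at this; linarith)
    (by have := key k hvk; rw [hk2] at this; linarith)
    (by have := key l hvl; rw [hl2] at this; linarith)
  exact hne ⟨h1, h2, h3, h4⟩

/-- Every point of a face of dimension at most one lies in at least two bounding planes. -/
theorem exists_ne_active [Finite ι] (h : IsRep P a b) {G : Set E3} (hG : IsExposed ℝ P.carrier G)
    (hd : finrank ℝ (vectorSpan ℝ G) ≤ 1) {p : E3} (hp : p ∈ G) (i : ι) :
    ∃ j, j ≠ i ∧ p ∈ facet a b j := by
  by_contra! hcon
  have hpP : p ∈ halfspaces a b := h.carrier_eq ▸ hG.subset hp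
  obtain ⟨l, hl⟩ := hG ⟨p, hp⟩
  have hp' := hp
  rw [hl, h.carrier_eq] at hp'
  have hle : ∀ w, (⟪a i, p⟫_ℝ = b i → ⟪a i, w⟫_ℝ = 0) → l w ≤ 0 := by
    intro w hw
    obtain ⟨ε, hε, hε'⟩ := exists_pos_add_smul_mem (w := w) hpP (fun j hj => by
      by_cases hji : j = i
      · subst hji; exact (hw hj).le
      · exact absurd ⟨hpP, hj⟩ (hcon j hji))
    have h2 := hp'.2 _ (hε' ε hε.le le_rfl)
    rw [map_add, map_smul, smul_eq_mul] at h2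
    by_contra! h3
    nlinarith [mul_pos hε h3]
  have hsub : facet a b i ⊆ G := by
    intro y hy
    have h1 := hle (p - y) (fun hpi => by rw [inner_sub_right, hpi, hy.2, sub_self])
    rw [hl, h.carrier_eq]
    rw [map_sub] at h1
    exact ⟨hy.1, fun z hz => by linarith [hp'.2 z hz]⟩
  have h1 := Submodule.finrank_mono (vectorSpan_mono ℝ hsub)
  rw [finrank_vectorSpan_facet (h.norm_eq i) (h.exists_relint i)] at h1
  omega

theorem edge_subset_facet [Finite ι] (h : IsRep P a b) {e : Set E3} (he : e ∈ P.edges) {p : E3}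
    (hp : p ∈ e) (hpv : p ∉ P.vertices) {i : ι} (hi : p ∈ facet a b i) : e ⊆ facet a b i := by
  have hexp := (h.facet_mem_faces i).2.1
  obtain ⟨x, hxp, hx⟩ := ConvexPolyhedron.exists_ne_of_notMem_vertices (he.2.1.subset hp) hpv
  exact ConvexPolyhedron.edge_eq_of_subset he hexp (hx e he.2.1 hp) hp (hx _ hexp hi) hi hxp

/-- Every edge is contained in exactly two faces. -/
theorem exists_two_facets [Finite ι] (h : IsRep P a b) {e : Set E3} (he : e ∈ P.edges) :
    ∃ i j, i ≠ j ∧ ∀ k, e ⊆ facet a b k ↔ k = i ∨ k = j := by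
  obtain ⟨p, hp, hpv⟩ := ConvexPolyhedron.exists_mem_edge_notMem_vertices he
  obtain ⟨i, hi⟩ := exists_subset_facet h.solid (h.carrier_eq ▸ he.2.1) he.1
    (he.2.2.le.trans (by norm_num))
  obtain ⟨j, hji, hj⟩ := h.exists_ne_active he.2.1 he.2.2.le hp i
  refine ⟨i, j, hji.symm, fun k => ⟨fun hk => ?_, ?_⟩⟩
  · by_contra! hcon
    obtain ⟨x, hx, y, hy, hxy⟩ := exists_ne_of_finrank_ne_zero (F := e)
      (by rw [he.2.2]; norm_num)
    have hej := h.edge_subset_facet he hp hpv hj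
    exact h.not_three_facets hcon.1 hcon.2 hji.symm hxy (hk hx).2 (hi hx).2 (hej hx).2
      (hk hy).2 (hi hy).2 (hej hy).2
  · rintro (rfl | rfl)
    · exact hi
    · exact h.edge_subset_facet he hp hpv hj

/-- A segment in a face that cannot be prolonged beyond a point `p`, not a vertex, in the direction
`d` ends on an edge of the face. -/
theorem exists_edge_of_blocked [Finite ι] (h : IsRep P a b) {i : ι} {p d : E3}
    (hp : p ∈ facet a b i) (hpv : p ∉ P.vertices) (hd : ⟪a i, d⟫_ℝ = 0)
    (hblock : ∀ ε : ℝ, 0 < ε → p + ε • d ∉ facet a b i) :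
    ∃ j, j ≠ i ∧ p ∈ facet a b j ∧ 0 < ⟪a j, d⟫_ℝ ∧ facet a b i ∩ facet a b j ∈ P.edges := by
  obtain ⟨j, hj, hjd⟩ : ∃ j, ⟪a j, p⟫_ℝ = b j ∧ 0 < ⟪a j, d⟫_ℝ := by
    by_contra! hcon
    obtain ⟨ε, hε, hε'⟩ := exists_pos_add_smul_mem hp.1 hcon
    refine hblock ε hε ⟨hε' ε hε.le le_rfl, ?_⟩
    rw [inner_add_right, inner_smul_right, hd, hp.2, mul_zero, add_zero]
  have hji : j ≠ i := by rintro rfl; exact hjd.ne' hd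
  have hpj : p ∈ facet a b j := ⟨hp.1, hj⟩
  refine ⟨j, hji, hpj, hjd, ?_⟩
  obtain ⟨x, hxp, hx⟩ := ConvexPolyhedron.exists_ne_of_notMem_vertices
    (h.carrier_eq ▸ hp.1) hpv
  exact ConvexPolyhedron.inter_mem_edges (h.facet_mem_faces i) (h.facet_mem_faces j)
    (fun he => hji (h.facet_injective he).symm)
    ⟨hx _ (h.facet_mem_faces i).2.1 hp, hx _ (h.facet_mem_faces j).2.1 hpj⟩ ⟨hp, hpj⟩ hxp

end IsRep

/-- The directions common to two planes that are not parallel form a line. -/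
theorem exists_common_direction {v u : E3} (hv : ‖v‖ = 1)
    (hu : ∃ w, ⟪v, w⟫_ℝ = 0 ∧ ⟪u, w⟫_ℝ ≠ 0) :
    ∃ d : E3, d ≠ 0 ∧ ⟪v, d⟫_ℝ = 0 ∧ ⟪u, d⟫_ℝ = 0 ∧
      ∀ w, ⟪v, w⟫_ℝ = 0 → ⟪u, w⟫_ℝ = 0 → ∃ c : ℝ, c • d = w := by
  obtain ⟨w, hw1, hw2⟩ := hu
  set V := LinearMap.ker (innerSL ℝ v : E3 →ₗ[ℝ] ℝ)
  set U := LinearMap.ker (innerSL ℝ u : E3 →ₗ[ℝ] ℝ)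
  have hV : finrank ℝ V = 2 := finrank_ker_eq_two (innerSL_ne_zero hv)
  have hU : finrank ℝ U = 2 := finrank_ker_eq_two fun h => hw2 (by
    have := congrArg (fun l : StrongDual ℝ E3 => l w) h
    simpa using this)
  have h1 := Submodule.finrank_sup_add_finrank_inf_eq V U
  have h2 := Submodule.finrank_le (V ⊔ U)
  have h3 : finrank ℝ E3 = 3 := by simp
  have h4 : finrank ℝ (V ⊓ U : Submodule ℝ E3) < finrank ℝ V := by
    refine Submodule.finrank_lt_finrank_of_lt (lt_of_le_of_ne inf_le_left fun h => ?_)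
    have : w ∈ V ⊓ U := h.ge (show w ∈ V from hw1)
    exact hw2 this.2
  have h5 : finrank ℝ (V ⊓ U : Submodule ℝ E3) = 1 := by omega
  obtain ⟨⟨d, hd⟩, hd0, hspan⟩ := finrank_eq_one_iff'.1 h5
  refine ⟨d, fun h => hd0 (by simpa using h), hd.1, hd.2, fun w hw hw' => ?_⟩
  obtain ⟨c, hc⟩ := hspan ⟨w, hw, hw'⟩
  exact ⟨c, congrArg Subtype.val hc⟩

open ConvexPolyhedron in
/-- A plane that contains no vertex and meets a face meets exactly two of its edges. -/
theorem IsRep.exists_two_edges {ι : Type*} [Finite ι] {P : ConvexPolyhedron} {a : ι → E3}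
    {b : ι → ℝ} (h : IsRep P a b) {u : E3} {s : ℝ} (hgen : ∀ v ∈ P.vertices, ⟪u, v⟫_ℝ ≠ s) {i : ι}
    (hs : ∃ x ∈ facet a b i, ⟪u, x⟫_ℝ = s) :
    ∃ e₁ e₂, e₁ ≠ e₂ ∧ ∀ e, (e ∈ P.edges ∧ e ⊆ facet a b i ∧ ∃ x ∈ e, ⟪u, x⟫_ℝ = s) ↔
      e = e₁ ∨ e = e₂ := by
  obtain ⟨x₀, hx₀, hs₀⟩ := hs
  have hFf := h.facet_mem_faces i
  have hFc : IsCompact (facet a b i) := hFf.2.1.isCompact P.isCompact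
  obtain ⟨v₀, hv₀F, hv₀⟩ := exists_mem_vertices hFf.2.1 hFf.1
  obtain ⟨d, hd0, hda, hdu, hspan⟩ := exists_common_direction (h.norm_eq i) (u := u)
    ⟨v₀ - x₀, by rw [inner_sub_right, hv₀F.2, hx₀.2, sub_self], by
      rw [inner_sub_right, hs₀]; exact sub_ne_zero.2 (hgen v₀ hv₀)⟩
  -- the plane meets the face in the segment of the points `f τ` with `τ₁ ≤ τ ≤ τ₂`, the end points
  -- of which lie on the two edges
  set f : ℝ → E3 := fun τ => x₀ + τ • d with hf
  have hfc : Continuous f := by fun_prop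
  have hfinj : Function.Injective f := fun τ σ hτσ => by
    have h1 : τ • d = σ • d := add_left_cancel hτσ
    exact smul_left_injective ℝ hd0 h1
  have hfu : ∀ τ, ⟪u, f τ⟫_ℝ = s := fun τ => by
    simp only [hf, inner_add_right, inner_smul_right, hdu, hs₀, mul_zero, add_zero]
  have hfa : ∀ τ, ⟪a i, f τ⟫_ℝ = b i := fun τ => by
    simp only [hf, inner_add_right, inner_smul_right, hda, hx₀.2, mul_zero, add_zero]
  set T : Set ℝ := f ⁻¹' facet a b i with hT
  have hTc : IsCompact T := by
    refine Metric.isCompact_of_isClosed_isBounded (hFc.isClosed.preimage hfc) ?_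
    obtain ⟨R, hR⟩ := hFc.isBounded.subset_closedBall x₀
    rw [isBounded_iff_forall_norm_le]
    refine ⟨R / ‖d‖, fun τ hτ => ?_⟩
    have := hR hτ
    rw [Metric.mem_closedBall, dist_eq_norm, hf] at this
    simp only [add_sub_cancel_left, norm_smul] at this
    rwa [le_div_iff₀ (norm_pos_iff.2 hd0)]
  have hTne : T.Nonempty := ⟨0, by simpa [hT, hf] using hx₀⟩
  have hnv : ∀ τ, f τ ∉ P.vertices := fun τ hτ => hgen _ hτ (hfu τ)
  obtain ⟨τ₁, hτ₁, hmin⟩ := hTc.exists_isLeast hTne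
  obtain ⟨τ₂, hτ₂, hmax⟩ := hTc.exists_isGreatest hTne
  obtain ⟨j, hji, hpj, hdj, hej⟩ := h.exists_edge_of_blocked hτ₂ (hnv τ₂) hda (fun ε hε hcon => by
    have : τ₂ + ε ∈ T := by
      simp only [hT, mem_preimage, hf]
      rwa [add_smul, ← add_assoc]
    linarith [hmax this])
  obtain ⟨k, hki, hpk, hdk, hek⟩ := h.exists_edge_of_blocked (d := -d) hτ₁ (hnv τ₁)
    (by rw [inner_neg_right, hda, neg_zero]) (fun ε hε hcon => by
    have : τ₁ - ε ∈ T := by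
      simp only [hT, mem_preimage, hf]
      rwa [sub_smul, sub_eq_add_neg, ← add_assoc, ← smul_neg]
    linarith [hmin this])
  have hjk : j ≠ k := by
    rintro rfl
    rw [inner_neg_right] at hdk
    linarith
  refine ⟨facet a b i ∩ facet a b j, facet a b i ∩ facet a b k, fun heq => ?_, fun e => ⟨?_, ?_⟩⟩
  rotate_left
  · rintro ⟨he, heF, p, hpe, hps⟩
    have hpF := heF hpe
    obtain ⟨τ, hτ⟩ := hspan (p - x₀) (by rw [inner_sub_right, hpF.2, hx₀.2, sub_self])
      (by rw [inner_sub_right, hps, hs₀, sub_self])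
    have hpτ : p = f τ := by simp only [hf]; rw [hτ]; abel
    subst hpτ
    have hτT : τ ∈ T := hpF
    rcases (hmin hτT).eq_or_lt with h1 | h1
    · subst h1
      exact Or.inr (edge_eq_edge_of_notMem_vertices he hek hpe ⟨hτ₁, hpk⟩ (hnv _))
    rcases (hmax hτT).eq_or_lt with h2 | h2
    · subst h2
      exact Or.inl (edge_eq_edge_of_notMem_vertices he hej hpe ⟨hτ₂, hpj⟩ (hnv _))
    exfalso
    have hop : f τ ∈ openSegment ℝ (f τ₁) (f τ₂) := by
      have h12 : 0 < τ₂ - τ₁ := by linarith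
      refine ⟨(τ₂ - τ) / (τ₂ - τ₁), (τ - τ₁) / (τ₂ - τ₁), div_pos (by linarith) h12,
        div_pos (by linarith) h12, by field_simp; ring, ?_⟩
      simp only [hf]
      match_scalars <;> field_simp <;> ring
    have h3 : f τ₁ ∈ e := he.2.1.isExtreme.2 (hFf.2.1.subset hτ₁) (hFf.2.1.subset hτ₂) hpe hop
    obtain ⟨v, hv, hvs⟩ := exists_vertex_of_two_points he h3 hpe (hfinj.ne h1.ne)
      ((hfu τ₁).trans (hfu τ).symm)
    exact hgen v hv (hvs.trans (hfu τ₁))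
  · rintro (rfl | rfl)
    · exact ⟨hej, inter_subset_left, _, ⟨hτ₂, hpj⟩, hfu τ₂⟩
    · exact ⟨hek, inter_subset_left, _, ⟨hτ₁, hpk⟩, hfu τ₁⟩
  · obtain ⟨x, hx, y, hy, hxy⟩ := exists_ne_of_finrank_ne_zero
      (F := facet a b i ∩ facet a b j) (by rw [hej.2.2]; norm_num)
    have hx' := hx
    have hy' := hy
    rw [heq] at hx' hy'
    exact h.not_three_facets hji.symm hki.symm hjk hxy hx.1.2 hx.2.2 hx'.2.2 hy.1.2 hy.2.2 hy'.2.2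

open ConvexPolyhedron in
open scoped Classical in
/-- A plane that contains no vertex meets as many edges as faces: the section is a polygon, with
as many vertices as sides. -/
theorem card_edges_eq_card_faces (P : ConvexPolyhedron) {u : E3} {s : ℝ}
    (hgen : ∀ v ∈ P.vertices, ⟪u, v⟫_ℝ ≠ s) :
    ((P.facesOfDim_finite 1).toFinset.filter fun e => ∃ x ∈ e, ⟪u, x⟫_ℝ = s).card =
      ((P.facesOfDim_finite 2).toFinset.filter fun F => ∃ x ∈ F, ⟪u, x⟫_ℝ = s).card := by
  obtain ⟨a, b, h⟩ := exists_isRep P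
  set E := (P.facesOfDim_finite 1).toFinset.filter fun e => ∃ x ∈ e, ⟪u, x⟫_ℝ = s with hE
  set F := (P.facesOfDim_finite 2).toFinset.filter fun F => ∃ x ∈ F, ⟪u, x⟫_ℝ = s with hF
  have key := Finset.sum_card_bipartiteAbove_eq_sum_card_bipartiteBelow (s := E) (t := F)
    (fun e F : Set E3 => e ⊆ F)
  have h1 : ∀ e ∈ E, (F.bipartiteAbove (fun e F : Set E3 => e ⊆ F) e).card = 2 := by
    intro e he
    rw [hE, Finset.mem_filter, Set.Finite.mem_toFinset] at he
    obtain ⟨he, x, hxe, hxs⟩ := he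
    obtain ⟨i, j, hij, hk⟩ := h.exists_two_facets he
    rw [Finset.card_eq_two]
    refine ⟨facet a b i, facet a b j, h.facet_injective.ne hij, ?_⟩
    ext G
    rw [Finset.mem_bipartiteAbove, hF, Finset.mem_filter, Set.Finite.mem_toFinset,
      Finset.mem_insert, Finset.mem_singleton]
    constructor
    · rintro ⟨⟨hG, -⟩, heG⟩
      obtain ⟨k, rfl⟩ : G ∈ range (facet a b) := h.faces_eq ▸ (show G ∈ P.faces from hG)
      rcases (hk k).1 heG with rfl | rfl
      · exact Or.inl rfl
      · exact Or.inr rfl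
    · rintro (rfl | rfl)
      · have := (hk i).2 (Or.inl rfl)
        exact ⟨⟨h.facet_mem_faces i, x, this hxe, hxs⟩, this⟩
      · have := (hk j).2 (Or.inr rfl)
        exact ⟨⟨h.facet_mem_faces j, x, this hxe, hxs⟩, this⟩
  have h2 : ∀ G ∈ F, (E.bipartiteBelow (fun e F : Set E3 => e ⊆ F) G).card = 2 := by
    intro G hG
    rw [hF, Finset.mem_filter, Set.Finite.mem_toFinset] at hG
    obtain ⟨hG, hGs⟩ := hG
    obtain ⟨i, rfl⟩ : G ∈ range (facet a b) := h.faces_eq ▸ (show G ∈ P.faces from hG)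
    obtain ⟨e₁, e₂, hne, he⟩ := h.exists_two_edges hgen hGs
    rw [Finset.card_eq_two]
    refine ⟨e₁, e₂, hne, ?_⟩
    ext e
    rw [Finset.mem_bipartiteBelow, hE, Finset.mem_filter, Set.Finite.mem_toFinset,
      Finset.mem_insert, Finset.mem_singleton, ← he e]
    exact ⟨fun h => ⟨h.1.1, h.2, h.1.2⟩, fun h => ⟨⟨h.1, h.2.2⟩, h.2.1⟩⟩
  rw [Finset.sum_congr rfl h1, Finset.sum_congr rfl h2, Finset.sum_const, Finset.sum_const,
    smul_eq_mul, smul_eq_mul] at key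
  omega

/-! ### Widths and the integral formula for the edge length -/

/-- The width of `F` in the direction `u`: the length of the smallest interval containing the
values of `⟪u, ·⟫` on `F`. It is used for nonempty compact sets `F`. -/
noncomputable def width (F : Set E3) (u : E3) : ℝ :=
  sSup ((fun x => ⟪u, x⟫_ℝ) '' F) - sInf ((fun x => ⟪u, x⟫_ℝ) '' F)

/-- The integral of the width over the directions in a ball. The radius `2` makes every unit
vector an interior point of the domain of integration. -/
noncomputable def meanWidth (F : Set E3) : ℝ := ∫ u in Metric.ball (0 : E3) 2, width F u

/-- The ratio of `meanWidth` to the length for segments. -/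
noncomputable def widthConst : ℝ :=
  ∫ u in Metric.ball (0 : E3) 2, |⟪u, EuclideanSpace.single 0 1⟫_ℝ|

theorem inner_sub_le_width {F : Set E3} (hF : IsCompact F) (u : E3) {x y : E3} (hx : x ∈ F)
    (hy : y ∈ F) : ⟪u, x - y⟫_ℝ ≤ width F u := by
  have hc : IsCompact ((fun x => ⟪u, x⟫_ℝ) '' F) := hF.image (by fun_prop)
  have h1 := le_csSup hc.bddAbove (mem_image_of_mem (fun x => ⟪u, x⟫_ℝ) hx)
  have h2 := csInf_le hc.bddBelow (mem_image_of_mem (fun x => ⟪u, x⟫_ℝ) hy)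
  rw [inner_sub_right, width]
  exact sub_le_sub h1 h2

theorem exists_width_eq {F : Set E3} (hF : IsCompact F) (hne : F.Nonempty) (u : E3) :
    ∃ x ∈ F, ∃ y ∈ F, width F u = ⟪u, x - y⟫_ℝ := by
  have hc : IsCompact ((fun x => ⟪u, x⟫_ℝ) '' F) := hF.image (by fun_prop)
  obtain ⟨x, hx, hx'⟩ := hc.sSup_mem (hne.image _)
  obtain ⟨y, hy, hy'⟩ := hc.sInf_mem (hne.image _)
  refine ⟨x, hx, y, hy, ?_⟩
  rw [width, ← hx', ← hy', inner_sub_right]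

theorem width_le {F : Set E3} (hF : IsCompact F) (hne : F.Nonempty) {u : E3} {c : ℝ}
    (h : ∀ x ∈ F, ∀ y ∈ F, ⟪u, x - y⟫_ℝ ≤ c) : width F u ≤ c := by
  obtain ⟨x, hx, y, hy, hxy⟩ := exists_width_eq hF hne u
  exact hxy ▸ h x hx y hy

theorem width_mono {F G : Set E3} (hF : IsCompact F) (hne : F.Nonempty) (hG : IsCompact G)
    (hFG : F ⊆ G) (u : E3) : width F u ≤ width G u :=
  width_le hF hne fun _ hx _ hy => inner_sub_le_width hG u (hFG hx) (hFG hy)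

theorem width_nonneg {F : Set E3} (hF : IsCompact F) (hne : F.Nonempty) (u : E3) :
    0 ≤ width F u := by
  obtain ⟨x, hx⟩ := hne
  simpa using inner_sub_le_width hF u hx hx

theorem image_inner_eq_Icc {F : Set E3} (hF : IsCompact F) (hne : F.Nonempty) (hc : Convex ℝ F)
    (u : E3) : (fun x => ⟪u, x⟫_ℝ) '' F =
      Icc (sInf ((fun x => ⟪u, x⟫_ℝ) '' F)) (sSup ((fun x => ⟪u, x⟫_ℝ) '' F)) :=
  eq_Icc_of_connected_compact
    ⟨hne.image _, hc.isPreconnected.image _ (by fun_prop)⟩ (hF.image (by fun_prop))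

theorem volume_image_inner {F : Set E3} (hF : IsCompact F) (hne : F.Nonempty) (hc : Convex ℝ F)
    (u : E3) : volume.real ((fun x => ⟪u, x⟫_ℝ) '' F) = width F u := by
  have h := image_inner_eq_Icc hF hne hc u
  have h2 := width_nonneg hF hne u
  rw [width] at h2 ⊢
  rw [h, Real.volume_real_Icc_of_le (by linarith), ← h]

theorem continuous_width {F : Set E3} (hF : IsCompact F) : Continuous (width F) := by
  unfold width
  exact (hF.continuous_sSup (f := fun u x : E3 => ⟪u, x⟫_ℝ) (by
      simp only [Function.HasUncurry.uncurry]; fun_prop)).sub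
    (hF.continuous_sInf (f := fun u x : E3 => ⟪u, x⟫_ℝ) (by
      simp only [Function.HasUncurry.uncurry]; fun_prop))

theorem integrableOn_ball {f : E3 → ℝ} (hf : Continuous f) (r : ℝ) :
    IntegrableOn f (Metric.ball (0 : E3) r) :=
  (hf.continuousOn.integrableOn_compact (isCompact_closedBall 0 r)).mono_set
    Metric.ball_subset_closedBall

/-- The left-hand side depends on `‖x‖` only, since a reflection carries any unit vector to any
other one. -/
theorem integral_abs_inner (x : E3) :
    ∫ u in Metric.ball (0 : E3) 2, |⟪u, x⟫_ℝ| = widthConst * ‖x‖ := by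
  rcases eq_or_ne x 0 with rfl | hx
  · simp
  have hx0 : 0 < ‖x‖ := norm_pos_iff.2 hx
  set e : E3 := EuclideanSpace.single 0 1 with he
  have hen : ‖e‖ = 1 := by simp [he]
  set w : E3 := ‖x‖⁻¹ • x with hw
  have hwn : ‖w‖ = 1 := by rw [hw, norm_smul, norm_inv, norm_norm, inv_mul_cancel₀ hx0.ne']
  set T := (Submodule.span ℝ {e - w})ᗮ.reflection with hT
  have hTe : T e = w := Submodule.reflection_sub (hen.trans hwn.symm)
  have h1 : ∀ u, |⟪u, x⟫_ℝ| = |⟪u, w⟫_ℝ| * ‖x‖ := fun u => by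
    rw [hw, inner_smul_right, abs_mul, abs_of_pos (inv_pos.2 hx0)]
    field_simp
  simp_rw [h1]
  rw [integral_mul_const]
  congr 1
  have hmp := T.measurePreserving
  have h2 := hmp.setIntegral_preimage_emb T.toHomeomorph.measurableEmbedding
    (fun u => |⟪u, w⟫_ℝ|) (Metric.ball 0 2)
  have h3 : T ⁻¹' Metric.ball 0 2 = Metric.ball 0 2 := by
    ext u; simp
  rw [h3] at h2
  rw [← h2, widthConst]
  congr 1
  ext u
  rw [← hTe, T.inner_map_map]

theorem widthConst_pos : 0 < widthConst := by
  rw [widthConst]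
  set e : E3 := EuclideanSpace.single 0 1 with he
  rw [setIntegral_pos_iff_support_of_nonneg_ae (Filter.Eventually.of_forall fun u => abs_nonneg _)
    (integrableOn_ball (by fun_prop) 2)]
  refine IsOpen.measure_pos volume (IsOpen.inter ?_ Metric.isOpen_ball) ⟨e, ?_, ?_⟩
  · exact isOpen_ne_fun (by fun_prop) continuous_const
  · simp [he]
  · simp [he]

theorem meanWidth_nonneg {F : Set E3} (hF : IsCompact F) (hne : F.Nonempty) : 0 ≤ meanWidth F :=
  integral_nonneg fun u => width_nonneg hF hne u

theorem exists_norm_sub_eq_diam {e : Set E3} (hc : IsCompact e) (hne : e.Nonempty) :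
    ∃ x ∈ e, ∃ y ∈ e, Metric.diam e = ‖x - y‖ ∧ ∀ z ∈ e, ∀ w ∈ e, ‖z - w‖ ≤ ‖x - y‖ := by
  obtain ⟨p, hp, hmax⟩ := (hc.prod hc).exists_isMaxOn (hne.prod hne)
    (f := fun p : E3 × E3 => dist p.1 p.2) continuous_dist.continuousOn
  have hmax' : ∀ z ∈ e, ∀ w ∈ e, dist z w ≤ dist p.1 p.2 := fun z hz w hw =>
    isMaxOn_iff.1 hmax (z, w) (mk_mem_prod hz hw)
  refine ⟨p.1, hp.1, p.2, hp.2, ?_, fun z hz w hw => ?_⟩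
  · rw [← dist_eq_norm]
    exact le_antisymm (Metric.diam_le_of_forall_dist_le dist_nonneg hmax')
      (Metric.dist_le_diam_of_mem hc.isBounded hp.1 hp.2)
  · rw [← dist_eq_norm, ← dist_eq_norm]
    exact hmax' z hz w hw

namespace ConvexPolyhedron

variable {P : ConvexPolyhedron}

theorem isCompact_of_mem_facesOfDim {d : ℕ} {F : Set E3} (hF : F ∈ P.facesOfDim d) :
    IsCompact F := hF.2.1.isCompact P.isCompact

theorem meanWidth_edge {e : Set E3} (he : e ∈ P.edges) :
    meanWidth e = widthConst * Metric.diam e := by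
  have hc : IsCompact e := isCompact_of_mem_facesOfDim he
  obtain ⟨z, hz, w, hw, hzw⟩ := exists_ne_of_finrank_ne_zero (F := e) (by rw [he.2.2]; norm_num)
  obtain ⟨x, hx, y, hy, hdiam, hmax⟩ := exists_norm_sub_eq_diam hc he.1
  have hxy : x ≠ y := fun h => by
    have := hmax z hz w hw
    rw [h, sub_self, norm_zero] at this
    exact hzw (sub_eq_zero.1 (norm_le_zero_iff.1 this))
  rw [hdiam, ← integral_abs_inner, meanWidth]
  congr 1
  ext u
  refine le_antisymm (width_le hc he.1 fun z hz w hw => ?_) (abs_le'.2 ⟨?_, ?_⟩)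
  · obtain ⟨c, hc'⟩ := (finrank_eq_one_iff_of_nonzero'
      (⟨_, vsub_mem_vectorSpan ℝ hx hy⟩ : vectorSpan ℝ e) (by
        intro h0
        rw [Submodule.mk_eq_zero, vsub_eq_sub, sub_eq_zero] at h0
        exact hxy h0)).1 he.2.2 ⟨_, vsub_mem_vectorSpan ℝ hz hw⟩
    have hc'' : c • (x - y) = z - w := congrArg Subtype.val hc'
    have h1 := hmax z hz w hw
    rw [← hc'', norm_smul] at h1
    have h2 : |c| ≤ 1 := by
      have : 0 < ‖x - y‖ := norm_pos_iff.2 (sub_ne_zero.2 hxy)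
      rw [Real.norm_eq_abs] at h1
      by_contra! h3
      nlinarith
    rw [← hc'', inner_smul_right]
    calc c * ⟪u, x - y⟫_ℝ ≤ |c * ⟪u, x - y⟫_ℝ| := le_abs_self _
      _ = |c| * |⟪u, x - y⟫_ℝ| := abs_mul _ _
      _ ≤ 1 * |⟪u, x - y⟫_ℝ| := by gcongr
      _ = _ := one_mul _
  · exact inner_sub_le_width hc u hx hy
  · rw [← inner_neg_right, neg_sub]
    exact inner_sub_le_width hc u hy hx

open scoped Classical in
/-- The width of a face of any dimension is the measure of the set of levels at which the planes
orthogonal to `u` meet it. Almost every such plane contains no vertex and hence meets as many edges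
as two-dimensional faces. -/
theorem sum_width_edges_eq_sum_width_faces (P : ConvexPolyhedron) (u : E3) :
    ∑ e ∈ (P.facesOfDim_finite 1).toFinset, width e u =
      ∑ F ∈ (P.facesOfDim_finite 2).toFinset, width F u := by
  have key : ∀ d, ∑ F ∈ (P.facesOfDim_finite d).toFinset, width F u =
      ∫ s, (((P.facesOfDim_finite d).toFinset.filter fun F => ∃ x ∈ F, ⟪u, x⟫_ℝ = s).card : ℝ) := by
    intro d
    have hmem : ∀ F ∈ (P.facesOfDim_finite d).toFinset, F ∈ P.facesOfDim d := fun F hF => by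
      simpa using hF
    have h1 : ∀ s : ℝ, (((P.facesOfDim_finite d).toFinset.filter
        fun F => ∃ x ∈ F, ⟪u, x⟫_ℝ = s).card : ℝ) =
        ∑ F ∈ (P.facesOfDim_finite d).toFinset,
          ((fun x => ⟪u, x⟫_ℝ) '' F).indicator (fun _ => (1 : ℝ)) s := by
      intro s
      rw [Finset.card_filter, Nat.cast_sum]
      refine Finset.sum_congr rfl fun F _ => ?_
      rw [indicator_apply]
      simp only [mem_image, Nat.cast_ite, Nat.cast_one, Nat.cast_zero]
    simp_rw [h1]
    have hms : ∀ F ∈ (P.facesOfDim_finite d).toFinset,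
        IsCompact ((fun x => ⟪u, x⟫_ℝ) '' F) := fun F hF =>
      (isCompact_of_mem_facesOfDim (hmem F hF)).image (by fun_prop)
    rw [integral_finsetSum]
    · refine Finset.sum_congr rfl fun F hF => ?_
      have hF' := hmem F hF
      rw [integral_indicator (hms F hF).measurableSet, setIntegral_const, smul_eq_mul, mul_one,
        volume_image_inner (isCompact_of_mem_facesOfDim hF') hF'.1 (hF'.2.1.convex P.convex)]
    · intro F hF
      rw [integrable_indicator_iff (hms F hF).measurableSet]
      exact integrableOn_const (hms F hF).measure_lt_top.ne
  rw [key, key]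
  refine integral_congr_ae ?_
  have hnull : volume ((fun x => ⟪u, x⟫_ℝ) '' P.vertices) = 0 :=
    (P.finite_vertices.image _).measure_zero volume
  filter_upwards [measure_eq_zero_iff_ae_notMem.1 hnull] with s hs
  rw [card_edges_eq_card_faces P fun v hv h => hs ⟨v, hv, h⟩]

/-- The integral formula for the edge length: up to a constant, the total length of the edges is
the sum over the faces of their mean widths. It expresses the edge length through the faces alone,
without reference to the incidences between them. -/
theorem widthConst_mul_edgeLength (P : ConvexPolyhedron) :
    widthConst * P.edgeLength = ∑ᶠ F ∈ P.faces, meanWidth F := by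
  have hE := P.facesOfDim_finite 1
  have hF := P.facesOfDim_finite 2
  have h0 : P.edges = P.facesOfDim 1 := rfl
  rw [edgeLength, finsum_mem_congr h0 (fun _ _ => rfl), finsum_mem_eq_finite_toFinset_sum _ hE,
    Finset.mul_sum]
  have h1 : P.faces = P.facesOfDim 2 := rfl
  rw [finsum_mem_congr h1 (fun _ _ => rfl), finsum_mem_eq_finite_toFinset_sum _ hF]
  have h2 : ∀ d, ∀ F ∈ (P.facesOfDim_finite d).toFinset,
      IntegrableOn (width F) (Metric.ball (0 : E3) 2) := fun d F hF => by
    refine integrableOn_ball (continuous_width ?_) 2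
    exact isCompact_of_mem_facesOfDim (by simpa using hF : F ∈ P.facesOfDim d)
  calc ∑ e ∈ hE.toFinset, widthConst * Metric.diam e = ∑ e ∈ hE.toFinset, meanWidth e :=
        Finset.sum_congr rfl fun e he => (meanWidth_edge (hE.mem_toFinset.1 he)).symm
    _ = ∫ u in Metric.ball (0 : E3) 2, ∑ e ∈ hE.toFinset, width e u :=
        (integral_finsetSum _ (h2 1)).symm
    _ = ∫ u in Metric.ball (0 : E3) 2, ∑ F ∈ hF.toFinset, width F u := by
        simp_rw [P.sum_width_edges_eq_sum_width_faces]
    _ = ∑ F ∈ hF.toFinset, meanWidth F := integral_finsetSum _ (h2 2)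

end ConvexPolyhedron

theorem IsRep.widthConst_mul_edgeLength {ι : Type*} [Fintype ι] {P : ConvexPolyhedron}
    {a : ι → E3} {b : ι → ℝ} (h : IsRep P a b) :
    widthConst * P.edgeLength = ∑ i, meanWidth (facet a b i) := by
  rw [P.widthConst_mul_edgeLength, h.finsum_faces]

/-! ### Vertices of degree three -/

theorem exists_ne_zero_inner_eq_zero {ι : Type*} (a : ι → E3) (s : Finset ι) (hs : s.card ≤ 2) :
    ∃ w : E3, w ≠ 0 ∧ ∀ i ∈ s, ⟪a i, w⟫_ℝ = 0 := by
  let f : E3 →ₗ[ℝ] (s → ℝ) := LinearMap.pi fun i => (innerSL ℝ (a i) : E3 →ₗ[ℝ] ℝ)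
  have h1 : LinearMap.ker f ≠ ⊥ := by
    refine LinearMap.ker_ne_bot_of_finrank_lt ?_
    simp
    omega
  obtain ⟨w, hw, hw0⟩ := Submodule.exists_mem_ne_zero_of_ne_bot h1
  exact ⟨w, hw0, fun i hi => congrFun (LinearMap.mem_ker.1 hw) ⟨i, hi⟩⟩

namespace IsRep

variable {ι : Type*} {P : ConvexPolyhedron} {a : ι → E3} {b : ι → ℝ}

/-- A vertex lies in at least three faces. -/
theorem exists_active_notMem [Finite ι] (h : IsRep P a b) {v : E3} (hv : v ∈ P.vertices)
    (s : Finset ι) (hs : s.card ≤ 2) : ∃ k ∉ s, v ∈ facet a b k := by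
  by_contra! hcon
  obtain ⟨w, hw0, hw⟩ := exists_ne_zero_inner_eq_zero a s hs
  have hvP : v ∈ halfspaces a b := h.carrier_eq ▸ hv.1
  have hz : ∀ i, ⟪a i, v⟫_ℝ = b i → ⟪a i, w⟫_ℝ = 0 := fun i hi => by
    by_contra h0
    exact hcon i (fun his => h0 (hw i his)) ⟨hvP, hi⟩
  obtain ⟨ε, hε, h1⟩ := exists_pos_add_smul_mem hvP (fun i hi => (hz i hi).le)
  obtain ⟨δ, hδ, h2⟩ := exists_pos_add_smul_mem (w := -w) hvP
    (fun i hi => by rw [inner_neg_right, hz i hi, neg_zero])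
  have hm : 0 < min ε δ := lt_min hε hδ
  have h1 := h1 _ hm.le (min_le_left _ _)
  have h2 := h2 _ hm.le (min_le_right _ _)
  rw [← h.carrier_eq] at h1 h2
  have h3 := hv.2 h1 h2 ⟨1/2, 1/2, by norm_num, by norm_num, by norm_num, by module⟩
  rw [add_eq_left, smul_eq_zero] at h3
  exact h3.elim hm.ne' hw0

/-- If the faces at a vertex pairwise share an edge, there are only three of them, since no more
than two edges of a face pass through the vertex, and the degree is three. -/
theorem exists_facets_inter_eq_singleton [Finite ι] (h : IsRep P a b) {v : E3}
    (hv : v ∈ P.vertices) (hdeg : P.degree v ≠ 3) :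
    ∃ i j, i ≠ j ∧ facet a b i ∩ facet a b j = {v} := by
  classical
  by_contra! hcon
  have hshare : ∀ i j, i ≠ j → v ∈ facet a b i → v ∈ facet a b j →
      ∃ y, y ≠ v ∧ y ∈ facet a b i ∩ facet a b j := by
    intro i j hij hi hj
    by_contra! hc
    exact hcon i j hij (Subset.antisymm (fun y hy => by_contra fun hne => hc y hne hy)
      (singleton_subset_iff.2 ⟨hi, hj⟩))
  obtain ⟨i, -, hi⟩ := h.exists_active_notMem hv ∅ (by simp)
  obtain ⟨j, hji, hj⟩ := h.exists_active_notMem hv {i} (by simp)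
  obtain ⟨k, hk', hk⟩ := h.exists_active_notMem hv {i, j} Finset.card_le_two
  rw [Finset.mem_singleton] at hji
  rw [Finset.mem_insert, Finset.mem_singleton, not_or] at hk'
  obtain ⟨hki, hkj⟩ := hk'
  have hall : ∀ l, v ∈ facet a b l → l = i ∨ l = j ∨ l = k := by
    intro l hl
    by_contra! hc
    have hsh : ∀ m, i ≠ m → v ∈ facet a b m →
        ∃ y, y ≠ v ∧ y ∈ facet a b i ∧ ⟪a m, y⟫_ℝ = b m := fun m him hm => by
      obtain ⟨y, hy, hy1, hy2⟩ := hshare i m him hi hm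
      exact ⟨y, hy, hy1, hy2.2⟩
    exact h.not_three_edges (Ne.symm hji) (Ne.symm hki) hc.1.symm (Ne.symm hkj) hc.2.1.symm
      hc.2.2.symm hi hj.2 hk.2 hl.2 (hsh j (Ne.symm hji) hj) (hsh k (Ne.symm hki) hk)
      (hsh l hc.1.symm hl)
  have hedge : ∀ m n, m ≠ n → v ∈ facet a b m → v ∈ facet a b n →
      facet a b m ∩ facet a b n ∈ P.edges := fun m n hmn hm hn => by
    obtain ⟨y, hy, hy'⟩ := hshare m n hmn hm hn
    exact ConvexPolyhedron.inter_mem_edges (h.facet_mem_faces m) (h.facet_mem_faces n)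
      (h.facet_injective.ne hmn) hy' ⟨hm, hn⟩ hy
  have hdiff : ∀ l m n, l ≠ m → l ≠ n → m ≠ n → v ∈ facet a b l → v ∈ facet a b m →
      v ∈ facet a b n → facet a b l ∩ facet a b m ≠ facet a b l ∩ facet a b n := by
    intro l m n hlm hln hmn hl hm hn heq
    obtain ⟨y, hy, hy'⟩ := hshare l m hlm hl hm
    have hy'' := hy'
    rw [heq] at hy''
    exact h.not_three_facets hlm hln hmn hy hy'.1.2 hy'.2.2 hy''.2.2 hl.2 hm.2 hn.2
  refine hdeg ?_
  rw [ConvexPolyhedron.degree, ncard_eq_three]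
  refine ⟨facet a b i ∩ facet a b j, facet a b i ∩ facet a b k, facet a b j ∩ facet a b k,
    hdiff i j k (Ne.symm hji) (Ne.symm hki) (Ne.symm hkj) hi hj hk, ?_, ?_, ?_⟩
  · rw [inter_comm (facet a b i)]
    exact hdiff j i k hji (Ne.symm hkj) (Ne.symm hki) hj hi hk
  · rw [inter_comm (facet a b i), inter_comm (facet a b j)]
    exact hdiff k i j hki hkj (Ne.symm hji) hk hi hj
  ext e
  simp only [mem_ofPred_eq, mem_insert_iff, mem_singleton_iff]
  constructor
  · rintro ⟨he, hve⟩
    obtain ⟨m, n, hmn, hsub⟩ := h.exists_two_facets he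
    have hm := (hsub m).2 (Or.inl rfl)
    have hn := (hsub n).2 (Or.inr rfl)
    obtain ⟨x, hx, y, hy, hxy⟩ := exists_ne_of_finrank_ne_zero (F := e)
      (by rw [he.2.2]; norm_num)
    have heq := ConvexPolyhedron.edge_eq_edge he (hedge m n hmn (hm hve) (hn hve)) hx hy
      ⟨hm hx, hn hx⟩ ⟨hm hy, hn hy⟩ hxy
    subst heq
    rcases hall m (hm hve) with rfl | rfl | rfl <;> rcases hall n (hn hve) with rfl | rfl | rfl
    all_goals first
      | exact absurd rfl hmn
      | simp [inter_comm]
  · rintro (rfl | rfl | rfl)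
    · exact ⟨hedge i j (Ne.symm hji) hi hj, hi, hj⟩
    · exact ⟨hedge i k (Ne.symm hki) hi hk, hi, hk⟩
    · exact ⟨hedge j k (Ne.symm hkj) hj hk, hj, hk⟩

end IsRep

/-! ### Moving one face -/

theorem isOpen_strict {ι : Type*} [Finite ι] (a : ι → E3) (b : ι → ℝ) :
    IsOpen {x : E3 | ∀ i, ⟪a i, x⟫_ℝ < b i} := by
  have : {x : E3 | ∀ i, ⟪a i, x⟫_ℝ < b i} = ⋂ i, {x | ⟪a i, x⟫_ℝ < b i} := by
    ext x; simp
  rw [this]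
  exact isOpen_iInter_of_finite fun i => isOpen_lt (by fun_prop) continuous_const

theorem interior_halfspaces_nonempty {ι : Type*} [Finite ι] {a : ι → E3} {b : ι → ℝ} {p : E3}
    (hp : ∀ i, ⟪a i, p⟫_ℝ < b i) : (interior (halfspaces a b)).Nonempty :=
  ⟨p, interior_maximal (fun _ hx i => (hx i).le) (isOpen_strict a b) hp⟩

theorem volume_real_image_homothety (c : E3) {r : ℝ} (hr : 0 ≤ r) (s : Set E3) :
    volume.real (AffineMap.homothety c r '' s) = r ^ 3 * volume.real s := by
  have h3 : finrank ℝ E3 = 3 := by simp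
  rw [Measure.real, Measure.addHaar_image_homothety, h3, ENNReal.toReal_mul,
    ENNReal.toReal_ofReal (abs_nonneg _), abs_of_nonneg (by positivity), Measure.real]

/-- The right-hand sides after the plane number `i₀` has been moved outwards by `t`. -/
def shift {ι : Type*} [DecidableEq ι] (b : ι → ℝ) (i₀ : ι) (t : ℝ) (i : ι) : ℝ :=
  if i = i₀ then b i + t else b i

section shift

variable {ι : Type*} [DecidableEq ι] {b : ι → ℝ} {i₀ : ι} {t : ℝ}

@[simp] theorem shift_self : shift b i₀ t i₀ = b i₀ + t := if_pos rfl

theorem shift_of_ne {i : ι} (h : i ≠ i₀) : shift b i₀ t i = b i := if_neg h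

theorem shift_le (i : ι) (ht : 0 ≤ t) : b i ≤ shift b i₀ t i := by
  unfold shift; split_ifs <;> linarith

theorem shift_neg_le (i : ι) (ht : 0 ≤ t) : shift b i₀ (-t) i ≤ b i := by
  unfold shift; split_ifs <;> linarith

theorem shift_add_shift_neg (i : ι) : shift b i₀ t i + shift b i₀ (-t) i = 2 * b i := by
  unfold shift; split_ifs <;> ring

end shift

theorem halfspaces_mono {ι : Type*} (a : ι → E3) {b b' : ι → ℝ} (h : ∀ i, b i ≤ b' i) :
    halfspaces a b ⊆ halfspaces a b' := fun _ hx i => (hx i).trans (h i)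

namespace IsRep

variable {ι : Type*} {P : ConvexPolyhedron} {a : ι → E3} {b : ι → ℝ}

theorem exists_strict (h : IsRep P a b) : ∃ p, ∀ i, ⟪a i, p⟫_ℝ < b i := by
  obtain ⟨p, hp⟩ := h.solid
  exact ⟨p, fun i => inner_lt_of_mem_interior (h.norm_eq i)
    (fun x (hx : x ∈ halfspaces a b) => hx i) hp⟩

theorem isCompact_facet [Finite ι] (h : IsRep P a b) (i : ι) : IsCompact (facet a b i) :=
  ConvexPolyhedron.isCompact_of_mem_facesOfDim (h.facet_mem_faces i)

theorem facet_nonempty [Finite ι] (h : IsRep P a b) (i : ι) : (facet a b i).Nonempty :=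
  (h.facet_mem_faces i).1

theorem vol_eq (h : IsRep P a b) : P.vol = volume.real (halfspaces a b) := by
  rw [ConvexPolyhedron.vol, h.carrier_eq]

variable [DecidableEq ι]

/-- Moving a face slightly does not change the number of faces. -/
theorem eventually_isRep_shift [Finite ι] (h : IsRep P a b) (i₀ : ι) :
    ∀ᶠ t in 𝓝 (0 : ℝ), ∃ Q : ConvexPolyhedron, IsRep Q a (shift b i₀ t) := by
  have hcont : ∀ i, Tendsto (fun t => shift b i₀ t i) (𝓝 0) (𝓝 (b i)) := by
    intro i
    unfold shift
    split_ifs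
    · have : Continuous fun t : ℝ => b i + t := by fun_prop
      simpa using this.tendsto 0
    · exact tendsto_const_nhds
  obtain ⟨p, hp⟩ := h.exists_strict
  choose x hxi hxj using h.exists_relint
  have e1 : ∀ᶠ t in 𝓝 (0 : ℝ), ∀ i, ⟪a i, p⟫_ℝ < shift b i₀ t i :=
    eventually_all.2 fun i => (hcont i).eventually_const_lt (hp i)
  have e2 : ∀ᶠ t in 𝓝 (0 : ℝ), ∀ i, shift b i₀ t i < 2 * b i - ⟪a i, p⟫_ℝ :=
    eventually_all.2 fun i => (hcont i).eventually_lt_const (by linarith [hp i])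
  have e3 : ∀ᶠ t in 𝓝 (0 : ℝ), ∀ i j, j ≠ i → ⟪a j, x i⟫_ℝ < shift b i₀ t j :=
    eventually_all.2 fun i => eventually_all.2 fun j => by
      by_cases hji : j = i
      · exact Eventually.of_forall fun t hne => absurd hji hne
      · filter_upwards [(hcont j).eventually_const_lt (hxj i j hji)] with t ht _ using ht
  have e4 : ∀ᶠ t in 𝓝 (0 : ℝ), ∀ j, j ≠ i₀ → ⟪a j, x i₀ + t • a i₀⟫_ℝ < b j :=
    eventually_all.2 fun j => by
      by_cases hji : j = i₀
      · exact Eventually.of_forall fun t hne => absurd hji hne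
      · have hc : Continuous fun t : ℝ => ⟪a j, x i₀ + t • a i₀⟫_ℝ := by fun_prop
        have := (hc.tendsto 0).eventually_lt_const (u := b j) (by simpa using hxj i₀ j hji)
        filter_upwards [this] with t ht _ using ht
  filter_upwards [e1, e2, e3, e4] with t h1 h2 h3 h4
  have hbd : Bornology.IsBounded (halfspaces a (shift b i₀ t)) := by
    obtain ⟨R, hR⟩ := P.isCompact.isBounded.subset_closedBall p
    refine (Metric.isBounded_closedBall (x := p) (r := 2 * R)).subset fun y hy => ?_
    -- the contraction towards `p` with ratio `1 / 2` maps the new polyhedron into the old one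
    have hyP : p + (1 / 2 : ℝ) • (y - p) ∈ P.carrier := by
      rw [h.carrier_eq]
      intro i
      rw [inner_add_right, inner_smul_right, inner_sub_right]
      linarith [hy i, h2 i]
    have := hR hyP
    rw [Metric.mem_closedBall, dist_eq_norm, add_sub_cancel_left, norm_smul] at this
    rw [Metric.mem_closedBall, dist_eq_norm]
    norm_num at this
    linarith
  refine ⟨ofHalfspaces a (shift b i₀ t) hbd (interior_halfspaces_nonempty h1), rfl, h.norm_eq,
    fun i => ?_⟩
  by_cases hi : i = i₀
  · subst hi
    refine ⟨x i + t • a i, ?_, fun j hj => ?_⟩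
    · rw [inner_add_right, inner_smul_right, hxi, real_inner_self_eq_norm_sq, h.norm_eq,
        shift_self]
      ring
    · rw [shift_of_ne hj]
      exact h4 j hj
  · exact ⟨x i, by rw [shift_of_ne hi, hxi], h3 i⟩

/-- Pushing a face inwards by `t` loses a volume of order `t` at most. -/
theorem exists_volume_shift_neg_ge [Finite ι] (h : IsRep P a b) (i₀ : ι) :
    ∃ K : ℝ, 0 < K ∧ ∀ t, 0 ≤ t → K * t ≤ 1 →
      (1 - K * t) ^ 3 * P.vol ≤ volume.real (halfspaces a (shift b i₀ (-t))) := by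
  obtain ⟨p, hp⟩ := h.exists_strict
  have hr : 0 < b i₀ - ⟪a i₀, p⟫_ℝ := by linarith [hp i₀]
  refine ⟨(b i₀ - ⟪a i₀, p⟫_ℝ)⁻¹, by positivity, fun t ht hKt => ?_⟩
  set r := b i₀ - ⟪a i₀, p⟫_ℝ with hrdef
  have hrt : r * (r⁻¹ * t) = t := by field_simp
  rw [ConvexPolyhedron.vol, ← volume_real_image_homothety p (by linarith)]
  have hb : Bornology.IsBounded (halfspaces a (shift b i₀ (-t))) := by
    refine P.isCompact.isBounded.subset ?_
    rw [h.carrier_eq]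
    exact halfspaces_mono a fun i => shift_neg_le i ht
  refine measureReal_mono ?_ hb.measure_lt_top.ne
  rintro _ ⟨x, hx, rfl⟩ i
  rw [h.carrier_eq] at hx
  rw [AffineMap.homothety_apply, vsub_eq_sub, vadd_eq_add, inner_add_right, inner_smul_right,
    inner_sub_right]
  have h1 := hx i
  have h0 : 0 ≤ r⁻¹ * t := by positivity
  have h2 : (1 - r⁻¹ * t) * (⟪a i, x⟫_ℝ - ⟪a i, p⟫_ℝ) ≤
      (1 - r⁻¹ * t) * (b i - ⟪a i, p⟫_ℝ) :=
    mul_le_mul_of_nonneg_left (by linarith) (by linarith)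
  by_cases hi : i = i₀
  · subst hi
    rw [shift_self]
    nlinarith
  · rw [shift_of_ne hi]
    nlinarith [mul_nonneg h0 (sub_nonneg.2 (hp i).le)]

/-- Pushing a face outwards by `t` gains at least the volume lost by pushing it inwards, up to
a factor `(1 - C * t) ^ 3`: a homothety maps the slab that is cut off into the slab that is
added. -/
theorem exists_volume_shift_ge [Finite ι] (h : IsRep P a b) (i₀ : ι) :
    ∃ C : ℝ, 0 < C ∧ ∀ t, 0 ≤ t → C * t ≤ 1 →
      Bornology.IsBounded (halfspaces a (shift b i₀ t)) →
      (1 - C * t) ^ 3 * (P.vol - volume.real (halfspaces a (shift b i₀ (-t)))) ≤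
        volume.real (halfspaces a (shift b i₀ t)) - P.vol := by
  cases nonempty_fintype ι
  obtain ⟨z, hz, hzj⟩ := h.exists_relint i₀
  obtain ⟨C, hC, hCj⟩ : ∃ C : ℝ, 0 < C ∧ ∀ j, j ≠ i₀ → 1 ≤ C * (b j - ⟪a j, z⟫_ℝ) := by
    have hpos : ∀ j, j ≠ i₀ → 0 < b j - ⟪a j, z⟫_ℝ := fun j hj => by linarith [hzj j hj]
    refine ⟨1 + ∑ j, |b j - ⟪a j, z⟫_ℝ|⁻¹, by positivity, fun j hj => ?_⟩
    have h1 : |b j - ⟪a j, z⟫_ℝ|⁻¹ ≤ ∑ j, |b j - ⟪a j, z⟫_ℝ|⁻¹ :=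
      Finset.single_le_sum (f := fun j => |b j - ⟪a j, z⟫_ℝ|⁻¹) (fun _ _ => by positivity)
        (Finset.mem_univ j)
    rw [abs_of_pos (hpos j hj)] at h1
    calc (1 : ℝ) = (b j - ⟪a j, z⟫_ℝ)⁻¹ * (b j - ⟪a j, z⟫_ℝ) :=
          (inv_mul_cancel₀ (hpos j hj).ne').symm
      _ ≤ _ := mul_le_mul_of_nonneg_right (by linarith) (hpos j hj).le
  refine ⟨C, hC, fun t ht hCt hbd => ?_⟩
  have hPb : Bornology.IsBounded (halfspaces a b) := h.carrier_eq ▸ P.isCompact.isBounded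
  have hsub1 : halfspaces a b ⊆ halfspaces a (shift b i₀ t) :=
    halfspaces_mono a fun i => shift_le i ht
  have hsub2 : halfspaces a (shift b i₀ (-t)) ⊆ halfspaces a b :=
    halfspaces_mono a fun i => shift_neg_le i ht
  rw [h.vol_eq, ← measureReal_sdiff hsub1 (isClosed_halfspaces a b).measurableSet
      hbd.measure_lt_top.ne, ← measureReal_sdiff hsub2
      (isClosed_halfspaces a _).measurableSet hPb.measure_lt_top.ne,
    ← volume_real_image_homothety (z + C⁻¹ • a i₀) (by linarith)]
  refine measureReal_mono ?_ (hbd.subset sdiff_subset).measure_lt_top.ne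
  rintro _ ⟨x, ⟨hx, hxn⟩, rfl⟩
  have hval : ∀ i, ⟪a i, AffineMap.homothety (z + C⁻¹ • a i₀) (1 - C * t) x⟫_ℝ =
      ⟪a i, z⟫_ℝ + t * ⟪a i, a i₀⟫_ℝ + (1 - C * t) * (⟪a i, x⟫_ℝ - ⟪a i, z⟫_ℝ) := by
    intro i
    rw [AffineMap.homothety_apply, vsub_eq_sub, vadd_eq_add]
    simp only [inner_add_right, inner_smul_right, inner_sub_right]
    field_simp
    ring
  have h00 : ⟪a i₀, a i₀⟫_ℝ = 1 := by
    rw [real_inner_self_eq_norm_sq, h.norm_eq, one_pow]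
  have hx0 : b i₀ - t < ⟪a i₀, x⟫_ℝ := by
    by_contra! hcon
    refine hxn fun i => ?_
    by_cases hi : i = i₀
    · subst hi
      rw [shift_self]
      linarith
    · rw [shift_of_ne hi]
      exact hx i
  have hr : 0 ≤ 1 - C * t := by linarith
  constructor
  · intro i
    rw [hval]
    by_cases hi : i = i₀
    · subst hi
      rw [shift_self, h00, hz]
      nlinarith [mul_nonneg hr (sub_nonneg.2 (hx i))]
    · rw [shift_of_ne hi]
      have h1 : ⟪a i, a i₀⟫_ℝ ≤ 1 := by
        have := real_inner_le_norm (a i) (a i₀)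
        rwa [h.norm_eq, h.norm_eq, mul_one] at this
      have h2 := hCj i hi
      have h3 : (1 - C * t) * (⟪a i, x⟫_ℝ - ⟪a i, z⟫_ℝ) ≤ (1 - C * t) * (b i - ⟪a i, z⟫_ℝ) :=
        mul_le_mul_of_nonneg_left (by linarith [hx i]) hr
      nlinarith
  · intro hmem
    have h1 := hmem i₀
    rw [hval, h00, hz] at h1
    rcases hr.eq_or_lt with h2 | h2
    · have : 0 < t := by
        by_contra! h3
        have : t = 0 := le_antisymm h3 ht
        rw [this] at h2
        norm_num at h2
      rw [← h2] at h1
      linarith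
    · nlinarith [mul_lt_mul_of_pos_left hx0 h2, mul_nonneg (mul_nonneg hC.le ht) ht]

end IsRep

/-- A linear form that attains its maximum over a polytope only at `v` decreases at a linear rate
away from `v`. -/
theorem exists_sharp_maximum {F : Set E3} (hF : IsCompact F) (hc : Convex ℝ F)
    (hfin : (F.extremePoints ℝ).Finite) {w v : E3} (h : ∀ x ∈ F, x ≠ v → ⟪w, x⟫_ℝ < ⟪w, v⟫_ℝ) :
    ∃ κ > 0, ∀ x ∈ F, κ * ‖x - v‖ ≤ ⟪w, v - x⟫_ℝ := by
  obtain ⟨κ, hκ, hκe⟩ : ∃ κ > 0, ∀ x ∈ F.extremePoints ℝ, κ * ‖x - v‖ ≤ ⟪w, v - x⟫_ℝ := by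
    have hpt : ∀ x : E3, ∃ κ > 0, x ∈ F.extremePoints ℝ → κ * ‖x - v‖ ≤ ⟪w, v - x⟫_ℝ := by
      intro x
      by_cases hx : x ∈ F ∧ x ≠ v
      · have h1 : 0 < ‖x - v‖ := norm_pos_iff.2 (sub_ne_zero.2 hx.2)
        have h2 : 0 < ⟪w, v - x⟫_ℝ := by
          rw [inner_sub_right]; linarith [h x hx.1 hx.2]
        exact ⟨⟪w, v - x⟫_ℝ / ‖x - v‖, by positivity, fun _ => by
          rw [div_mul_cancel₀ _ h1.ne']⟩
      · refine ⟨1, one_pos, fun hxe => ?_⟩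
        have : x = v := by by_contra hne; exact hx ⟨hxe.1, hne⟩
        simp [this]
    choose κ hκ hκx using hpt
    obtain ⟨m, hm, hmle⟩ : ∃ m > 0, ∀ x ∈ F.extremePoints ℝ, m ≤ κ x := by
      rcases (F.extremePoints ℝ).eq_empty_or_nonempty with he | he
      · exact ⟨1, one_pos, by simp [he]⟩
      · obtain ⟨x, -, hmin⟩ := hfin.exists_minimalFor κ _ he
        refine ⟨κ x, hκ x, fun y hy => ?_⟩
        rcases le_total (κ x) (κ y) with h1 | h1
        · exact h1
        · exact hmin hy h1
    exact ⟨m, hm, fun x hx => (mul_le_mul_of_nonneg_right (hmle x hx) (norm_nonneg _)).trans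
      (hκx x hx)⟩
  refine ⟨κ, hκ, ?_⟩
  have hset : Convex ℝ {x : E3 | κ * ‖x - v‖ ≤ ⟪w, v - x⟫_ℝ} := by
    intro x hx y hy s t hs ht hst
    have hx' : κ * ‖x - v‖ ≤ ⟪w, v - x⟫_ℝ := hx
    have hy' : κ * ‖y - v‖ ≤ ⟪w, v - y⟫_ℝ := hy
    have h1 : s • x + t • y - v = s • (x - v) + t • (y - v) := by
      have : s = 1 - t := by linarith
      subst this
      module
    have h2 : v - (s • x + t • y) = s • (v - x) + t • (v - y) := by
      have : s = 1 - t := by linarith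
      subst this
      module
    have h3 : ‖s • x + t • y - v‖ ≤ s * ‖x - v‖ + t * ‖y - v‖ := by
      rw [h1]
      refine (norm_add_le _ _).trans_eq ?_
      rw [norm_smul, norm_smul, Real.norm_of_nonneg hs, Real.norm_of_nonneg ht]
    change κ * ‖s • x + t • y - v‖ ≤ ⟪w, v - (s • x + t • y)⟫_ℝ
    rw [h2, inner_add_right, inner_smul_right, inner_smul_right]
    nlinarith [mul_le_mul_of_nonneg_left h3 hκ.le, mul_le_mul_of_nonneg_left hx' hs,
      mul_le_mul_of_nonneg_left hy' ht]
  have hclosed : IsClosed {x : E3 | κ * ‖x - v‖ ≤ ⟪w, v - x⟫_ℝ} :=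
    isClosed_le (by fun_prop) (by fun_prop)
  intro x hx
  rw [← closure_convexHull_extremePoints hF hc] at hx
  exact closure_minimal (convexHull_min hκe hset) hclosed hx

namespace IsRep

variable {ι : Type*} [DecidableEq ι] {P Q₁ Q₂ : ConvexPolyhedron} {a : ι → E3}
  {b : ι → ℝ} {i₀ i₁ : ι} {t : ℝ}

/-- The average of the displaced faces lies in the original one, so the sum of the widths does
not exceed twice the original width. -/
theorem width_shift_add_le [Finite ι] (h : IsRep P a b) (h₁ : IsRep Q₁ a (shift b i₀ t))
    (h₂ : IsRep Q₂ a (shift b i₀ (-t))) (i : ι) (u : E3) :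
    width (facet a (shift b i₀ t) i) u + width (facet a (shift b i₀ (-t)) i) u ≤
      2 * width (facet a b i) u := by
  obtain ⟨x, hx, y, hy, hxy⟩ := exists_width_eq (h₁.isCompact_facet i) (h₁.facet_nonempty i) u
  obtain ⟨z, hz, w, hw, hzw⟩ := exists_width_eq (h₂.isCompact_facet i) (h₂.facet_nonempty i) u
  have hmid : ∀ p ∈ facet a (shift b i₀ t) i, ∀ q ∈ facet a (shift b i₀ (-t)) i,
      (1 / 2 : ℝ) • (p + q) ∈ facet a b i := by
    intro p hp q hq
    refine ⟨fun j => ?_, ?_⟩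
    · rw [inner_smul_right, inner_add_right]
      linarith [hp.1 j, hq.1 j, shift_add_shift_neg (b := b) (i₀ := i₀) (t := t) j]
    · rw [inner_smul_right, inner_add_right, hp.2, hq.2, shift_add_shift_neg]
      ring
  have := inner_sub_le_width (h.isCompact_facet i) u (hmid x hx z hz) (hmid y hy w hw)
  rw [← smul_sub, inner_smul_right, show x + z - (y + w) = (x - y) + (z - w) by abel,
    inner_add_right] at this
  linarith

/-- A face that meets the displaced one only at `v` does not grow when the latter is moved
outwards. -/
theorem facet_shift_subset [Finite ι] (h : IsRep P a b) (hne : i₀ ≠ i₁) {v : E3}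
    (hv : facet a b i₀ ∩ facet a b i₁ = {v}) :
    facet a (shift b i₀ t) i₁ ⊆ facet a b i₁ := by
  intro x hx
  have hx1 : ⟪a i₁, x⟫_ℝ = b i₁ := by rw [hx.2, shift_of_ne hne.symm]
  have hxj : ∀ j, j ≠ i₀ → ⟪a j, x⟫_ℝ ≤ b j := fun j hj => by
    have := hx.1 j
    rwa [shift_of_ne hj] at this
  refine ⟨fun j => ?_, hx1⟩
  by_cases hj : j = i₀
  swap
  · exact hxj j hj
  subst hj
  by_contra! hcon
  obtain ⟨z, hz, hzj⟩ := h.exists_relint i₁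
  have hzj0 := hzj j hne
  -- the point at which the segment from `z` to `x` leaves the polyhedron
  set s : ℝ := (b j - ⟪a j, z⟫_ℝ) / (⟪a j, x⟫_ℝ - ⟪a j, z⟫_ℝ) with hs
  have hden : 0 < ⟪a j, x⟫_ℝ - ⟪a j, z⟫_ℝ := by linarith
  have hs0 : 0 < s := div_pos (by linarith) hden
  have hs1 : s < 1 := by rw [hs, div_lt_one hden]; linarith
  have hsden : s * (⟪a j, x⟫_ℝ - ⟪a j, z⟫_ℝ) = b j - ⟪a j, z⟫_ℝ := div_mul_cancel₀ _ hden.ne'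
  set y : E3 := z + s • (x - z) with hy
  have hyval : ∀ k, ⟪a k, y⟫_ℝ = (1 - s) * ⟪a k, z⟫_ℝ + s * ⟪a k, x⟫_ℝ := fun k => by
    rw [hy, inner_add_right, inner_smul_right, inner_sub_right]
    ring
  have hyj : ⟪a j, y⟫_ℝ = b j := by rw [hyval]; linarith
  have hy1 : ⟪a i₁, y⟫_ℝ = b i₁ := by rw [hyval, hz, hx1]; ring
  have hyk : ∀ k, k ≠ j → k ≠ i₁ → ⟪a k, y⟫_ℝ < b k := fun k hkj hk1 => by
    rw [hyval]
    nlinarith [hzj k hk1, hxj k hkj]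
  have hyP : y ∈ halfspaces a b := fun k => by
    by_cases hkj : k = j
    · subst hkj; exact hyj.le
    by_cases hk1 : k = i₁
    · subst hk1; exact hy1.le
    exact (hyk k hkj hk1).le
  have hyv : y = v := by
    have : y ∈ facet a b j ∩ facet a b i₁ := ⟨⟨hyP, hyj⟩, ⟨hyP, hy1⟩⟩
    rwa [hv] at this
  obtain ⟨w, hw0, hw⟩ := exists_ne_zero_inner_eq_zero a {j, i₁} Finset.card_le_two
  have hwj := hw j (by simp)
  have hw1 := hw i₁ (by simp)
  obtain ⟨ε, hε, hmem⟩ := exists_pos_add_smul_mem (w := w) hyP fun k hk => by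
    by_cases hkj : k = j
    · subst hkj; exact hwj.le
    by_cases hk1 : k = i₁
    · subst hk1; exact hw1.le
    exact absurd hk (hyk k hkj hk1).ne
  have hmem' := hmem ε hε.le le_rfl
  have : y + ε • w ∈ facet a b j ∩ facet a b i₁ := by
    refine ⟨⟨hmem', ?_⟩, ⟨hmem', ?_⟩⟩
    · rw [inner_add_right, inner_smul_right, hyj, hwj, mul_zero, add_zero]
    · rw [inner_add_right, inner_smul_right, hy1, hw1, mul_zero, add_zero]
  rw [hv, mem_singleton_iff, ← hyv, add_eq_left, smul_eq_zero] at this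
  exact this.elim hε.ne' hw0

/-- Moving a face inwards cuts off the corner `v` of a face that it meets only at `v`; the widths
of that face in the directions close to the normal of the displaced face decrease linearly. -/
theorem exists_width_shift_neg_le [Finite ι] (h : IsRep P a b) {v : E3}
    (hv : facet a b i₀ ∩ facet a b i₁ = {v}) :
    ∃ r > 0, Metric.ball (a i₀) r ⊆ Metric.ball 0 2 ∧ ∀ u ∈ Metric.ball (a i₀) r, ∀ t, 0 ≤ t →
      (facet a (shift b i₀ (-t)) i₁).Nonempty →
      facet a (shift b i₀ (-t)) i₁ ⊆ facet a b i₁ →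
      width (facet a (shift b i₀ (-t)) i₁) u ≤ width (facet a b i₁) u - t / 2 := by
  have hvm : v ∈ facet a b i₀ ∩ facet a b i₁ := by rw [hv]; rfl
  have hF := h.facet_mem_faces i₁
  obtain ⟨κ, hκ, hsharp⟩ := exists_sharp_maximum (w := a i₀) (v := v) (h.isCompact_facet i₁)
    (hF.2.1.convex P.convex)
    (P.finite_vertices.subset hF.2.1.isExtreme.extremePoints_subset_extremePoints)
    (fun x hx hxv => by
      rw [hvm.1.2]
      refine lt_of_le_of_ne (hx.1 i₀) fun heq => hxv ?_
      have : x ∈ facet a b i₀ ∩ facet a b i₁ := ⟨⟨hx.1, heq⟩, hx⟩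
      rwa [hv] at this)
  refine ⟨min (κ / 2) 1, lt_min (by positivity) one_pos, fun u hu => ?_, fun u hu t ht hne hsub => ?_⟩
  · rw [Metric.mem_ball, dist_eq_norm] at hu
    rw [mem_ball_zero_iff]
    have h1 : ‖u‖ ≤ ‖u - a i₀‖ + ‖a i₀‖ := by simpa using norm_add_le (u - a i₀) (a i₀)
    rw [h.norm_eq] at h1
    linarith [min_le_right (κ / 2) 1]
  · rw [Metric.mem_ball, dist_eq_norm] at hu
    have hu' : ‖u - a i₀‖ ≤ κ / 2 := hu.le.trans (min_le_left _ _)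
    have hc : IsCompact (facet a (shift b i₀ (-t)) i₁) := by
      refine (h.isCompact_facet i₁).of_isClosed_subset ?_ hsub
      exact (isClosed_halfspaces _ _).inter (isClosed_eq (by fun_prop) continuous_const)
    refine width_le hc hne fun x hx y hy => ?_
    have hx0 : ⟪a i₀, v - x⟫_ℝ ≥ t := by
      have := hx.1 i₀
      rw [shift_self] at this
      rw [inner_sub_right, hvm.1.2]
      linarith
    have h1 := hsharp x (hsub hx)
    have h2 : |⟪u - a i₀, v - x⟫_ℝ| ≤ κ / 2 * ‖x - v‖ := by
      rw [norm_sub_rev x v]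
      exact (abs_real_inner_le_norm _ _).trans (mul_le_mul_of_nonneg_right hu' (norm_nonneg _))
    have h3 : ⟪u, v - x⟫_ℝ = ⟪u - a i₀, v - x⟫_ℝ + ⟪a i₀, v - x⟫_ℝ := by
      rw [← inner_add_left, sub_add_cancel]
    have h4 : ⟪u, x - y⟫_ℝ = ⟪u, v - y⟫_ℝ - ⟪u, v - x⟫_ℝ := by
      rw [← inner_sub_right]; congr 1; abel
    have h5 := inner_sub_le_width (h.isCompact_facet i₁) u hvm.2 (hsub hy)
    have h6 := neg_abs_le ⟪u - a i₀, v - x⟫_ℝ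
    linarith

/-- If two faces have just the point `v` in common, the edge length as a function of the position
of one of them has a strictly concave kink. -/
theorem exists_edgeLength_shift_add_le [Fintype ι] (h : IsRep P a b) (hne : i₀ ≠ i₁) {v : E3}
    (hv : facet a b i₀ ∩ facet a b i₁ = {v}) :
    ∃ c > 0, ∀ t, 0 ≤ t → ∀ Q₁ Q₂ : ConvexPolyhedron, IsRep Q₁ a (shift b i₀ t) →
      IsRep Q₂ a (shift b i₀ (-t)) →
      Q₁.edgeLength + Q₂.edgeLength ≤ 2 * P.edgeLength - c * t := by
  obtain ⟨r, hr, hball, hwidth⟩ := h.exists_width_shift_neg_le hv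
  have hvol : 0 < volume.real (Metric.ball (a i₀) r) :=
    ENNReal.toReal_pos (Metric.measure_ball_pos volume _ hr).ne' measure_ball_lt_top.ne
  have hwc := widthConst_pos
  refine ⟨volume.real (Metric.ball (a i₀) r) / 2 / widthConst, by positivity,
    fun t ht Q₁ Q₂ h₁ h₂ => ?_⟩
  have hint : ∀ {Q : ConvexPolyhedron} {b' : ι → ℝ}, IsRep Q a b' → ∀ i,
      IntegrableOn (width (facet a b' i)) (Metric.ball (0 : E3) 2) := fun hQ i =>
    integrableOn_ball (continuous_width (hQ.isCompact_facet i)) 2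
  have hall : ∀ i, 0 ≤ 2 * meanWidth (facet a b i) -
      (meanWidth (facet a (shift b i₀ t) i) + meanWidth (facet a (shift b i₀ (-t)) i)) := by
    intro i
    rw [meanWidth, meanWidth, meanWidth, ← integral_const_mul, ← integral_add (hint h₁ i)
      (hint h₂ i), sub_nonneg]
    exact integral_mono ((hint h₁ i).add (hint h₂ i)) ((hint h i).const_mul 2)
      fun u => h.width_shift_add_le h₁ h₂ i u
  have hsub : facet a (shift b i₀ (-t)) i₁ ⊆ facet a b i₁ := fun x hx =>
    ⟨halfspaces_mono a (fun i => shift_neg_le i ht) hx.1, by rw [hx.2, shift_of_ne hne.symm]⟩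
  have hone : volume.real (Metric.ball (a i₀) r) * (t / 2) ≤ 2 * meanWidth (facet a b i₁) -
      (meanWidth (facet a (shift b i₀ t) i₁) + meanWidth (facet a (shift b i₀ (-t)) i₁)) := by
    have hI₁ : IntegrableOn (fun u => 2 * width (facet a b i₁) u) (Metric.ball (0 : E3) 2) :=
      (hint h i₁).const_mul 2
    have hI₂ : IntegrableOn (fun u => width (facet a (shift b i₀ t) i₁) u +
        width (facet a (shift b i₀ (-t)) i₁) u) (Metric.ball (0 : E3) 2) :=
      (hint h₁ i₁).add (hint h₂ i₁)
    have hI : IntegrableOn (fun u => 2 * width (facet a b i₁) u -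
        (width (facet a (shift b i₀ t) i₁) u + width (facet a (shift b i₀ (-t)) i₁) u))
        (Metric.ball (0 : E3) 2) := hI₁.sub hI₂
    have heq : 2 * meanWidth (facet a b i₁) -
        (meanWidth (facet a (shift b i₀ t) i₁) + meanWidth (facet a (shift b i₀ (-t)) i₁)) =
        ∫ u in Metric.ball (0 : E3) 2, (2 * width (facet a b i₁) u -
          (width (facet a (shift b i₀ t) i₁) u + width (facet a (shift b i₀ (-t)) i₁) u)) := by
      rw [integral_sub hI₁ hI₂, integral_const_mul, integral_add (hint h₁ i₁) (hint h₂ i₁)]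
      rfl
    rw [heq, ← smul_eq_mul, ← setIntegral_const]
    calc ∫ _ in Metric.ball (a i₀) r, t / 2 ≤ ∫ u in Metric.ball (a i₀) r,
          (2 * width (facet a b i₁) u -
          (width (facet a (shift b i₀ t) i₁) u + width (facet a (shift b i₀ (-t)) i₁) u)) := by
          refine setIntegral_mono_on (integrableOn_const measure_ball_lt_top.ne)
            (hI.mono_set hball) measurableSet_ball fun u hu => ?_
          have h1 := hwidth u hu t ht (h₂.facet_nonempty i₁) hsub
          have h2 := width_mono (h₁.isCompact_facet i₁) (h₁.facet_nonempty i₁)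
            (h.isCompact_facet i₁) (h.facet_shift_subset hne hv) u
          linarith
      _ ≤ _ := by
          refine setIntegral_mono_set hI (Eventually.of_forall fun u => ?_)
            (Eventually.of_forall hball)
          have := h.width_shift_add_le h₁ h₂ i₁ u
          simp only [Pi.zero_apply]
          linarith
  have hsum : volume.real (Metric.ball (a i₀) r) * (t / 2) ≤
      ∑ i, (2 * meanWidth (facet a b i) -
      (meanWidth (facet a (shift b i₀ t) i) + meanWidth (facet a (shift b i₀ (-t)) i))) :=
    hone.trans (Finset.single_le_sum (f := fun i => 2 * meanWidth (facet a b i) -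
      (meanWidth (facet a (shift b i₀ t) i) + meanWidth (facet a (shift b i₀ (-t)) i)))
      (fun i _ => hall i) (Finset.mem_univ i₁))
  rw [Finset.sum_sub_distrib, ← Finset.mul_sum, Finset.sum_add_distrib,
    ← h.widthConst_mul_edgeLength, ← h₁.widthConst_mul_edgeLength,
    ← h₂.widthConst_mul_edgeLength] at hsum
  refine le_of_mul_le_mul_left ?_ hwc
  have : widthConst * (volume.real (Metric.ball (a i₀) r) / 2 / widthConst * t) =
      volume.real (Metric.ball (a i₀) r) * (t / 2) := by field_simp
  rw [mul_sub, this]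
  linarith

end IsRep

/-- A strictly concave kink of the edge length is incompatible with minimality of the ratio,
whose other ingredient, the volume, has no convex part of first order. Here `e₀, e₁, e₂` and
`v₀, v₁, v₂` stand for the edge lengths and volumes before and after an outward and an inward
move by `t`. -/
theorem false_of_concave_kink {c C K e₀ v₀ : ℝ} (hc : 0 < c) (hC : 0 < C) (hK : 0 < K)
    (he₀ : 0 < e₀) (hv₀ : 0 < v₀)
    (h : ∀ᶠ t in 𝓝[>] (0 : ℝ), ∃ e₁ e₂ v₁ v₂ : ℝ, 0 ≤ e₁ ∧ 0 ≤ e₂ ∧ v₂ ≤ v₀ ∧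
      (1 - K * t) ^ 3 * v₀ ≤ v₂ ∧ (1 - C * t) ^ 3 * (v₀ - v₂) ≤ v₁ - v₀ ∧
      e₁ + e₂ ≤ 2 * e₀ - c * t ∧ e₀ ^ 3 * v₁ ≤ e₁ ^ 3 * v₀ ∧ e₀ ^ 3 * v₂ ≤ e₂ ^ 3 * v₀) :
    False := by
  -- a bound for the terms of order `t ^ 2` and higher in the comparison of the sums of the cubes
  -- of the edge lengths, divided by `t ^ 2`
  set M : ℝ := 54 * K ^ 2 * e₀ ^ 3 + 27 * K ^ 3 * e₀ ^ 3 + 9 * C * K * e₀ ^ 3 with hM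
  have hMpos : 0 < M := by positivity
  have hτ : 0 < min (min 1 C⁻¹) (min K⁻¹ (3 * e₀ ^ 2 * c / M)) := by positivity
  obtain ⟨t, ⟨e₁, e₂, v₁, v₂, he₁, he₂, hv₂, hK₂, hC₁, hsum, hm₁, hm₂⟩, ht, htτ⟩ :=
    (h.and (Ioo_mem_nhdsGT hτ)).exists
  simp only [lt_min_iff] at htτ
  obtain ⟨⟨ht1, htC⟩, htK, htM⟩ := htτ
  have hKt : K * t < 1 := by
    have := mul_lt_mul_of_pos_left htK hK
    rwa [mul_inv_cancel₀ hK.ne'] at this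
  have hCt : C * t < 1 := by
    have := mul_lt_mul_of_pos_left htC hC
    rwa [mul_inv_cancel₀ hC.ne'] at this
  have hMt : t * M < 3 * e₀ ^ 2 * c := by rwa [lt_div_iff₀ hMpos] at htM
  have bern : ∀ x : ℝ, 0 ≤ x → x < 1 → 1 - 3 * x ≤ (1 - x) ^ 3 := fun x h0 h1 => by
    nlinarith [mul_nonneg (sq_nonneg x) (by linarith : (0 : ℝ) ≤ 3 - x)]
  have hK' := bern (K * t) (by positivity) hKt
  have hC' := bern (C * t) (by positivity) hCt
  have hD : 0 ≤ v₀ - v₂ := by linarith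
  have hD' : v₀ - v₂ ≤ 3 * (K * t) * v₀ := by nlinarith
  have hv₁ : v₀ ≤ v₁ := by
    have : 0 ≤ (1 - C * t) ^ 3 * (v₀ - v₂) :=
      mul_nonneg (pow_nonneg (by linarith) 3) hD
    linarith
  -- the volume changes by `O(t)`, and its second difference is at least `-O(t ^ 2)`
  have hvv : v₀ * (2 - 9 * C * K * t ^ 2) ≤ v₁ + v₂ := by
    have h1 : (1 - 3 * (C * t)) * (v₀ - v₂) ≤ v₁ - v₀ :=
      (mul_le_mul_of_nonneg_right hC' hD).trans hC₁
    have h2 : 3 * (C * t) * (v₀ - v₂) ≤ 3 * (C * t) * (3 * (K * t) * v₀) :=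
      mul_le_mul_of_nonneg_left hD' (by positivity)
    nlinarith
  -- hence the edge length changes by `O(t)`
  have hη₁ : e₀ ≤ e₁ := by
    have h1 : e₀ ^ 3 * v₀ ≤ e₁ ^ 3 * v₀ :=
      (mul_le_mul_of_nonneg_left hv₁ (by positivity)).trans hm₁
    exact le_of_pow_le_pow_left₀ (by norm_num) he₁ (le_of_mul_le_mul_right h1 hv₀)
  have hct : 0 < c * t := by positivity
  have hη₂ : e₂ ≤ e₀ := by linarith
  have hη₂' : e₀ * (1 - 3 * (K * t)) ≤ e₂ := by
    have h1 : e₀ ^ 3 * ((1 - 3 * (K * t)) * v₀) ≤ e₂ ^ 3 * v₀ := by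
      refine le_trans (mul_le_mul_of_nonneg_left ?_ (by positivity)) hm₂
      exact (mul_le_mul_of_nonneg_right hK' hv₀.le).trans hK₂
    have h2 : e₀ ^ 3 * (1 - 3 * (K * t)) ≤ e₂ ^ 3 := by
      refine le_of_mul_le_mul_right ?_ hv₀
      linarith
    have h3 : e₂ ^ 3 ≤ e₂ * e₀ ^ 2 := by
      have : e₂ ^ 2 ≤ e₀ ^ 2 := pow_le_pow_left₀ he₂ hη₂ 2
      nlinarith
    have h4 : e₀ ^ 2 * (e₀ * (1 - 3 * (K * t))) ≤ e₀ ^ 2 * e₂ := by nlinarith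
    exact le_of_mul_le_mul_left h4 (by positivity)
  -- compare the sums of the cubes to first order
  have hcube : e₀ ^ 3 * (2 - 9 * C * K * t ^ 2) ≤ e₁ ^ 3 + e₂ ^ 3 := by
    refine le_of_mul_le_mul_right ?_ hv₀
    have := mul_le_mul_of_nonneg_left hvv (by positivity : 0 ≤ e₀ ^ 3)
    linarith
  obtain ⟨η₁, rfl⟩ : ∃ η, e₁ = e₀ + η := ⟨e₁ - e₀, by ring⟩
  obtain ⟨η₂, rfl⟩ : ∃ η, e₂ = e₀ - η := ⟨e₀ - e₂, by ring⟩
  have h0₁ : 0 ≤ η₁ := by linarith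
  have h0₂ : 0 ≤ η₂ := by linarith
  have hle₂ : η₂ ≤ 3 * K * e₀ * t := by linarith
  have hle₁ : η₁ ≤ 3 * K * e₀ * t := by linarith
  have hsq₁ := pow_le_pow_left₀ h0₁ hle₁ 2
  have hsq₂ := pow_le_pow_left₀ h0₂ hle₂ 2
  have hcu₁ := pow_le_pow_left₀ h0₁ hle₁ 3
  have hcu₂ := pow_nonneg h0₂ 3
  have ht3 : t ^ 3 ≤ t ^ 2 := pow_le_pow_of_le_one ht.le ht1.le (by norm_num)
  have hlin : 3 * e₀ ^ 2 * (η₁ - η₂) ≤ 3 * e₀ ^ 2 * (-(c * t)) :=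
    mul_le_mul_of_nonneg_left (by linarith) (by positivity)
  have hq := mul_le_mul_of_nonneg_left (add_le_add hsq₁ hsq₂) (by positivity : 0 ≤ 3 * e₀)
  have hq3 := mul_le_mul_of_nonneg_left ht3 (by positivity : 0 ≤ 27 * K ^ 3 * e₀ ^ 3)
  have hfin : t * (3 * e₀ ^ 2 * c) ≤ t * (t * M) := by
    have hexp : (e₀ + η₁) ^ 3 + (e₀ - η₂) ^ 3 = 2 * e₀ ^ 3 + 3 * e₀ ^ 2 * (η₁ - η₂) +
      3 * e₀ * (η₁ ^ 2 + η₂ ^ 2) + η₁ ^ 3 - η₂ ^ 3 := by ring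
    rw [hexp] at hcube
    rw [hM]
    linarith
  exact absurd (le_of_mul_le_mul_left hfin ht) (not_le.2 hMt)

theorem widthConst_mul_norm_le_meanWidth {F : Set E3} (hF : IsCompact F) {x y : E3} (hx : x ∈ F)
    (hy : y ∈ F) : widthConst * ‖x - y‖ ≤ meanWidth F := by
  rw [← integral_abs_inner, meanWidth]
  refine integral_mono (integrableOn_ball (by fun_prop) 2)
    (integrableOn_ball (continuous_width hF) 2) fun u => abs_le'.2 ⟨?_, ?_⟩
  · exact inner_sub_le_width hF u hx hy
  · rw [← inner_neg_right, neg_sub]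
    exact inner_sub_le_width hF u hy hx

namespace ConvexPolyhedron

theorem edgeLength_pos (P : ConvexPolyhedron) : 0 < P.edgeLength := by
  obtain ⟨a, b, h⟩ := exists_isRep P
  have hne : P.faces.Nonempty := by
    by_contra! he
    have h0 := h.carrier_eq
    have : IsEmpty (Fin P.numFaces) := by
      rw [numFaces, he, ncard_empty]; infer_instance
    have h1 : halfspaces a b = univ := eq_univ_of_forall fun x i => isEmptyElim i
    rw [h1] at h0
    exact noncompact_univ E3 (h0 ▸ P.isCompact)
  obtain ⟨F, hF⟩ := hne
  obtain ⟨i, rfl⟩ : F ∈ range (facet a b) := h.faces_eq ▸ hF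
  obtain ⟨x, hx, y, hy, hxy⟩ := exists_ne_of_finrank_ne_zero (F := facet a b i)
    (by rw [hF.2.2]; norm_num)
  refine pos_of_mul_pos_right (a := widthConst) ?_ widthConst_pos.le
  rw [h.widthConst_mul_edgeLength]
  refine Finset.sum_pos' (fun j _ => meanWidth_nonneg (h.isCompact_facet j) (h.facet_nonempty j))
    ⟨i, Finset.mem_univ i, ?_⟩
  refine lt_of_lt_of_le ?_ (widthConst_mul_norm_le_meanWidth (h.isCompact_facet i) hx hy)
  exact mul_pos widthConst_pos (norm_pos_iff.2 (sub_ne_zero.2 hxy))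

/-- A polyhedron that minimizes the Melzak ratio among those with as many faces is simple. -/
theorem IsMinimizerForFaces.degree_eq_three {P : ConvexPolyhedron} (hP : P.IsMinimizerForFaces)
    {v : E3} (hv : v ∈ P.vertices) : P.degree v = 3 := by
  by_contra hdeg
  obtain ⟨a, b, h⟩ := exists_isRep P
  obtain ⟨i₀, i₁, hne, hi⟩ := h.exists_facets_inter_eq_singleton hv hdeg
  obtain ⟨K, hK, hvK⟩ := h.exists_volume_shift_neg_ge i₀
  obtain ⟨C, hC, hvC⟩ := h.exists_volume_shift_ge i₀
  obtain ⟨c, hc, hec⟩ := h.exists_edgeLength_shift_add_le hne hi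
  refine false_of_concave_kink hc hC hK P.edgeLength_pos P.vol_pos ?_
  have hrep := h.eventually_isRep_shift i₀
  have hrep' : ∀ᶠ t in 𝓝 (0 : ℝ), ∃ Q, IsRep Q a (shift b i₀ (-t)) := by
    have : Tendsto (fun t : ℝ => -t) (𝓝 0) (𝓝 0) := by
      simpa using (continuous_neg (G := ℝ)).tendsto 0
    exact this.eventually hrep
  have hτ : 0 < min K⁻¹ C⁻¹ := by positivity
  filter_upwards [hrep.filter_mono nhdsWithin_le_nhds, hrep'.filter_mono nhdsWithin_le_nhds,
    Ioo_mem_nhdsGT hτ] with t ⟨Q₁, h₁⟩ ⟨Q₂, h₂⟩ ⟨ht, htτ⟩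
  obtain ⟨htK, htC⟩ := lt_min_iff.1 htτ
  have hKt : K * t ≤ 1 := by
    have := mul_lt_mul_of_pos_left htK hK
    rw [mul_inv_cancel₀ hK.ne'] at this
    exact this.le
  have hCt : C * t ≤ 1 := by
    have := mul_lt_mul_of_pos_left htC hC
    rw [mul_inv_cancel₀ hC.ne'] at this
    exact this.le
  have hmin : ∀ {Q : ConvexPolyhedron} {b' : Fin P.numFaces → ℝ}, IsRep Q a b' →
      P.edgeLength ^ 3 * Q.vol ≤ Q.edgeLength ^ 3 * P.vol := fun {Q b'} hQ => by
    have := hP Q (by rw [hQ.numFaces_eq, Nat.card_fin])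
    rwa [melzakRatio, melzakRatio, div_le_div_iff₀ P.vol_pos Q.vol_pos] at this
  refine ⟨Q₁.edgeLength, Q₂.edgeLength, Q₁.vol, Q₂.vol, Q₁.edgeLength_pos.le,
    Q₂.edgeLength_pos.le, ?_, ?_, ?_, hec t ht.le Q₁ Q₂ h₁ h₂, hmin h₁, hmin h₂⟩
  · rw [h.vol_eq, h₂.vol_eq]
    refine measureReal_mono (halfspaces_mono a fun i => shift_neg_le i ht.le) ?_
    rw [← h.carrier_eq]
    exact P.isCompact.measure_lt_top.ne
  · rw [h₂.vol_eq]
    exact hvK t ht.le hKt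
  · rw [h₁.vol_eq, h₂.vol_eq]
    exact hvC t ht.le hCt (h₁.carrier_eq ▸ Q₁.isCompact.isBounded)

end ConvexPolyhedron

/-! ### Existence of minimizers -/

/-- A segment that leaves `halfspaces a b` passes through a facet. -/
theorem exists_facet_of_exit {ι : Type*} [Finite ι] {a : ι → E3} {b : ι → ℝ} {x y : E3}
    (hx : x ∈ halfspaces a b) (hy : y ∉ halfspaces a b) :
    ∃ z ∈ segment ℝ x y, ∃ i, z ∈ facet a b i := by
  set T : Set ℝ := Icc 0 1 ∩ (fun τ : ℝ => x + τ • (y - x)) ⁻¹' halfspaces a b with hT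
  have hTc : IsCompact T :=
    isCompact_Icc.inter_right ((isClosed_halfspaces a b).preimage (by fun_prop))
  obtain ⟨τ, ⟨⟨h0, h1⟩, hτ⟩, hmax⟩ :=
    hTc.exists_isGreatest ⟨0, ⟨le_rfl, zero_le_one⟩, by simpa using hx⟩
  have hτ' : x + τ • (y - x) ∈ halfspaces a b := hτ
  have hτ1 : τ < 1 := lt_of_le_of_ne h1 fun h => hy (by
    rw [h] at hτ'; simpa using hτ')
  refine ⟨x + τ • (y - x), ?_, ?_⟩
  · rw [segment_eq_image']
    exact ⟨τ, ⟨h0, h1⟩, rfl⟩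
  · by_contra! hcon
    obtain ⟨ε, hε, hmem⟩ := exists_pos_add_smul_mem (w := y - x) hτ'
      (fun i hi => absurd ⟨hτ', hi⟩ (hcon i))
    have hm : 0 < min ε (1 - τ) := lt_min hε (by linarith)
    have := hmem (min ε (1 - τ)) hm.le (min_le_left _ _)
    rw [add_assoc, ← add_smul] at this
    have := hmax (⟨⟨by linarith, by linarith [min_le_right ε (1 - τ)]⟩, this⟩ :
      τ + min ε (1 - τ) ∈ T)
    linarith

/-- The images of convex sets on a line cover an interval only if their lengths add up to at least
its length. -/
theorem sub_le_sum_width {κ : Type*} (s : Finset κ) (F : κ → Set E3)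
    (hF : ∀ i ∈ s, IsCompact (F i)) (hne : ∀ i ∈ s, (F i).Nonempty)
    (hc : ∀ i ∈ s, Convex ℝ (F i)) (u : E3) {α β : ℝ}
    (h : ∀ r ∈ Icc α β, ∃ i ∈ s, ∃ x ∈ F i, ⟪u, x⟫_ℝ = r) :
    β - α ≤ ∑ i ∈ s, width (F i) u := by
  have hsub : Icc α β ⊆ ⋃ i ∈ s, (fun x => ⟪u, x⟫_ℝ) '' F i := fun r hr => by
    obtain ⟨i, hi, x, hx, hxr⟩ := h r hr
    exact mem_biUnion hi ⟨x, hx, hxr⟩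
  have hcomp : ∀ i ∈ s, IsCompact ((fun x => ⟪u, x⟫_ℝ) '' F i) := fun i hi =>
    (hF i hi).image (by fun_prop)
  have hfin : volume (⋃ i ∈ s, (fun x => ⟪u, x⟫_ℝ) '' F i) ≠ ⊤ :=
    (s.isCompact_biUnion hcomp).measure_lt_top.ne
  calc β - α ≤ volume.real (Icc α β) := by
        rw [Measure.real, Real.volume_Icc, ENNReal.toReal_ofReal']
        exact le_max_left _ _
    _ ≤ volume.real (⋃ i ∈ s, (fun x => ⟪u, x⟫_ℝ) '' F i) := measureReal_mono hsub hfin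
    _ ≤ ∑ i ∈ s, volume.real ((fun x => ⟪u, x⟫_ℝ) '' F i) := measureReal_biUnion_finset_le _ _
    _ = ∑ i ∈ s, width (F i) u := Finset.sum_congr rfl fun i hi =>
        volume_image_inner (hF i hi) (hne i hi) (hc i hi) u

theorem IsRep.convex_facet {ι : Type*} {a : ι → E3} {b : ι → ℝ} (i : ι) :
    Convex ℝ (facet a b i) := (isExposed_facet a b i).convex (convex_halfspaces a b)

/-- The faces cover the boundary, so their projections to a line cover that of the polyhedron. -/
theorem IsRep.inner_sub_le_sum_width {ι : Type*} [Fintype ι] {P : ConvexPolyhedron} {a : ι → E3}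
    {b : ι → ℝ} (h : IsRep P a b) {x y : E3} (hx : x ∈ P.carrier) (hy : y ∈ P.carrier) (u : E3) :
    ⟪u, x - y⟫_ℝ ≤ ∑ i, width (facet a b i) u := by
  rw [inner_sub_right]
  refine sub_le_sum_width Finset.univ (facet a b) (fun i _ => h.isCompact_facet i)
    (fun i _ => h.facet_nonempty i) (fun i _ => IsRep.convex_facet i) u fun r hr => ?_
  obtain ⟨d, hd0, hd⟩ := exists_ne_zero_inner_eq_zero (fun _ : Unit => u) {()} (by simp)
  have hd : ⟪u, d⟫_ℝ = 0 := hd () (by simp)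
  obtain ⟨z, hz, hzr⟩ : ∃ z ∈ P.carrier, ⟪u, z⟫_ℝ = r := by
    have h1 : IsPreconnected ((fun x => ⟪u, x⟫_ℝ) '' P.carrier) :=
      P.convex.isPreconnected.image _ (by fun_prop)
    exact h1.Icc_subset ⟨y, hy, rfl⟩ ⟨x, hx, rfl⟩ hr
  obtain ⟨R, hR⟩ := P.isCompact.isBounded.subset_closedBall z
  have hR0 : 0 ≤ R := by simpa using hR hz
  have hout : z + ((R + 1) / ‖d‖) • d ∉ halfspaces a b := fun hmem => by
    rw [← h.carrier_eq] at hmem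
    have := hR hmem
    rw [Metric.mem_closedBall, dist_eq_norm, add_sub_cancel_left, norm_smul, norm_div, norm_norm,
      div_mul_cancel₀ _ (norm_ne_zero_iff.2 hd0), Real.norm_of_nonneg (by linarith)] at this
    linarith
  rw [h.carrier_eq] at hz
  obtain ⟨w, hw, i, hwi⟩ := exists_facet_of_exit hz hout
  refine ⟨i, Finset.mem_univ i, w, hwi, ?_⟩
  rw [segment_eq_image'] at hw
  obtain ⟨θ, -, rfl⟩ := hw
  simp only [add_sub_cancel_left, inner_add_right, inner_smul_right, hd, hzr, mul_zero, add_zero]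

/-- The edge length bounds the diameter. -/
theorem ConvexPolyhedron.norm_sub_le_edgeLength {P : ConvexPolyhedron} {x y : E3}
    (hx : x ∈ P.carrier) (hy : y ∈ P.carrier) : ‖x - y‖ ≤ P.edgeLength := by
  obtain ⟨a, b, h⟩ := exists_isRep P
  refine le_of_mul_le_mul_left ?_ widthConst_pos
  rw [h.widthConst_mul_edgeLength, ← integral_abs_inner]
  simp only [meanWidth]
  have hint : ∀ i, IntegrableOn (width (facet a b i)) (Metric.ball (0 : E3) 2) := fun i =>
    integrableOn_ball (continuous_width (h.isCompact_facet i)) 2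
  rw [← integral_finsetSum _ fun i _ => hint i]
  refine integral_mono (integrableOn_ball (by fun_prop) 2)
    (integrable_finsetSum _ fun i _ => hint i) fun u => abs_le'.2 ⟨?_, ?_⟩
  · exact h.inner_sub_le_sum_width hx hy u
  · rw [← inner_neg_right, neg_sub]
    exact h.inner_sub_le_sum_width hy hx u

open scoped Pointwise in
/-- The image of a polyhedron under a translation and a scaling. -/
theorem IsRep.exists_rescale {ι : Type*} [Fintype ι] {P : ConvexPolyhedron} {a : ι → E3}
    {b : ι → ℝ} (h : IsRep P a b) (x₀ : E3) {c : ℝ} (hc : 0 < c) :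
    ∃ Q : ConvexPolyhedron, IsRep Q a (fun i => c * (b i - ⟪a i, x₀⟫_ℝ)) ∧
      Q.carrier = (fun x => c • (x - x₀)) '' P.carrier ∧ Q.edgeLength = c * P.edgeLength ∧
      Q.vol = c ^ 3 * P.vol := by
  set b' : ι → ℝ := fun i => c * (b i - ⟪a i, x₀⟫_ℝ) with hb'
  set g : E3 → E3 := fun x => c • (x - x₀) with hg
  have hgi : ∀ i x, ⟪a i, g x⟫_ℝ = c * (⟪a i, x⟫_ℝ - ⟪a i, x₀⟫_ℝ) := fun i x => by
    rw [hg, inner_smul_right, inner_sub_right]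
  have hgs : ∀ y, g (c⁻¹ • y + x₀) = y := fun y => by
    simp only [hg, add_sub_cancel_right, smul_smul, mul_inv_cancel₀ hc.ne', one_smul]
  have hgle : ∀ i x, ⟪a i, g x⟫_ℝ ≤ b' i ↔ ⟪a i, x⟫_ℝ ≤ b i := fun i x => by
    rw [hgi, hb', mul_le_mul_iff_right₀ hc, sub_le_sub_iff_right]
  have hgeq : ∀ i x, ⟪a i, g x⟫_ℝ = b' i ↔ ⟪a i, x⟫_ℝ = b i := fun i x => by
    rw [hgi, hb', mul_right_inj' hc.ne', sub_left_inj]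
  have hglt : ∀ i x, ⟪a i, g x⟫_ℝ < b' i ↔ ⟪a i, x⟫_ℝ < b i := fun i x => by
    rw [hgi, hb', mul_lt_mul_iff_right₀ hc, sub_lt_sub_iff_right]
  have himg : halfspaces a b' = g '' halfspaces a b := by
    ext y
    constructor
    · intro hy
      refine ⟨c⁻¹ • y + x₀, fun i => ?_, hgs y⟩
      rw [← hgle, hgs]
      exact hy i
    · rintro ⟨x, hx, rfl⟩ i
      exact (hgle i x).2 (hx i)
  have hfimg : ∀ i, facet a b' i = g '' facet a b i := fun i => by
    ext y
    constructor
    · rintro ⟨hy, hyi⟩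
      rw [himg] at hy
      obtain ⟨x, hx, rfl⟩ := hy
      exact ⟨x, ⟨hx, (hgeq i x).1 hyi⟩, rfl⟩
    · rintro ⟨x, ⟨hx, hxi⟩, rfl⟩
      exact ⟨himg ▸ mem_image_of_mem g hx, (hgeq i x).2 hxi⟩
  have hgc : Continuous g := by fun_prop
  have hbdd : Bornology.IsBounded (halfspaces a b') := by
    rw [himg, ← h.carrier_eq]
    exact (P.isCompact.image hgc).isBounded
  obtain ⟨p, hp⟩ := h.exists_strict
  set Q := ofHalfspaces a b' hbdd
    (interior_halfspaces_nonempty (p := g p) fun i => (hglt i p).2 (hp i)) with hQ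
  have hrep : IsRep Q a b' := ⟨rfl, h.norm_eq, fun i => by
    obtain ⟨x, hx, hxj⟩ := h.exists_relint i
    exact ⟨g x, (hgeq i x).2 hx, fun j hj => (hglt j x).2 (hxj j hj)⟩⟩
  refine ⟨Q, hrep, ?_, ?_, ?_⟩
  · rw [h.carrier_eq]; exact himg
  · have hw : ∀ i, meanWidth (facet a b' i) = c * meanWidth (facet a b i) := fun i => by
      rw [meanWidth, meanWidth, ← integral_const_mul]
      congr 1
      ext u
      have hF := h.isCompact_facet i
      have hne := h.facet_nonempty i
      have hgsub : ∀ x y, ⟪u, g x - g y⟫_ℝ = c * ⟪u, x - y⟫_ℝ := fun x y => by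
        rw [hg, ← smul_sub, inner_smul_right, sub_sub_sub_cancel_right]
      rw [hfimg]
      refine le_antisymm (width_le (hF.image hgc) (hne.image g) ?_) ?_
      · rintro _ ⟨x, hx, rfl⟩ _ ⟨y, hy, rfl⟩
        rw [hgsub]
        exact mul_le_mul_of_nonneg_left (inner_sub_le_width hF u hx hy) hc.le
      · obtain ⟨x, hx, y, hy, hxy⟩ := exists_width_eq hF hne u
        rw [hxy, ← hgsub]
        exact inner_sub_le_width (hF.image hgc) u (mem_image_of_mem g hx) (mem_image_of_mem g hy)
    refine mul_left_cancel₀ widthConst_pos.ne' ?_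
    rw [hrep.widthConst_mul_edgeLength, Finset.sum_congr rfl fun i _ => hw i, ← Finset.mul_sum,
      ← h.widthConst_mul_edgeLength]
    ring
  · rw [hrep.vol_eq, himg, h.vol_eq]
    have h1 : g '' halfspaces a b = c • ((fun x => x + -x₀) '' halfspaces a b) := by
      rw [← image_smul, image_image]
      simp only [hg, sub_eq_add_neg]
    have h3 : finrank ℝ E3 = 3 := by simp
    rw [h1, Measure.real, Measure.addHaar_smul, image_add_right, neg_neg,
      measure_preimage_add_right, h3, ENNReal.toReal_mul, ENNReal.toReal_ofReal (abs_nonneg _),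
      abs_of_pos (by positivity)]
    rfl

/-- Up to scaling and translation, a polyhedron has edge length one and contains the origin. -/
theorem exists_normalized (P : ConvexPolyhedron) :
    ∃ (Q : ConvexPolyhedron) (a : Fin P.numFaces → E3) (b : Fin P.numFaces → ℝ), IsRep Q a b ∧
      0 ∈ Q.carrier ∧ Q.edgeLength = 1 ∧ Q.vol = P.melzakRatio⁻¹ := by
  obtain ⟨a, b, h⟩ := exists_isRep P
  obtain ⟨x₀, hx₀⟩ := P.nonempty
  have he := P.edgeLength_pos
  obtain ⟨Q, hQ, hcar, hel, hvol⟩ := h.exists_rescale x₀ (inv_pos.2 he)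
  refine ⟨Q, a, _, hQ, ?_, ?_, ?_⟩
  · rw [hcar]
    exact ⟨x₀, hx₀, by simp⟩
  · rw [hel, inv_mul_cancel₀ he.ne']
  · rw [hvol, ConvexPolyhedron.melzakRatio, inv_div, inv_pow, inv_mul_eq_div]

/-- Polyhedra with `k` faces, of edge length one and containing the origin, whose face planes
converge. -/
structure IsConvergentFamily {k : ℕ} (Q : ℕ → ConvexPolyhedron) (a : ℕ → Fin k → E3)
    (b : ℕ → Fin k → ℝ) (A : Fin k → E3) (B : Fin k → ℝ) : Prop where
  isRep : ∀ n, IsRep (Q n) (a n) (b n)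
  zero_mem : ∀ n, 0 ∈ (Q n).carrier
  edgeLength_eq : ∀ n, (Q n).edgeLength = 1
  tendsto_normal : ∀ i, Tendsto (fun n => a n i) atTop (𝓝 (A i))
  tendsto_offset : ∀ i, Tendsto (fun n => b n i) atTop (𝓝 (B i))

namespace IsConvergentFamily

variable {k : ℕ} {Q : ℕ → ConvexPolyhedron} {a : ℕ → Fin k → E3} {b : ℕ → Fin k → ℝ}
  {A : Fin k → E3} {B : Fin k → ℝ}

theorem norm_eq (h : IsConvergentFamily Q a b A B) (i : Fin k) : ‖A i‖ = 1 :=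
  tendsto_nhds_unique (h.tendsto_normal i).norm (by simp [(h.isRep _).norm_eq])

theorem norm_le_one (h : IsConvergentFamily Q a b A B) {n : ℕ} {x : E3}
    (hx : x ∈ (Q n).carrier) : ‖x‖ ≤ 1 := by
  have := ConvexPolyhedron.norm_sub_le_edgeLength hx (h.zero_mem n)
  rwa [sub_zero, h.edgeLength_eq] at this

theorem eventually_lt (h : IsConvergentFamily Q a b A B) {i : Fin k} {x : E3}
    (hx : ⟪A i, x⟫_ℝ < B i) : ∀ᶠ n in atTop, ⟪a n i, x⟫_ℝ < b n i :=
  ((h.tendsto_normal i).inner tendsto_const_nhds).eventually_lt (h.tendsto_offset i) hx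

theorem eventually_gt (h : IsConvergentFamily Q a b A B) {i : Fin k} {x : E3}
    (hx : B i < ⟪A i, x⟫_ℝ) : ∀ᶠ n in atTop, b n i < ⟪a n i, x⟫_ℝ :=
  (h.tendsto_offset i).eventually_lt ((h.tendsto_normal i).inner tendsto_const_nhds) hx

/-- The volume is upper semicontinuous: up to a small error in the offsets, the polyhedra satisfy
the limiting inequalities. -/
theorem le_volume (h : IsConvergentFamily Q a b A B) {L : ℝ}
    (hL : Tendsto (fun n => (Q n).vol) atTop (𝓝 L)) :
    L ≤ volume.real (halfspaces A B ∩ Metric.closedBall 0 1) := by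
  set K : ℕ → Set E3 := fun m =>
    halfspaces A (fun i => B i + 1 / ((m : ℝ) + 1)) ∩ Metric.closedBall 0 1 with hK
  have hKfin : ∀ m, volume (K m) ≠ ⊤ := fun m =>
    ((measure_mono inter_subset_right).trans_lt measure_closedBall_lt_top).ne
  have hLK : ∀ m, L ≤ volume.real (K m) := by
    intro m
    have hm : (0 : ℝ) < 1 / ((m : ℝ) + 1) := by positivity
    refine le_of_tendsto hL ?_
    have hev : ∀ᶠ n in atTop, ∀ i, b n i + ‖A i - a n i‖ ≤ B i + 1 / ((m : ℝ) + 1) := by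
      refine eventually_all.2 fun i => ?_
      have h1 : Tendsto (fun n => b n i + ‖A i - a n i‖) atTop (𝓝 (B i + ‖A i - A i‖)) :=
        (h.tendsto_offset i).add (tendsto_const_nhds.sub (h.tendsto_normal i)).norm
      rw [sub_self, norm_zero, add_zero] at h1
      exact (h1.eventually_lt_const (by linarith)).mono fun n hn => hn.le
    filter_upwards [hev] with n hn
    refine measureReal_mono (fun x hx => ⟨fun i => ?_, ?_⟩) (hKfin m)
    · have hx1 := h.norm_le_one hx
      have hxi : ⟪a n i, x⟫_ℝ ≤ b n i := by
        rw [(h.isRep n).carrier_eq] at hx; exact hx i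
      have h2 : ⟪A i - a n i, x⟫_ℝ ≤ ‖A i - a n i‖ := by
        refine (real_inner_le_norm _ _).trans ?_
        exact mul_le_of_le_one_right (norm_nonneg _) hx1
      rw [inner_sub_left] at h2
      have := hn i
      simp only
      linarith
    · rw [mem_closedBall_zero_iff]
      exact h.norm_le_one hx
  have hinter : ⋂ m, K m = halfspaces A B ∩ Metric.closedBall 0 1 := by
    ext x
    simp only [hK, mem_iInter, mem_inter_iff]
    constructor
    · intro hx
      refine ⟨fun i => ?_, (hx 0).2⟩
      refine ge_of_tendsto' (f := fun m : ℕ => B i + 1 / ((m : ℝ) + 1)) (x := atTop) ?_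
        fun m => (hx m).1 i
      simpa using tendsto_const_nhds.add (tendsto_one_div_add_atTop_nhds_zero_nat (𝕜 := ℝ))
    · rintro ⟨hx, hx1⟩ m
      refine ⟨fun i => (hx i).trans ?_, hx1⟩
      have : (0 : ℝ) < 1 / ((m : ℝ) + 1) := by positivity
      linarith
  have hanti : Antitone K := fun m m' hmm' => inter_subset_inter_left _ <|
    halfspaces_mono A fun i => by
      have : 1 / ((m' : ℝ) + 1) ≤ 1 / ((m : ℝ) + 1) := Nat.one_div_le_one_div hmm'
      linarith
  have htend : Tendsto (fun m => volume.real (K m)) atTop (𝓝 (volume.real (⋂ m, K m))) := by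
    refine (ENNReal.tendsto_toReal ?_).comp (tendsto_measure_iInter_atTop (fun m => ?_) hanti
      ⟨0, hKfin 0⟩)
    · exact ((measure_mono (iInter_subset K 0)).trans_lt (hKfin 0).lt_top).ne
    · exact ((isClosed_halfspaces _ _).inter Metric.isClosed_closedBall).measurableSet.nullMeasurableSet
  rw [← hinter]
  exact ge_of_tendsto' htend hLK

theorem exists_strict (h : IsConvergentFamily Q a b A B) {L : ℝ} (hL0 : 0 < L)
    (hL : Tendsto (fun n => (Q n).vol) atTop (𝓝 L)) : ∃ p, ∀ i, ⟪A i, p⟫_ℝ < B i := by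
  have hpos := hL0.trans_le (h.le_volume hL)
  have hconv : Convex ℝ (halfspaces A B ∩ Metric.closedBall (0 : E3) 1) :=
    (convex_halfspaces A B).inter (convex_closedBall 0 1)
  obtain ⟨p, hp⟩ : (interior (halfspaces A B ∩ Metric.closedBall (0 : E3) 1)).Nonempty := by
    by_contra! he
    have hcl : IsClosed (halfspaces A B ∩ Metric.closedBall (0 : E3) 1) :=
      (isClosed_halfspaces A B).inter Metric.isClosed_closedBall
    have h1 := hconv.addHaar_frontier volume
    rw [hcl.frontier_eq, he, sdiff_empty] at h1
    rw [Measure.real, h1] at hpos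
    simp at hpos
  exact ⟨p, fun i => inner_lt_of_mem_interior (h.norm_eq i) (fun x hx => hx.1 i) hp⟩

/-- An interior point of the limit lies in almost all of the polyhedra and hence in the unit ball;
the other points of the limit are approximated by interior ones. -/
theorem halfspaces_subset (h : IsConvergentFamily Q a b A B) {L : ℝ} (hL0 : 0 < L)
    (hL : Tendsto (fun n => (Q n).vol) atTop (𝓝 L)) :
    halfspaces A B ⊆ Metric.closedBall 0 1 := by
  obtain ⟨p, hp⟩ := h.exists_strict hL0 hL
  intro x hx
  have hmem : ∀ s : ℝ, 0 ≤ s → s < 1 → ‖p + s • (x - p)‖ ≤ 1 := by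
    intro s h0 h1
    have hev : ∀ᶠ n in atTop, ∀ i, ⟪a n i, p + s • (x - p)⟫_ℝ < b n i :=
      eventually_all.2 fun i => h.eventually_lt (by
        rw [inner_add_right, inner_smul_right, inner_sub_right]
        nlinarith [hp i, hx i])
    obtain ⟨n, hn⟩ := hev.exists
    refine h.norm_le_one (n := n) ?_
    rw [(h.isRep n).carrier_eq]
    exact fun i => (hn i).le
  have hc : Continuous fun s : ℝ => ‖p + s • (x - p)‖ := by fun_prop
  have ht : Tendsto (fun s : ℝ => ‖p + s • (x - p)‖) (𝓝[<] 1) (𝓝 ‖x‖) := by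
    have := (hc.tendsto 1).mono_left (nhdsWithin_le_nhds (s := Iio 1))
    simpa using this
  rw [mem_closedBall_zero_iff]
  refine le_of_tendsto ht ?_
  filter_upwards [Ioo_mem_nhdsLT (zero_lt_one (α := ℝ))] with s hs
  exact hmem s hs.1.le hs.2

/-- In the limit no width of a face is lost: the faces of the polyhedra that converge to a face
of the limit cover it up to an arbitrarily small error. -/
theorem eventually_width_le (h : IsConvergentFamily Q a b A B) {p : E3}
    (hp : ∀ i, ⟪A i, p⟫_ℝ < B i) (hbd : IsCompact (halfspaces A B)) {i₀ : Fin k}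
    (hd : finrank ℝ (vectorSpan ℝ (facet A B i₀)) = 2) (u : E3) {ε : ℝ} (hε : 0 < ε) :
    ∀ᶠ n in atTop, width (facet A B i₀) u - ε ≤
      ∑ i ∈ Finset.univ.filter (fun i => facet A B i = facet A B i₀),
        width (facet (a n) (b n) i) u := by
  set F := facet A B i₀ with hF
  set I := Finset.univ.filter (fun i => facet A B i = F) with hI
  have hnonneg : ∀ n, 0 ≤ ∑ i ∈ I, width (facet (a n) (b n) i) u := fun n =>
    Finset.sum_nonneg fun i _ => width_nonneg ((h.isRep n).isCompact_facet i)
      ((h.isRep n).facet_nonempty i) u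
  rcases le_or_gt (width F u) ε with hsmall | hlarge
  · exact Eventually.of_forall fun n => by linarith [hnonneg n]
  have hFne : F.Nonempty := by
    by_contra! he
    rw [he, vectorSpan_empty, finrank_bot] at hd
    omega
  have hFexp : IsExposed ℝ (halfspaces A B) F := isExposed_facet A B i₀
  have hFc : IsCompact F := hFexp.isCompact hbd
  obtain ⟨z, hz, hzs⟩ := exists_strict_point (IsRep.convex_facet i₀) hFne A B
    (fun x hx i => hx.1 i) Finset.univ
  have hzs : ∀ i ∉ I, ⟪A i, z⟫_ℝ < B i := by
    intro i hi
    refine hzs i (Finset.mem_univ i) ?_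
    by_contra! hcon
    refine hi (Finset.mem_filter.2 ⟨Finset.mem_univ i, ?_⟩)
    have hsub : F ⊆ facet A B i := fun y hy => ⟨hy.1, le_antisymm (hy.1 i) (hcon y hy)⟩
    exact IsExposed.eq_of_subset_of_finrank_le (isExposed_facet A B i) hFexp hFne hsub
      (hd ▸ finrank_vectorSpan_facet_le (h.norm_eq i))
  have hFI : ∀ i ∈ I, ∀ x ∈ F, ⟪A i, x⟫_ℝ = B i := fun i hi x hx => by
    rw [hI, Finset.mem_filter] at hi
    rw [← hi.2] at hx
    exact hx.2
  obtain ⟨x, hx, y, hy, hxy⟩ := exists_width_eq hFc hFne u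
  have hw0 : 0 < width F u := hε.trans hlarge
  -- points `x'`, `y'` in the relative interior of the face, almost realizing its width
  set s : ℝ := 1 - ε / width F u with hs
  have hs1 : s < 1 := by
    have : 0 < ε / width F u := by positivity
    linarith
  have hs0 : 0 ≤ s := by
    have : ε / width F u < 1 := (div_lt_one hw0).2 hlarge
    linarith
  have hsw : s * width F u = width F u - ε := by rw [hs]; field_simp
  have hrel : ∀ q ∈ F, z + s • (q - z) ∈ F ∧ ∀ i ∉ I, ⟪A i, z + s • (q - z)⟫_ℝ < B i := by
    intro q hq
    constructor
    · exact (IsRep.convex_facet i₀).add_smul_sub_mem hz hq ⟨hs0, hs1.le⟩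
    · intro i hi
      rw [inner_add_right, inner_smul_right, inner_sub_right]
      nlinarith [hzs i hi, hq.1 i]
  set w := x - y with hw
  have hwA : ∀ i ∈ I, ⟪A i, w⟫_ℝ = 0 := fun i hi => by
    rw [hw, inner_sub_right, hFI i hi x hx, hFI i hi y hy, sub_self]
  have hi₀ : i₀ ∈ I := by simp [hI, hF]
  have huw : ⟪u, w⟫_ℝ ≠ 0 := by rw [← hxy]; exact hw0.ne'
  -- an outward direction orthogonal to `u`
  set d := A i₀ - (⟪u, A i₀⟫_ℝ / ⟪u, w⟫_ℝ) • w with hd'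
  have hud : ⟪u, d⟫_ℝ = 0 := by
    rw [hd', inner_sub_right, inner_smul_right, div_mul_cancel₀ _ huw, sub_self]
  have hAd : ⟪A i₀, d⟫_ℝ = 1 := by
    rw [hd', inner_sub_right, inner_smul_right, hwA i₀ hi₀, real_inner_self_eq_norm_sq, h.norm_eq]
    norm_num
  have hpts : ∀ q ∈ F, (∀ i ∉ I, ⟪A i, q⟫_ℝ < B i) → ∃ q₁ q₂ : E3, ⟪u, q₁⟫_ℝ = ⟪u, q⟫_ℝ ∧
      ⟪u, q₂⟫_ℝ = ⟪u, q⟫_ℝ ∧ (∀ i, ⟪A i, q₁⟫_ℝ < B i) ∧ (∀ i ∉ I, ⟪A i, q₂⟫_ℝ < B i) ∧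
      B i₀ < ⟪A i₀, q₂⟫_ℝ := by
    intro q hq hqI
    -- an inward direction orthogonal to `u`
    set e := p - q - (⟪u, p - q⟫_ℝ / ⟪u, w⟫_ℝ) • w with he
    have hue : ⟪u, e⟫_ℝ = 0 := by
      rw [he, inner_sub_right, inner_smul_right, div_mul_cancel₀ _ huw, sub_self]
    have hAe : ∀ i ∈ I, ⟪A i, e⟫_ℝ < 0 := fun i hi => by
      rw [he, inner_sub_right, inner_smul_right, hwA i hi, inner_sub_right, hFI i hi q hq]
      linarith [hp i]
    have hev : ∀ v : E3, ∀ᶠ τ in 𝓝[>] (0 : ℝ), ∀ i ∉ I, ⟪A i, q + τ • v⟫_ℝ < B i := by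
      intro v
      refine eventually_all.2 fun i => ?_
      by_cases hi : i ∈ I
      · exact Eventually.of_forall fun τ hn => absurd hi hn
      · have hc : Continuous fun τ : ℝ => ⟪A i, q + τ • v⟫_ℝ := by fun_prop
        have := ((hc.tendsto 0).mono_left
          (nhdsWithin_le_nhds (s := Ioi 0))).eventually_lt_const (u := B i)
          (by simpa using hqI i hi)
        filter_upwards [this] with τ hτ _ using hτ
    obtain ⟨τ, hτ₁, hτ₂, hτ⟩ := ((hev e).and ((hev d).and
      (self_mem_nhdsWithin : Ioi (0 : ℝ) ∈ 𝓝[>] 0))).exists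
    have hτ : 0 < τ := hτ
    refine ⟨q + τ • e, q + τ • d, ?_, ?_, fun i => ?_, hτ₂, ?_⟩
    · rw [inner_add_right, inner_smul_right, hue, mul_zero, add_zero]
    · rw [inner_add_right, inner_smul_right, hud, mul_zero, add_zero]
    · by_cases hi : i ∈ I
      · rw [inner_add_right, inner_smul_right, hFI i hi q hq]
        nlinarith [hAe i hi]
      · exact hτ₁ i hi
    · rw [inner_add_right, inner_smul_right, hAd, hFI i₀ hi₀ q hq]
      linarith
  obtain ⟨hx'F, hx'I⟩ := hrel x hx
  obtain ⟨hy'F, hy'I⟩ := hrel y hy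
  set x' := z + s • (x - z) with hx'
  set y' := z + s • (y - z) with hy'
  have hxy' : ⟪u, x' - y'⟫_ℝ = width F u - ε := by
    rw [← hsw, hxy, hx', hy', ← inner_smul_right]
    congr 1
    module
  obtain ⟨x₁, x₂, hux₁, hux₂, hx₁, hx₂, hx₂'⟩ := hpts x' hx'F hx'I
  obtain ⟨y₁, y₂, huy₁, huy₂, hy₁, hy₂, hy₂'⟩ := hpts y' hy'F hy'I
  have e₁ : ∀ᶠ n in atTop, ∀ i, ⟪a n i, x₁⟫_ℝ < b n i :=
    eventually_all.2 fun i => h.eventually_lt (hx₁ i)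
  have e₂ : ∀ᶠ n in atTop, ∀ i, ⟪a n i, y₁⟫_ℝ < b n i :=
    eventually_all.2 fun i => h.eventually_lt (hy₁ i)
  have e₃ : ∀ᶠ n in atTop, ∀ i, i ∉ I → ⟪a n i, x₂⟫_ℝ < b n i :=
    eventually_all.2 fun i => by
      by_cases hi : i ∈ I
      · exact Eventually.of_forall fun n hn => absurd hi hn
      · filter_upwards [h.eventually_lt (hx₂ i hi)] with n hn _ using hn
  have e₄ : ∀ᶠ n in atTop, ∀ i, i ∉ I → ⟪a n i, y₂⟫_ℝ < b n i :=
    eventually_all.2 fun i => by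
      by_cases hi : i ∈ I
      · exact Eventually.of_forall fun n hn => absurd hi hn
      · filter_upwards [h.eventually_lt (hy₂ i hi)] with n hn _ using hn
  filter_upwards [e₁, e₂, e₃, e₄, h.eventually_gt hx₂', h.eventually_gt hy₂'] with n f₁ f₂ f₃ f₄ f₅ f₆
  rw [← hxy', inner_sub_right]
  refine sub_le_sum_width I (facet (a n) (b n)) (fun i _ => (h.isRep n).isCompact_facet i)
    (fun i _ => (h.isRep n).facet_nonempty i) (fun i _ => IsRep.convex_facet i) u fun r hr => ?_
  -- for each value `r` of `⟪u, ·⟫`, a segment in the plane `⟪u, ·⟫ = r` leaves the polyhedron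
  -- through a face that converges to `F`
  obtain ⟨α, β, hα, hβ, hαβ, hr'⟩ : ∃ α β : ℝ, 0 ≤ α ∧ 0 ≤ β ∧ α + β = 1 ∧
      α * ⟪u, y'⟫_ℝ + β * ⟪u, x'⟫_ℝ = r := by
    rw [← segment_eq_Icc (hr.1.trans hr.2)] at hr
    obtain ⟨α, β, hα, hβ, hαβ, hr⟩ := hr
    exact ⟨α, β, hα, hβ, hαβ, by simpa using hr⟩
  have hlt : ∀ {i : Fin k} {v v' : E3} {c : ℝ}, ⟪a n i, v⟫_ℝ < c → ⟪a n i, v'⟫_ℝ < c →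
      ∀ {α β : ℝ}, 0 ≤ α → 0 ≤ β → α + β = 1 → ⟪a n i, α • v + β • v'⟫_ℝ < c := by
    intro i v v' c hv hv' α β hα hβ hαβ
    have hconv : Convex ℝ {v : E3 | innerSL ℝ (a n i) v < c} :=
      convex_halfSpace_lt (innerSL ℝ (a n i)).toLinearMap.isLinear c
    exact hconv hv hv' hα hβ hαβ
  have hin : α • y₁ + β • x₁ ∈ halfspaces (a n) (b n) := fun i =>
    (hlt (f₂ i) (f₁ i) hα hβ hαβ).le
  have hout : α • y₂ + β • x₂ ∉ halfspaces (a n) (b n) := fun hmem => by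
    have h1 := hmem i₀
    rw [inner_add_right, inner_smul_right, inner_smul_right] at h1
    have h2 : b n i₀ = α * b n i₀ + β * b n i₀ := by rw [← add_mul, hαβ, one_mul]
    rcases hα.eq_or_lt with h3 | h3
    · have : β = 1 := by linarith
      rw [← h3, this] at h1
      linarith
    · nlinarith [mul_lt_mul_of_pos_left f₆ h3, mul_le_mul_of_nonneg_left f₅.le hβ]
  obtain ⟨v, hv, i, hvi⟩ := exists_facet_of_exit hin hout
  obtain ⟨α', β', hα', hβ', hαβ', rfl⟩ := hv
  refine ⟨i, ?_, _, hvi, ?_⟩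
  · by_contra hi
    exact (hlt (hlt (f₂ i) (f₁ i) hα hβ hαβ) (hlt (f₄ i hi) (f₃ i hi) hα hβ hαβ)
      hα' hβ' hαβ').ne hvi.2
  · simp only [inner_add_right, inner_smul_right, hux₁, hux₂, huy₁, huy₂]
    rw [hr', ← add_mul, hαβ', one_mul]

end IsConvergentFamily

theorem ConvexPolyhedron.melzakRatio_pos (P : ConvexPolyhedron) : 0 < P.melzakRatio :=
  div_pos (pow_pos P.edgeLength_pos 3) P.vol_pos

open scoped Classical in
/-- The edge length is lower semicontinuous and the volume upper semicontinuous in the limit;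
the number of faces may drop. -/
theorem IsConvergentFamily.exists_limit {k : ℕ} {Q : ℕ → ConvexPolyhedron} {a : ℕ → Fin k → E3}
    {b : ℕ → Fin k → ℝ} {A : Fin k → E3} {B : Fin k → ℝ} (h : IsConvergentFamily Q a b A B)
    {L : ℝ} (hL0 : 0 < L) (hL : Tendsto (fun n => (Q n).vol) atTop (𝓝 L)) :
    ∃ R : ConvexPolyhedron, R.numFaces ≤ k ∧ R.edgeLength ≤ 1 ∧ L ≤ R.vol := by
  obtain ⟨p, hp⟩ := h.exists_strict hL0 hL
  have hsub := h.halfspaces_subset hL0 hL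
  set R := ofHalfspaces A B (Metric.isBounded_closedBall.subset hsub)
    (interior_halfspaces_nonempty hp) with hR
  have hcar : R.carrier = halfspaces A B := rfl
  have hfaces : R.faces ⊆ range (facet A B) := fun F hF => by
    obtain ⟨i, hi⟩ := eq_facet_of_finrank_eq_two h.norm_eq (hcar ▸ R.solid) hF.2.1 hF.1 hF.2.2
    exact ⟨i, hi.symm⟩
  refine ⟨R, ?_, ?_, ?_⟩
  · calc R.numFaces ≤ (range (facet A B)).ncard := ncard_le_ncard hfaces (finite_range _)
      _ ≤ (univ : Set (Fin k)).ncard := by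
        rw [← image_univ]; exact ncard_image_le
      _ = k := by rw [ncard_univ, Nat.card_fin]
  · have hfin : R.faces.Finite := R.facesOfDim_finite 2
    set W : E3 → ℝ := fun u => ∑ F ∈ hfin.toFinset, width F u with hW
    set V : ℕ → E3 → ℝ := fun n u => ∑ i, width (facet (a n) (b n) i) u with hV
    have hcF : ∀ F ∈ hfin.toFinset, Continuous (width F) := fun F hF =>
      continuous_width (ConvexPolyhedron.isCompact_of_mem_facesOfDim (hfin.mem_toFinset.1 hF))
    have hcV : ∀ n i, Continuous (width (facet (a n) (b n) i)) := fun n i =>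
      continuous_width ((h.isRep n).isCompact_facet i)
    have hWc : Continuous W := continuous_finsetSum _ fun F hF => hcF F hF
    have hVc : ∀ n, Continuous (V n) := fun n => continuous_finsetSum _ fun i _ => hcV n i
    have hVi : ∀ n, ∫ u in Metric.ball (0 : E3) 2, V n u = widthConst := fun n => by
      rw [integral_finsetSum _ fun i _ => integrableOn_ball (hcV n i) 2]
      have := (h.isRep n).widthConst_mul_edgeLength
      rw [h.edgeLength_eq, mul_one] at this
      exact this.symm
    have hWnn : ∀ u, 0 ≤ W u := fun u => Finset.sum_nonneg fun F hF =>
      width_nonneg (ConvexPolyhedron.isCompact_of_mem_facesOfDim (hfin.mem_toFinset.1 hF))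
        (hfin.mem_toFinset.1 hF).1 u
    have hVnn : ∀ n u, 0 ≤ V n u := fun n u => Finset.sum_nonneg fun i _ =>
      width_nonneg ((h.isRep n).isCompact_facet i) ((h.isRep n).facet_nonempty i) u
    have hev : ∀ u, ∀ ε > 0, ∀ᶠ n in atTop, W u - ε ≤ V n u := by
      intro u ε hε
      set N : ℝ := (hfin.toFinset.card : ℝ) + 1 with hN
      have hN0 : 0 < N := by positivity
      have h1 : ∀ᶠ n in atTop, ∀ F ∈ hfin.toFinset, width F u - ε / N ≤
          ∑ i ∈ Finset.univ.filter (fun i => facet A B i = F),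
            width (facet (a n) (b n) i) u := by
        rw [Filter.eventually_all_finset]
        intro F hF
        rw [hfin.mem_toFinset] at hF
        obtain ⟨i, rfl⟩ := hfaces hF
        exact h.eventually_width_le hp (hcar ▸ R.isCompact) hF.2.2 u (by positivity)
      filter_upwards [h1] with n hn
      have h2 := Finset.sum_le_sum hn
      have h3 : ∑ F ∈ hfin.toFinset, ∑ i ∈ Finset.univ.filter (fun i => facet A B i = F),
          width (facet (a n) (b n) i) u ≤ V n u :=
        Finset.sum_fiberwise_le_sum_of_sum_fiber_nonneg fun F _ => Finset.sum_nonneg fun i _ =>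
          width_nonneg ((h.isRep n).isCompact_facet i) ((h.isRep n).facet_nonempty i) u
      rw [Finset.sum_sub_distrib, Finset.sum_const, nsmul_eq_mul] at h2
      have h4 : (hfin.toFinset.card : ℝ) * (ε / N) ≤ ε := by
        rw [mul_div_assoc', div_le_iff₀ hN0, hN]
        nlinarith
      linarith
    have hlim : Tendsto (fun n => ∫ u in Metric.ball (0 : E3) 2, min (W u) (V n u)) atTop
        (𝓝 (∫ u in Metric.ball (0 : E3) 2, W u)) := by
      refine tendsto_integral_of_dominated_convergence W
        (fun n => (hWc.min (hVc n)).aestronglyMeasurable) (integrableOn_ball hWc 2)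
        (fun n => Eventually.of_forall fun u => ?_) (Eventually.of_forall fun u => ?_)
      · rw [Real.norm_of_nonneg (le_min (hWnn u) (hVnn n u))]
        exact min_le_left _ _
      · rw [tendsto_order]
        refine ⟨fun c hc => ?_, fun c hc => Eventually.of_forall fun n =>
          (min_le_left _ _).trans_lt hc⟩
        filter_upwards [hev u ((W u - c) / 2) (by linarith)] with n hn
        exact lt_min hc (by linarith)
    have hle : ∫ u in Metric.ball (0 : E3) 2, W u ≤ widthConst := by
      refine le_of_tendsto' hlim fun n => ?_
      rw [← hVi n]
      exact integral_mono (integrableOn_ball (hWc.min (hVc n)) 2) (integrableOn_ball (hVc n) 2)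
        fun u => min_le_right _ _
    rw [integral_finsetSum _ fun F hF => integrableOn_ball (hcF F hF) 2] at hle
    refine le_of_mul_le_mul_left ?_ widthConst_pos
    rw [R.widthConst_mul_edgeLength, finsum_mem_eq_finite_toFinset_sum _ hfin, mul_one]
    exact hle
  · rw [ConvexPolyhedron.vol, hcar]
    have := h.le_volume hL
    rwa [inter_eq_self_of_subset_left hsub] at this

/-- The infimum of the Melzak ratio over the polyhedra with `k` faces is attained by a polyhedron
with at most `k` faces. -/
theorem exists_numFaces_le_melzakRatio_le {k : ℕ} (hk : ∃ P : ConvexPolyhedron, P.numFaces = k) :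
    ∃ R : ConvexPolyhedron, R.numFaces ≤ k ∧
      ∀ P : ConvexPolyhedron, P.numFaces = k → R.melzakRatio ≤ P.melzakRatio := by
  set S : Set ℝ := ConvexPolyhedron.melzakRatio '' {P | P.numFaces = k} with hS
  have hSne : S.Nonempty := by
    obtain ⟨P, hP⟩ := hk
    exact ⟨_, P, hP, rfl⟩
  have hSb : BddBelow S := ⟨0, by
    rintro _ ⟨P, -, rfl⟩
    exact P.melzakRatio_pos.le⟩
  obtain ⟨r, -, hr, hrS⟩ := exists_seq_tendsto_sInf hSne hSb
  have hnorm : ∀ n, ∃ (Q : ConvexPolyhedron) (a : Fin k → E3) (b : Fin k → ℝ), IsRep Q a b ∧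
      0 ∈ Q.carrier ∧ Q.edgeLength = 1 ∧ Q.vol = (r n)⁻¹ := by
    intro n
    obtain ⟨P, hP, hPr⟩ := hrS n
    obtain ⟨Q, a, b, h⟩ := exists_normalized P
    have hP : P.numFaces = k := hP
    subst hP
    exact ⟨Q, a, b, by rw [← hPr]; exact h⟩
  choose Q a b hrep h0 he hv using hnorm
  have hball : ∀ n, (Q n).carrier ⊆ Metric.closedBall 0 1 := fun n x hx => by
    have := ConvexPolyhedron.norm_sub_le_edgeLength hx (h0 n)
    rwa [sub_zero, he, ← mem_closedBall_zero_iff] at this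
  have hbd : ∀ n, (a n, b n) ∈ Metric.closedBall (0 : (Fin k → E3) × (Fin k → ℝ)) 1 := by
    intro n
    rw [mem_closedBall_zero_iff, Prod.norm_def, max_le_iff,
      pi_norm_le_iff_of_nonneg zero_le_one, pi_norm_le_iff_of_nonneg zero_le_one]
    refine ⟨fun i => ((hrep n).norm_eq i).le, fun i => ?_⟩
    obtain ⟨x, hx⟩ := (hrep n).facet_nonempty i
    have hx1 : ‖x‖ ≤ 1 := mem_closedBall_zero_iff.1 (hball n ((hrep n).carrier_eq ▸ hx.1))
    have h1 := abs_real_inner_le_norm (a n i) x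
    rw [(hrep n).norm_eq, one_mul, hx.2] at h1
    exact h1.trans hx1
  obtain ⟨⟨A, B⟩, -, φ, hφ, hlim⟩ := tendsto_subseq_of_bounded Metric.isBounded_closedBall hbd
  rw [Prod.tendsto_iff] at hlim
  have hfam : IsConvergentFamily (fun n => Q (φ n)) (fun n => a (φ n)) (fun n => b (φ n)) A B :=
    ⟨fun n => hrep _, fun n => h0 _, fun n => he _, fun i => tendsto_pi_nhds.1 hlim.1 i,
      fun i => tendsto_pi_nhds.1 hlim.2 i⟩
  have hβ : 0 < volume.real (Metric.closedBall (0 : E3) 1) :=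
    ENNReal.toReal_pos (Metric.measure_closedBall_pos volume _ one_pos).ne'
      measure_closedBall_lt_top.ne
  have hM : 0 < sInf S := by
    refine lt_of_lt_of_le (inv_pos.2 hβ) (ge_of_tendsto' hr fun n => ?_)
    have hrn : 0 < r n := by
      obtain ⟨P, -, hP⟩ := hrS n
      exact hP ▸ P.melzakRatio_pos
    refine inv_le_of_inv_le₀ hrn ?_
    rw [← hv]
    exact measureReal_mono (hball n) measure_closedBall_lt_top.ne
  have hvol : Tendsto (fun n => (Q (φ n)).vol) atTop (𝓝 (sInf S)⁻¹) := by
    simp_rw [hv]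
    exact (hr.inv₀ hM.ne').comp hφ.tendsto_atTop
  obtain ⟨R, hRk, hRe, hRv⟩ := hfam.exists_limit (inv_pos.2 hM) hvol
  refine ⟨R, hRk, fun P hP => le_trans ?_ (csInf_le hSb ⟨P, hP, rfl⟩)⟩
  rw [ConvexPolyhedron.melzakRatio, div_le_iff₀ R.vol_pos]
  have h1 : R.edgeLength ^ 3 ≤ 1 := pow_le_one₀ R.edgeLength_pos.le hRe
  have h2 : sInf S * (sInf S)⁻¹ ≤ sInf S * R.vol := mul_le_mul_of_nonneg_left hRv hM.le
  rw [mul_inv_cancel₀ hM.ne'] at h2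
  linarith

/-! ### Tetrahedra -/

namespace IsRep

variable {ι : Type*} {P : ConvexPolyhedron} {a : ι → E3} {b : ι → ℝ}

/-- A polyhedron contains no ray. -/
theorem eq_zero_of_recession (h : IsRep P a b) {w : E3} (hw : ∀ i, ⟪a i, w⟫_ℝ ≤ 0) : w = 0 := by
  by_contra hw0
  obtain ⟨x, hx⟩ := P.nonempty
  obtain ⟨R, hR⟩ := P.isCompact.isBounded.subset_closedBall x
  have hR0 : 0 ≤ R := by simpa using hR hx
  have hmem : x + ((R + 1) / ‖w‖) • w ∈ P.carrier := by
    rw [h.carrier_eq] at hx ⊢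
    intro i
    rw [inner_add_right, inner_smul_right]
    have : (R + 1) / ‖w‖ * ⟪a i, w⟫_ℝ ≤ 0 := mul_nonpos_of_nonneg_of_nonpos (by positivity) (hw i)
    linarith [hx i]
  have := hR hmem
  rw [Metric.mem_closedBall, dist_eq_norm, add_sub_cancel_left, norm_smul, norm_div, norm_norm,
    div_mul_cancel₀ _ (norm_ne_zero_iff.2 hw0), Real.norm_of_nonneg (by linarith)] at this
  linarith

end IsRep

theorem exists_isRep_of_numFaces_eq {P : ConvexPolyhedron} {k : ℕ} (hk : P.numFaces = k) :
    ∃ (a : Fin k → E3) (b : Fin k → ℝ), IsRep P a b := by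
  subst hk
  exact exists_isRep P

/-- A nonempty intersection of at most three half-spaces contains a ray: either some vector
is orthogonal to all their normals, or some vector has the inner product `-1` with each of them. -/
theorem four_le_numFaces (P : ConvexPolyhedron) : 4 ≤ P.numFaces := by
  generalize hP : P.numFaces = k
  obtain ⟨a, b, h⟩ := exists_isRep_of_numFaces_eq hP
  by_contra! hk
  let f : E3 →ₗ[ℝ] (Fin k → ℝ) := LinearMap.pi fun i => (innerSL ℝ (a i) : E3 →ₗ[ℝ] ℝ)
  have hf : ∀ w i, f w i = ⟪a i, w⟫_ℝ := fun w i => rfl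
  have hinj : Function.Injective f := by
    rw [← LinearMap.ker_eq_bot, LinearMap.ker_eq_bot']
    intro w hw
    exact h.eq_zero_of_recession fun i => by rw [← hf, hw]; rfl
  have hfr := LinearMap.finrank_le_finrank_of_injective hinj
  have h3 : finrank ℝ E3 = 3 := by simp
  have hk' : finrank ℝ (Fin k → ℝ) = k := by simp
  rw [h3, hk'] at hfr
  have hsurj := (LinearMap.injective_iff_surjective_of_finrank_eq_finrank
    (h3.trans ((by omega : 3 = k).trans hk'.symm))).1 hinj
  obtain ⟨w, hw⟩ := hsurj fun _ => -1
  have hw' : ∀ i, ⟪a i, w⟫_ℝ = -1 := fun i => by rw [← hf, hw]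
  have hw0 := h.eq_zero_of_recession fun i => by rw [hw']; norm_num
  have := hw' ⟨0, by omega⟩
  rw [hw0, inner_zero_right] at this
  norm_num at this

/-- A polyhedron with four faces is a tetrahedron. -/
theorem exists_affineBasis_of_numFaces_eq_four {P : ConvexPolyhedron} (hP : P.numFaces = 4) :
    ∃ p : AffineBasis (Fin 4) ℝ E3, P.carrier = convexHull ℝ (range p) := by
  obtain ⟨a, b, h⟩ := exists_isRep_of_numFaces_eq hP
  have h3 : finrank ℝ E3 = 3 := by simp
  have hvert : ∀ i : Fin 4, ∃ p : E3, ∀ j, j ≠ i → ⟪a j, p⟫_ℝ = b j := by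
    intro i
    let f : E3 →ₗ[ℝ] (Fin 3 → ℝ) :=
      LinearMap.pi fun j => (innerSL ℝ (a (i.succAbove j)) : E3 →ₗ[ℝ] ℝ)
    have hf : ∀ w j, f w j = ⟪a (i.succAbove j), w⟫_ℝ := fun w j => rfl
    have hinj : Function.Injective f := by
      rw [← LinearMap.ker_eq_bot, LinearMap.ker_eq_bot']
      intro w hw
      have hz : ∀ j, j ≠ i → ⟪a j, w⟫_ℝ = 0 := fun j hj => by
        obtain ⟨l, rfl⟩ := Fin.exists_succAbove_eq hj
        rw [← hf, hw]; rfl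
      rcases le_total ⟪a i, w⟫_ℝ 0 with h0 | h0
      · refine h.eq_zero_of_recession fun j => ?_
        by_cases hj : j = i
        · subst hj; exact h0
        · exact (hz j hj).le
      · refine neg_eq_zero.1 (h.eq_zero_of_recession fun j => ?_)
        rw [inner_neg_right]
        by_cases hj : j = i
        · subst hj; linarith
        · rw [hz j hj, neg_zero]
    have hsurj := (LinearMap.injective_iff_surjective_of_finrank_eq_finrank
      (h3.trans (by simp : 3 = finrank ℝ (Fin 3 → ℝ)))).1 hinj
    obtain ⟨p, hp⟩ := hsurj fun j => b (i.succAbove j)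
    refine ⟨p, fun j hj => ?_⟩
    obtain ⟨l, rfl⟩ := Fin.exists_succAbove_eq hj
    rw [← hf, hp]
  -- `p i` is the common point of the three planes other than the `i`-th one
  choose p hp using hvert
  obtain ⟨x, hx⟩ := h.exists_strict
  have hpi : ∀ i, ⟪a i, p i⟫_ℝ < b i := by
    intro i
    by_contra! hcon
    have hw : x - p i = 0 := h.eq_zero_of_recession fun j => by
      rw [inner_sub_right]
      by_cases hj : j = i
      · subst hj; linarith [hx j]
      · rw [hp i j hj]; linarith [hx j]
    obtain ⟨j, hj⟩ := exists_ne i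
    have := hx j
    rw [sub_eq_zero.1 hw, hp i j hj] at this
    exact lt_irrefl _ this
  have hcomb : ∀ (s : Finset (Fin 4)) (w : Fin 4 → ℝ) (i : Fin 4), i ∈ s →
      ⟪a i, ∑ j ∈ s, w j • p j⟫_ℝ = (∑ j ∈ s, w j) * b i - w i * (b i - ⟪a i, p i⟫_ℝ) := by
    intro s w i hi
    rw [inner_sum, ← Finset.add_sum_erase s _ hi, ← Finset.add_sum_erase s w hi]
    have : ∑ j ∈ s.erase i, ⟪a i, w j • p j⟫_ℝ = (∑ j ∈ s.erase i, w j) * b i := by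
      rw [Finset.sum_mul]
      refine Finset.sum_congr rfl fun j hj => ?_
      rw [inner_smul_right, hp j i (Finset.ne_of_mem_erase hj).symm]
    rw [this, inner_smul_right]
    ring
  have hind : AffineIndependent ℝ p := by
    rw [affineIndependent_iff]
    intro s w hw0 hwp i hi
    have := hcomb s w i hi
    rw [hwp, hw0, inner_zero_right, zero_mul, zero_sub, zero_eq_neg, mul_eq_zero] at this
    exact this.resolve_right (sub_pos.2 (hpi i)).ne'
  have htop : affineSpan ℝ (range p) = ⊤ := by
    rw [hind.affineSpan_eq_top_iff_card_eq_finrank_add_one]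
    simp
  refine ⟨⟨p, hind, htop⟩, ?_⟩
  set B : AffineBasis (Fin 4) ℝ E3 := ⟨p, hind, htop⟩ with hB
  rw [B.convexHull_eq_nonneg_coord, h.carrier_eq]
  ext y
  refine forall_congr' fun i => ?_
  have h1 := hcomb Finset.univ (fun j => B.coord j y) i (Finset.mem_univ i)
  have h2 : ∑ j, B.coord j y • p j = y := B.linear_combination_coord_eq_self y
  rw [h2, B.sum_coord_apply_eq_one, one_mul] at h1
  rw [h1, sub_le_self_iff]
  exact mul_nonneg_iff_of_pos_right (sub_pos.2 (hpi i))

/-- The faces of a tetrahedron, as the zero sets of the barycentric coordinates. -/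
theorem exists_isRep_of_affineBasis {P : ConvexPolyhedron} (p : AffineBasis (Fin 4) ℝ E3)
    (hP : P.carrier = convexHull ℝ (range p)) :
    ∃ (a : Fin 4 → E3) (b : Fin 4 → ℝ), IsRep P a b ∧
      ∀ i, facet a b i = {x ∈ P.carrier | p.coord i x = 0} := by
  set g : Fin 4 → E3 := fun i =>
    (InnerProductSpace.toDual ℝ E3).symm (LinearMap.toContinuousLinearMap (p.coord i).linear)
    with hg
  have hgi : ∀ i v, ⟪g i, v⟫_ℝ = (p.coord i).linear v := fun i v =>
    InnerProductSpace.toDual_symm_apply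
  have hcoord : ∀ i x, p.coord i x = ⟪g i, x⟫_ℝ + p.coord i 0 := fun i x => by
    rw [hgi]
    have := (p.coord i).linearMap_vsub x 0
    rw [vsub_eq_sub, vsub_eq_sub, sub_zero] at this
    rw [this]; ring
  have hg0 : ∀ i, 0 < ‖g i‖ := fun i => by
    rw [norm_pos_iff]
    intro h0
    obtain ⟨j, hj⟩ := exists_ne i
    have h1 := hcoord i (p i)
    have h2 := hcoord i (p j)
    rw [h0, inner_zero_left, zero_add] at h1 h2
    rw [p.coord_apply_eq] at h1
    rw [p.coord_apply_ne hj.symm] at h2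
    linarith
  set a : Fin 4 → E3 := fun i => -(‖g i‖⁻¹ • g i) with ha
  set b : Fin 4 → ℝ := fun i => ‖g i‖⁻¹ * p.coord i 0 with hb
  have hdiff : ∀ i x, b i - ⟪a i, x⟫_ℝ = ‖g i‖⁻¹ * p.coord i x := fun i x => by
    rw [ha, hb, inner_neg_left, real_inner_smul_left, hcoord i x]
    ring
  have hle : ∀ i x, ⟪a i, x⟫_ℝ ≤ b i ↔ 0 ≤ p.coord i x := fun i x => by
    rw [← sub_nonneg, hdiff]
    exact mul_nonneg_iff_of_pos_left (inv_pos.2 (hg0 i))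
  have hlt : ∀ i x, ⟪a i, x⟫_ℝ < b i ↔ 0 < p.coord i x := fun i x => by
    rw [← sub_pos, hdiff]
    exact mul_pos_iff_of_pos_left (inv_pos.2 (hg0 i))
  have heq : ∀ i x, ⟪a i, x⟫_ℝ = b i ↔ p.coord i x = 0 := fun i x => by
    rw [eq_comm, ← sub_eq_zero, hdiff, mul_eq_zero, or_iff_right (inv_pos.2 (hg0 i)).ne']
  have hcar : P.carrier = halfspaces a b := by
    rw [hP, p.convexHull_eq_nonneg_coord]
    ext x
    exact forall_congr' fun i => (hle i x).symm
  refine ⟨a, b, ⟨hcar, fun i => ?_, fun i => ?_⟩, fun i => ?_⟩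
  · rw [ha, norm_neg, norm_smul, norm_inv, norm_norm, inv_mul_cancel₀ (hg0 i).ne']
  · -- the centroid of the face opposite to `p i`
    refine ⟨AffineMap.lineMap (p i) (Finset.univ.centroid ℝ p) (4 / 3 : ℝ), ?_, fun j hj => ?_⟩
    · rw [heq, AffineMap.apply_lineMap, p.coord_apply_eq, p.coord_apply_centroid (Finset.mem_univ i)]
      norm_num [AffineMap.lineMap_apply]
    · rw [hlt, AffineMap.apply_lineMap, p.coord_apply_ne hj,
        p.coord_apply_centroid (Finset.mem_univ j)]
      norm_num [AffineMap.lineMap_apply]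
  · rw [hcar]
    ext x
    exact and_congr_right fun _ => heq i x

/-- Twice the length of the smallest interval containing three numbers is the sum of their
distances. -/
theorem two_mul_eq_sum_abs {r s t w : ℝ} (h₁ : |r - s| ≤ w) (h₂ : |s - t| ≤ w) (h₃ : |r - t| ≤ w)
    (h : ∀ c, |r - s| ≤ c → |s - t| ≤ c → |r - t| ≤ c → w ≤ c) :
    2 * w = |r - s| + |s - t| + |r - t| := by
  have h4 := h ((|r - s| + |s - t| + |r - t|) / 2)
    (by linarith [abs_sub_le r t s, abs_sub_comm s t])
    (by linarith [abs_sub_le s r t, abs_sub_comm r s])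
    (by linarith [abs_sub_le r s t])
  rcases abs_cases (r - s) with h5 | h5 <;> rcases abs_cases (s - t) with h6 | h6 <;>
    rcases abs_cases (r - t) with h7 | h7 <;> linarith

/-- A face of a tetrahedron is a triangle, and twice its width is the total width of its sides. -/
theorem two_mul_width_face {P : ConvexPolyhedron} (p : AffineBasis (Fin 4) ℝ E3)
    (hP : P.carrier = convexHull ℝ (range p)) {i j k l : Fin 4}
    (hl : ∀ m, m ≠ i ↔ m = j ∨ m = k ∨ m = l) (u : E3) :
    2 * width {x ∈ P.carrier | p.coord i x = 0} u =
      |⟪u, p j - p k⟫_ℝ| + |⟪u, p k - p l⟫_ℝ| + |⟪u, p j - p l⟫_ℝ| := by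
  set F := {x ∈ P.carrier | p.coord i x = 0} with hF
  have hpF : ∀ m, m ≠ i → p m ∈ F := fun m hm =>
    ⟨hP ▸ subset_convexHull ℝ _ (mem_range_self m), p.coord_apply_ne hm.symm⟩
  have hFc : IsCompact F := by
    refine P.isCompact.inter_right (isClosed_eq ?_ continuous_const)
    exact (p.coord i).continuous_of_finiteDimensional
  have hFsub : F ⊆ convexHull ℝ (p '' {i}ᶜ) := by
    rintro x ⟨hx, hxi⟩
    rw [hP, p.convexHull_eq_nonneg_coord] at hx
    have h1 : ∑ m, p.coord m x • p m = x := p.linear_combination_coord_eq_self x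
    have h2 := p.sum_coord_apply_eq_one x
    rw [← Finset.add_sum_erase _ _ (Finset.mem_univ i), hxi] at h1 h2
    rw [zero_smul, zero_add] at h1
    rw [zero_add] at h2
    rw [← h1]
    exact (convex_convexHull ℝ _).sum_mem (fun m _ => hx m) h2 fun m hm =>
      subset_convexHull ℝ _ (mem_image_of_mem p (Finset.ne_of_mem_erase hm))
  have hj := hpF j ((hl j).2 (Or.inl rfl))
  have hk := hpF k ((hl k).2 (Or.inr (Or.inl rfl)))
  have hll := hpF l ((hl l).2 (Or.inr (Or.inr rfl)))
  have habs : ∀ x ∈ F, ∀ y ∈ F, |⟪u, x⟫_ℝ - ⟪u, y⟫_ℝ| ≤ width F u := fun x hx y hy => by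
    have h1 := inner_sub_le_width hFc u hx hy
    have h2 := inner_sub_le_width hFc u hy hx
    rw [inner_sub_right] at h1 h2
    exact abs_le'.2 ⟨h1, by linarith⟩
  simp only [inner_sub_right]
  refine two_mul_eq_sum_abs (habs _ hj _ hk) (habs _ hk _ hll) (habs _ hj _ hll)
    fun c h1 h2 h3 => ?_
  have hc0 : 0 ≤ c := (abs_nonneg _).trans h1
  have hpts : ∀ m ∈ ({i}ᶜ : Set (Fin 4)), ∀ n ∈ ({i}ᶜ : Set (Fin 4)),
      ⟪u, p m⟫_ℝ - ⟪u, p n⟫_ℝ ≤ c := by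
    intro m hm n hn
    rw [abs_le] at h1 h2 h3
    rcases (hl m).1 hm with rfl | rfl | rfl <;> rcases (hl n).1 hn with rfl | rfl | rfl <;>
      linarith [h1.1, h1.2, h2.1, h2.2, h3.1, h3.2]
  have hle : ∀ r, Convex ℝ {x : E3 | ⟪u, x⟫_ℝ ≤ r} := fun r =>
    convex_halfSpace_le (innerSL ℝ u).toLinearMap.isLinear r
  have hge : ∀ r, Convex ℝ {x : E3 | r ≤ ⟪u, x⟫_ℝ} := fun r =>
    convex_halfSpace_ge (innerSL ℝ u).toLinearMap.isLinear r
  refine width_le hFc ⟨_, hj⟩ fun x hx y hy => ?_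
  have hx1 : ∀ n ∈ ({i}ᶜ : Set (Fin 4)), ⟪u, x⟫_ℝ ≤ c + ⟪u, p n⟫_ℝ := fun n hn => by
    refine convexHull_min ?_ (hle (c + ⟪u, p n⟫_ℝ)) (hFsub hx)
    rintro _ ⟨m, hm, rfl⟩
    have := hpts m hm n hn
    change ⟪u, p m⟫_ℝ ≤ _
    linarith
  have hy1 : ⟪u, x⟫_ℝ - c ≤ ⟪u, y⟫_ℝ := by
    refine convexHull_min ?_ (hge (⟪u, x⟫_ℝ - c)) (hFsub hy)
    rintro _ ⟨n, hn, rfl⟩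
    have := hx1 n hn
    change _ ≤ ⟪u, p n⟫_ℝ
    linarith
  rw [inner_sub_right]
  linarith

/-- The total length of the edges of a tetrahedron is that of the segments between its vertices,
by the integral formula for the edge length. -/
theorem edgeLength_tetrahedron {P : ConvexPolyhedron} (p : AffineBasis (Fin 4) ℝ E3)
    (hP : P.carrier = convexHull ℝ (range p)) :
    P.edgeLength = ‖p 0 - p 1‖ + ‖p 0 - p 2‖ + ‖p 0 - p 3‖ + ‖p 1 - p 2‖ + ‖p 1 - p 3‖ +
      ‖p 2 - p 3‖ := by
  obtain ⟨a, b, h, hf⟩ := exists_isRep_of_affineBasis p hP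
  have hw : ∀ u, ∑ i, width (facet a b i) u = |⟪u, p 0 - p 1⟫_ℝ| + |⟪u, p 0 - p 2⟫_ℝ| +
      |⟪u, p 0 - p 3⟫_ℝ| + |⟪u, p 1 - p 2⟫_ℝ| + |⟪u, p 1 - p 3⟫_ℝ| + |⟪u, p 2 - p 3⟫_ℝ| := by
    intro u
    rw [Fin.sum_univ_four]
    simp only [hf]
    have h0 := two_mul_width_face p hP (i := 0) (j := 1) (k := 2) (l := 3) (by decide) u
    have h1 := two_mul_width_face p hP (i := 1) (j := 0) (k := 2) (l := 3) (by decide) u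
    have h2 := two_mul_width_face p hP (i := 2) (j := 0) (k := 1) (l := 3) (by decide) u
    have h3 := two_mul_width_face p hP (i := 3) (j := 0) (k := 1) (l := 2) (by decide) u
    linarith
  have hI : ∀ x : E3, IntegrableOn (fun u => |⟪u, x⟫_ℝ|) (Metric.ball (0 : E3) 2) := fun x =>
    integrableOn_ball (by fun_prop) 2
  have hadd : ∀ {f : E3 → ℝ}, IntegrableOn f (Metric.ball (0 : E3) 2) → ∀ x : E3,
      IntegrableOn (fun u => f u + |⟪u, x⟫_ℝ|) (Metric.ball (0 : E3) 2) := fun hf x => hf.add (hI x)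
  have hint : ∀ {f : E3 → ℝ}, IntegrableOn f (Metric.ball (0 : E3) 2) → ∀ x : E3,
      ∫ u in Metric.ball (0 : E3) 2, (f u + |⟪u, x⟫_ℝ|) =
        (∫ u in Metric.ball (0 : E3) 2, f u) + widthConst * ‖x‖ := fun hf x => by
    rw [integral_add hf (hI x), integral_abs_inner]
  refine mul_left_cancel₀ widthConst_pos.ne' ?_
  rw [h.widthConst_mul_edgeLength]
  simp only [meanWidth]
  rw [← integral_finsetSum _ fun i _ => integrableOn_ball (continuous_width (h.isCompact_facet i)) 2]
  simp_rw [hw]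
  rw [hint (hadd (hadd (hadd (hadd (hI _) _) _) _) _), hint (hadd (hadd (hadd (hI _) _) _) _),
    hint (hadd (hadd (hI _) _) _), hint (hadd (hI _) _), hint (hI _), integral_abs_inner]
  ring

/-! ### The regular tetrahedron is optimal among tetrahedra -/

/-- The determinant of three vectors, that is, the oriented volume of the box they span. -/
def det3 (x y z : E3) : ℝ :=
  x 0 * (y 1 * z 2 - y 2 * z 1) - x 1 * (y 0 * z 2 - y 2 * z 0) + x 2 * (y 0 * z 1 - y 1 * z 0)

/-- The volume of the simplex spanned by the origin and the standard basis. -/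
noncomputable def simplexVol : ℝ :=
  volume.real (convexHull ℝ (insert 0 (range fun i : Fin 3 => EuclideanSpace.basisFun (Fin 3) ℝ i)))

/-- A tetrahedron is the image of the standard simplex under an affine map. -/
theorem volume_real_convexHull (p : Fin 4 → E3) :
    volume.real (convexHull ℝ (range p)) =
      |det3 (p 1 - p 0) (p 2 - p 0) (p 3 - p 0)| * simplexVol := by
  set B := (EuclideanSpace.basisFun (Fin 3) ℝ).toBasis with hB
  set f : E3 →ₗ[ℝ] E3 := B.constr ℝ fun i : Fin 3 => p i.succ - p 0 with hf
  have hfi : ∀ i : Fin 3, f (EuclideanSpace.basisFun (Fin 3) ℝ i) = p i.succ - p 0 := fun i => by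
    have := B.constr_basis ℝ (fun i : Fin 3 => p i.succ - p 0) i
    rwa [hB, OrthonormalBasis.coe_toBasis] at this
  have hdet : LinearMap.det f = det3 (p 1 - p 0) (p 2 - p 0) (p 3 - p 0) := by
    rw [← LinearMap.det_toMatrix B, Matrix.det_fin_three]
    have hent : ∀ i j : Fin 3, LinearMap.toMatrix B B f i j = (p j.succ - p 0) i := fun i j => by
      rw [LinearMap.toMatrix_apply, hB, OrthonormalBasis.coe_toBasis, hfi]
      simp
    simp only [hent, det3]
    simp only [Fin.succ_zero_eq_one, Fin.succ_one_eq_two, show (2 : Fin 3).succ = 3 from rfl]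
    ring
  have himg : convexHull ℝ (range p) = (fun x => x + p 0) '' (f '' convexHull ℝ
      (insert 0 (range fun i : Fin 3 => EuclideanSpace.basisFun (Fin 3) ℝ i))) := by
    rw [f.image_convexHull, image_insert_eq, map_zero, ← range_comp]
    have : (fun x => x + p 0) = (AffineEquiv.vaddConst ℝ (p 0) : E3 ≃ᵃ[ℝ] E3).toAffineMap := by
      ext x; simp
    rw [this, AffineMap.image_convexHull, ← this, image_insert_eq, ← range_comp]
    congr 1
    ext x
    simp only [mem_range, mem_insert_iff, Function.comp_apply, hfi, sub_add_cancel, zero_add]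
    rw [Fin.exists_fin_succ, eq_comm]
  rw [himg, simplexVol]
  simp only [Measure.real, image_add_right, measure_preimage_add_right,
    Measure.addHaar_image_linearMap, hdet, ENNReal.toReal_mul, ENNReal.toReal_ofReal (abs_nonneg _)]

/-- The cross product. -/
def cross3 (x y : E3) : E3 :=
  !₂[x 1 * y 2 - x 2 * y 1, x 2 * y 0 - x 0 * y 2, x 0 * y 1 - x 1 * y 0]

theorem inner_eq_sum3 (x y : E3) : ⟪x, y⟫_ℝ = x 0 * y 0 + x 1 * y 1 + x 2 * y 2 := by
  rw [PiLp.inner_apply, Fin.sum_univ_three]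
  simp only [RCLike.inner_apply, conj_trivial, mul_comm]

theorem inner_cross3_left (x y : E3) : ⟪cross3 x y, x⟫_ℝ = 0 := by
  simp [inner_eq_sum3, cross3]; ring

theorem inner_cross3_right (x y : E3) : ⟪cross3 x y, y⟫_ℝ = 0 := by
  simp [inner_eq_sum3, cross3]; ring

theorem inner_cross3 (x y z : E3) : ⟪cross3 x y, z⟫_ℝ = det3 x y z := by
  simp [inner_eq_sum3, cross3, det3]; ring

theorem norm_cross3_sq (x y : E3) : ‖cross3 x y‖ ^ 2 = ‖x‖ ^ 2 * ‖y‖ ^ 2 - ⟪x, y⟫_ℝ ^ 2 := by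
  simp only [← real_inner_self_eq_norm_sq, inner_eq_sum3]
  simp [cross3]
  ring

/-- Gram's determinant. -/
theorem det3_sq (x y z : E3) : det3 x y z ^ 2 =
    ⟪x, x⟫_ℝ * ⟪y, y⟫_ℝ * ⟪z, z⟫_ℝ + 2 * ⟪x, y⟫_ℝ * ⟪y, z⟫_ℝ * ⟪x, z⟫_ℝ
      - ⟪x, x⟫_ℝ * ⟪y, z⟫_ℝ ^ 2 - ⟪y, y⟫_ℝ * ⟪x, z⟫_ℝ ^ 2 - ⟪z, z⟫_ℝ * ⟪x, y⟫_ℝ ^ 2 := by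
  simp only [inner_eq_sum3, det3]; ring

/-- Among the vectors `m + g` with `g` orthogonal to `m`, the total distance to `s` and `-s`, where
`s` is orthogonal to `m` too, is least for `g = 0`. This follows by reflecting one of the two
segments. -/
theorem two_mul_norm_add_le {m g s : E3} (hmg : ⟪m, g⟫_ℝ = 0) (hms : ⟪m, s⟫_ℝ = 0) :
    2 * ‖m + s‖ ≤ ‖m + g + s‖ + ‖m + g - s‖ := by
  have h1 : ‖m + g - s‖ = ‖m - g + s‖ := by
    rw [← sq_eq_sq₀ (norm_nonneg _) (norm_nonneg _), sub_add, add_sub_assoc, norm_add_sq_real,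
      norm_sub_sq_real m, inner_sub_right, hmg, hms]
    ring
  have h2 : (2 : ℝ) • (m + s) = (m + g + s) + (m - g + s) := by module
  have h3 := norm_add_le (m + g + s) (m - g + s)
  rw [← h2, norm_smul, Real.norm_ofNat] at h3
  rwa [h1]

/-- A form of the inequality between weighted arithmetic and geometric means. -/
theorem mul_sq_mul_sq_le {A B X Y : ℝ} (hA : 0 ≤ A) (hB : 0 ≤ B) (hX : 0 ≤ X) (hY : 0 ≤ Y) :
    2916 * ((A * B) * (X ^ 2 * Y ^ 2)) ≤ (A + B + (X + Y)) ^ 6 := by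
  have hAB : 4 * (A * B) ≤ (A + B) ^ 2 := by linarith [sq_nonneg (A - B)]
  have hXY : 4 * (X * Y) ≤ (X + Y) ^ 2 := by linarith [sq_nonneg (X - Y)]
  have hu : 0 ≤ A + B := add_nonneg hA hB
  have hv : 0 ≤ X + Y := add_nonneg hX hY
  have h1 : (4 * (A * B)) * (4 * (X * Y)) ^ 2 ≤ (A + B) ^ 2 * ((X + Y) ^ 2) ^ 2 := by gcongr
  generalize A + B = u at *
  generalize X + Y = v at *
  have huv : 27 * (u * v ^ 2) ≤ 4 * (u + v) ^ 3 := by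
    have : 0 ≤ (2 * u - v) ^ 2 * (u + 4 * v) := by positivity
    linarith
  have h2 : (27 * (u * v ^ 2)) ^ 2 ≤ (4 * (u + v) ^ 3) ^ 2 := by gcongr
  linarith

/-- The right-hand side is the sixth power of the total edge length of a tetrahedron with the
opposite edges `2 • p` and `2 • q`, the midpoints of which differ by `f`. Its edge length does not
increase when `f` is replaced by its component orthogonal to both edges. -/
theorem mul_det3_sq_le (p q f : E3) :
    1492992 * det3 p q f ^ 2 ≤ (2 * ‖p‖ + 2 * ‖q‖ + (‖f + (p + q)‖ + ‖f - (p + q)‖) +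
      (‖f + (p - q)‖ + ‖f - (p - q)‖)) ^ 6 := by
  set n := cross3 p q with hn
  set Δ := det3 p q f with hΔ
  rcases eq_or_ne n 0 with h0 | h0
  · have : Δ = 0 := by rw [hΔ, ← inner_cross3, ← hn, h0, inner_zero_left]
    rw [this, zero_pow two_ne_zero, mul_zero]
    positivity
  have hN : 0 < ‖n‖ := norm_pos_iff.2 h0
  have hnp : ⟪n, p⟫_ℝ = 0 := inner_cross3_left p q
  have hnq : ⟪n, q⟫_ℝ = 0 := inner_cross3_right p q
  have hN2 : ‖n‖ ^ 2 = ‖p‖ ^ 2 * ‖q‖ ^ 2 - ⟪p, q⟫_ℝ ^ 2 := norm_cross3_sq p q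
  -- the component of `f` along the common normal of the two opposite edges
  set m := (Δ / ‖n‖ ^ 2) • n with hm
  set g := f - m with hg
  have hfm : f = m + g := by rw [hg]; abel
  have hmN : ‖m‖ ^ 2 * ‖n‖ ^ 2 = Δ ^ 2 := by
    rw [hm, norm_smul, mul_pow, Real.norm_eq_abs, sq_abs]
    field_simp
  have hmp : ⟪m, p⟫_ℝ = 0 := by rw [hm, real_inner_smul_left, hnp, mul_zero]
  have hmq : ⟪m, q⟫_ℝ = 0 := by rw [hm, real_inner_smul_left, hnq, mul_zero]
  have hmg : ⟪m, g⟫_ℝ = 0 := by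
    have h1 : ⟪n, f⟫_ℝ = Δ := inner_cross3 p q f
    have h2 : ⟪n, m⟫_ℝ = Δ := by
      rw [hm, inner_smul_right, real_inner_self_eq_norm_sq]
      field_simp
    rw [hg, hm, real_inner_smul_left, ← hm, inner_sub_right, h1, h2, sub_self, mul_zero]
  have hX := two_mul_norm_add_le hmg (s := p + q) (by rw [inner_add_right, hmp, hmq, add_zero])
  have hY := two_mul_norm_add_le hmg (s := p - q) (by rw [inner_sub_right, hmp, hmq, sub_zero])
  rw [← hfm] at hX hY
  have hX2 : ‖m + (p + q)‖ ^ 2 = ‖m‖ ^ 2 + ‖p‖ ^ 2 + ‖q‖ ^ 2 + 2 * ⟪p, q⟫_ℝ := by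
    rw [norm_add_sq_real, inner_add_right, hmp, hmq, norm_add_sq_real p]; ring
  have hY2 : ‖m + (p - q)‖ ^ 2 = ‖m‖ ^ 2 + ‖p‖ ^ 2 + ‖q‖ ^ 2 - 2 * ⟪p, q⟫_ℝ := by
    rw [norm_add_sq_real, inner_sub_right, hmp, hmq, norm_sub_sq_real p]; ring
  set X := ‖m + (p + q)‖
  set Y := ‖m + (p - q)‖
  set A := ‖p‖ with hA
  set B := ‖q‖ with hBdef
  have hA0 : 0 ≤ A := norm_nonneg _
  have hB0 : 0 ≤ B := norm_nonneg _
  have hX0 : 0 ≤ X := norm_nonneg _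
  have hY0 : 0 ≤ Y := norm_nonneg _
  have hNAB : ‖n‖ ≤ A * B := by
    rw [← sq_le_sq₀ hN.le (by positivity), mul_pow, hN2]
    exact sub_le_self _ (sq_nonneg _)
  have hXY : 8 * ‖m‖ ^ 2 * ‖n‖ ≤ X ^ 2 * Y ^ 2 := by
    have h1 : X ^ 2 * Y ^ 2 - 8 * ‖m‖ ^ 2 * ‖n‖ = (‖m‖ ^ 2 - 2 * ‖n‖) ^ 2 +
        4 * (‖m‖ ^ 2 * (A * B - ‖n‖)) + 2 * (‖m‖ ^ 2 * (A - B) ^ 2) + (A ^ 2 - B ^ 2) ^ 2 := by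
      rw [hX2, hY2]
      linear_combination (-4) * hN2
    have h2 : 0 ≤ A * B - ‖n‖ := sub_nonneg.2 hNAB
    rw [← sub_nonneg, h1]
    positivity
  have hΔ2 : 8 * Δ ^ 2 ≤ (A * B) * (X ^ 2 * Y ^ 2) := by
    calc 8 * Δ ^ 2 = ‖n‖ * (8 * ‖m‖ ^ 2 * ‖n‖) := by rw [← hmN]; ring
      _ ≤ (A * B) * (X ^ 2 * Y ^ 2) := by gcongr
  have h6 := mul_sq_mul_sq_le hA0 hB0 hX0 hY0
  have h7 : (2 * (A + B + (X + Y))) ^ 6 ≤ (2 * A + 2 * B + (‖f + (p + q)‖ + ‖f - (p + q)‖) +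
      (‖f + (p - q)‖ + ‖f - (p - q)‖)) ^ 6 := by
    gcongr
    linarith
  rw [mul_pow] at h7
  linarith

/-- The isoperimetric inequality between edge length and volume for tetrahedra. -/
theorem mul_det3_sq_le_edgeLength (p : Fin 4 → E3) :
    93312 * det3 (p 1 - p 0) (p 2 - p 0) (p 3 - p 0) ^ 2 ≤
      (‖p 0 - p 1‖ + ‖p 0 - p 2‖ + ‖p 0 - p 3‖ + ‖p 1 - p 2‖ + ‖p 1 - p 3‖ + ‖p 2 - p 3‖) ^ 6 := by
  have h := mul_det3_sq_le ((1 / 2 : ℝ) • (p 1 - p 0)) ((1 / 2 : ℝ) • (p 3 - p 2))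
    ((1 / 2 : ℝ) • (p 2 + p 3 - p 0 - p 1))
  have hd : det3 (p 1 - p 0) (p 2 - p 0) (p 3 - p 0) = -4 * det3 ((1 / 2 : ℝ) • (p 1 - p 0))
      ((1 / 2 : ℝ) • (p 3 - p 2)) ((1 / 2 : ℝ) • (p 2 + p 3 - p 0 - p 1)) := by
    simp only [det3, PiLp.sub_apply, PiLp.smul_apply, PiLp.add_apply, smul_eq_mul]
    ring
  rw [hd]
  refine (le_of_eq (by ring)).trans (h.trans (le_of_eq ?_))
  have e1 : (1 / 2 : ℝ) • (p 2 + p 3 - p 0 - p 1) +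
      ((1 / 2 : ℝ) • (p 1 - p 0) + (1 / 2 : ℝ) • (p 3 - p 2)) = -(p 0 - p 3) := by module
  have e2 : (1 / 2 : ℝ) • (p 2 + p 3 - p 0 - p 1) -
      ((1 / 2 : ℝ) • (p 1 - p 0) + (1 / 2 : ℝ) • (p 3 - p 2)) = -(p 1 - p 2) := by module
  have e3 : (1 / 2 : ℝ) • (p 2 + p 3 - p 0 - p 1) +
      ((1 / 2 : ℝ) • (p 1 - p 0) - (1 / 2 : ℝ) • (p 3 - p 2)) = -(p 0 - p 2) := by module
  have e4 : (1 / 2 : ℝ) • (p 2 + p 3 - p 0 - p 1) -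
      ((1 / 2 : ℝ) • (p 1 - p 0) - (1 / 2 : ℝ) • (p 3 - p 2)) = -(p 1 - p 3) := by module
  rw [e1, e2, e3, e4]
  simp only [norm_neg, norm_smul]
  rw [norm_sub_rev (p 1) (p 0), norm_sub_rev (p 3) (p 2)]
  norm_num
  ring

/-- Gram's determinant for a regular tetrahedron. -/
theorem det3_sq_of_dist_eq {p : Fin 4 → E3} {a : ℝ} (hp : ∀ i j, i ≠ j → dist (p i) (p j) = a) :
    2 * det3 (p 1 - p 0) (p 2 - p 0) (p 3 - p 0) ^ 2 = a ^ 6 := by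
  have hxx : ∀ i, i ≠ 0 → ⟪p i - p 0, p i - p 0⟫_ℝ = a ^ 2 := fun i hi => by
    rw [real_inner_self_eq_norm_sq, ← dist_eq_norm, hp i 0 hi]
  have hxy : ∀ i j, i ≠ 0 → j ≠ 0 → i ≠ j → ⟪p i - p 0, p j - p 0⟫_ℝ = a ^ 2 / 2 :=
    fun i j hi hj hij => by
      rw [real_inner_eq_norm_mul_self_add_norm_mul_self_sub_norm_sub_mul_self_div_two,
        sub_sub_sub_cancel_right, ← dist_eq_norm, ← dist_eq_norm, ← dist_eq_norm, hp i 0 hi,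
        hp j 0 hj, hp i j hij]
      ring
  rw [det3_sq, hxx 1 (by decide), hxx 2 (by decide), hxx 3 (by decide),
    hxy 1 2 (by decide) (by decide) (by decide), hxy 2 3 (by decide) (by decide) (by decide),
    hxy 1 3 (by decide) (by decide) (by decide)]
  ring

namespace ConvexPolyhedron

theorem exists_affineBasis_of_carrier_eq {P : ConvexPolyhedron} {p : Fin 4 → E3}
    (hP : P.carrier = convexHull ℝ (range p)) : ∃ B : AffineBasis (Fin 4) ℝ E3, ⇑B = p := by
  have hspan : affineSpan ℝ (range p) = ⊤ := by
    rw [← interior_convexHull_nonempty_iff_affineSpan_eq_top, ← hP]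
    exact P.solid
  have hind : AffineIndependent ℝ p := by
    rw [affineIndependent_iff_finrank_vectorSpan_eq ℝ p (n := 3) (by simp),
      ← direction_affineSpan, hspan, AffineSubspace.direction_top]
    simp
  exact ⟨⟨p, hind, hspan⟩, rfl⟩

namespace IsRegularTetrahedron

theorem numFaces_eq {P : ConvexPolyhedron} (hP : P.IsRegularTetrahedron) : P.numFaces = 4 := by
  obtain ⟨p, -, -, -, hp⟩ := hP
  obtain ⟨B, rfl⟩ := exists_affineBasis_of_carrier_eq hp
  obtain ⟨a, b, h, -⟩ := exists_isRep_of_affineBasis B hp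
  rw [h.numFaces_eq]
  simp

theorem isMinimizerForFaces {P : ConvexPolyhedron} (hP : P.IsRegularTetrahedron) :
    P.IsMinimizerForFaces := by
  intro Q hQ
  rw [hP.numFaces_eq] at hQ
  obtain ⟨q, hq⟩ := exists_affineBasis_of_numFaces_eq_four hQ
  obtain ⟨p, s, hs, hps, hp⟩ := hP
  obtain ⟨B, rfl⟩ := exists_affineBasis_of_carrier_eq hp
  have hPe : P.edgeLength = 6 * s := by
    rw [edgeLength_tetrahedron B hp]
    simp only [← dist_eq_norm]
    rw [hps 0 1 (by decide), hps 0 2 (by decide), hps 0 3 (by decide), hps 1 2 (by decide),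
      hps 1 3 (by decide), hps 2 3 (by decide)]
    ring
  have hQe := mul_det3_sq_le_edgeLength q
  rw [← edgeLength_tetrahedron q hq] at hQe
  have hPd := det3_sq_of_dist_eq hps
  have hPv : P.vol = _ := (congrArg volume.real hp).trans (volume_real_convexHull B)
  have hQv : Q.vol = _ := (congrArg volume.real hq).trans (volume_real_convexHull q)
  set D := det3 (B 1 - B 0) (B 2 - B 0) (B 3 - B 0)
  set D' := det3 (q 1 - q 0) (q 2 - q 0) (q 3 - q 0)
  have hle : (P.edgeLength ^ 3 * |D'|) ^ 2 ≤ (Q.edgeLength ^ 3 * |D|) ^ 2 := by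
    rw [mul_pow, mul_pow, sq_abs, sq_abs, hPe]
    calc ((6 * s) ^ 3) ^ 2 * D' ^ 2 = (93312 * D' ^ 2) * D ^ 2 := by
          rw [show ((6 * s) ^ 3) ^ 2 = 46656 * s ^ 6 by ring, ← hPd]; ring
      _ ≤ Q.edgeLength ^ 6 * D ^ 2 := by gcongr
      _ = _ := by ring
  have hle' := (sq_le_sq₀ (by have := P.edgeLength_pos; positivity)
    (by have := Q.edgeLength_pos; positivity)).1 hle
  rw [melzakRatio, melzakRatio, div_le_div_iff₀ P.vol_pos Q.vol_pos, hPv, hQv, ← mul_assoc,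
    ← mul_assoc]
  exact mul_le_mul_of_nonneg_right hle' measureReal_nonneg

end IsRegularTetrahedron

theorem exists_isRegularTetrahedron : ∃ P : ConvexPolyhedron, P.IsRegularTetrahedron := by
  -- alternate vertices of a cube centred at the origin
  set p : Fin 4 → E3 := ![!₂[1, 1, 1], !₂[1, -1, -1], !₂[-1, 1, -1], !₂[-1, -1, 1]] with hp
  refine ⟨⟨convexHull ℝ (range p), ⟨range p, finite_range p, rfl⟩, ?_⟩, p, √8, by positivity, ?_,
    rfl⟩
  · have hopen : IsOpen (⋂ i, {x : E3 | 0 < 1 + ⟪p i, x⟫_ℝ}) :=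
      isOpen_iInter_of_finite fun i => isOpen_lt continuous_const (by fun_prop)
    refine ⟨0, interior_maximal (fun x hx => ?_) hopen (mem_iInter.2 fun i => by simp)⟩
    rw [mem_iInter] at hx
    have hsum : ∑ i, ((1 + ⟪p i, x⟫_ℝ) / 4) • p i = x := by
      ext j
      fin_cases j <;> simp [Fin.sum_univ_four, hp, inner_eq_sum3] <;> ring
    rw [← hsum]
    refine (convex_convexHull ℝ _).sum_mem (fun i _ => ?_) ?_ fun i _ =>
      subset_convexHull ℝ _ (mem_range_self i)
    · have : 0 < 1 + ⟪p i, x⟫_ℝ := hx i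
      positivity
    · simp [Fin.sum_univ_four, hp, inner_eq_sum3]
      ring
  · intro i j hij
    rw [EuclideanSpace.dist_eq]
    congr 1
    fin_cases i <;> fin_cases j <;> first
      | exact absurd rfl hij
      | (simp [Fin.sum_univ_three, hp, Real.dist_eq]; norm_num)

end ConvexPolyhedron

/-! ### The recursive construction -/

namespace ConvexPolyhedron

/-- A polyhedron whose Melzak ratio is not minimal has a successor in the recursive construction. -/
theorem exists_isLeast_isMinimizerForFaces {P : ConvexPolyhedron}
    (hP : ∃ Q : ConvexPolyhedron, Q.melzakRatio < P.melzakRatio) :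
    ∃ R : ConvexPolyhedron, IsLeast {k : ℕ | ∃ Q : ConvexPolyhedron,
      Q.melzakRatio < P.melzakRatio ∧ Q.numFaces = k} R.numFaces ∧ R.IsMinimizerForFaces := by
  set S := {k : ℕ | ∃ Q : ConvexPolyhedron, Q.melzakRatio < P.melzakRatio ∧ Q.numFaces = k} with hS
  have hne : S.Nonempty := let ⟨Q, hQ⟩ := hP; ⟨_, Q, hQ, rfl⟩
  obtain ⟨Q, hQ, hQk⟩ := Nat.sInf_mem hne
  obtain ⟨R, hRk, hR⟩ := exists_numFaces_le_melzakRatio_le ⟨Q, hQk⟩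
  have hRP : R.melzakRatio < P.melzakRatio := (hR Q hQk).trans_lt hQ
  -- a limit with fewer faces would contradict the choice of the number of faces
  have hk : R.numFaces = sInf S := hRk.antisymm (Nat.sInf_le ⟨R, hRP, rfl⟩)
  exact ⟨R, hk ▸ ⟨Nat.sInf_mem hne, fun _ => Nat.sInf_le⟩, fun T hT => hR T (hT.trans hk)⟩

theorem isScaling_self (P : ConvexPolyhedron) : P.IsScaling P :=
  ⟨1, one_pos, by simp⟩

end ConvexPolyhedron

open scoped Classical in
theorem exists_isConstructedSequence : ∃ P : ℕ → ConvexPolyhedron, IsConstructedSequence P := by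
  obtain ⟨P₀, h₀⟩ := ConvexPolyhedron.exists_isRegularTetrahedron
  set next : ConvexPolyhedron → ConvexPolyhedron := fun P =>
    if h : ∃ Q : ConvexPolyhedron, Q.melzakRatio < P.melzakRatio then
      (ConvexPolyhedron.exists_isLeast_isMinimizerForFaces h).choose else P with hnext
  set P : ℕ → ConvexPolyhedron := fun n => next^[n] P₀ with hP
  have hsucc : ∀ n, P (n + 1) = next (P n) := fun n => Function.iterate_succ_apply' next n P₀
  refine ⟨P, h₀, fun n h => ?_, fun n h => ?_⟩
  · rw [hsucc, hnext]
    simp only [dif_pos h]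
    exact (ConvexPolyhedron.exists_isLeast_isMinimizerForFaces h).choose_spec
  · rw [hsucc, hnext]
    simp only [dif_neg h]

namespace IsConstructedSequence

variable {P : ℕ → ConvexPolyhedron}

theorem isMinimizerForFaces (h : IsConstructedSequence P) (n : ℕ) :
    (P n).IsMinimizerForFaces := by
  induction n with
  | zero => exact h.start.isMinimizerForFaces
  | succ n ih =>
    by_cases hex : ∃ Q : ConvexPolyhedron, Q.melzakRatio < (P n).melzakRatio
    · exact (h.step n hex).2
    · rwa [h.stationary n hex]

theorem melzakRatio_succ_lt (h : IsConstructedSequence P) {n : ℕ}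
    (hex : ∃ Q : ConvexPolyhedron, Q.melzakRatio < (P n).melzakRatio) :
    (P (n + 1)).melzakRatio < (P n).melzakRatio := by
  obtain ⟨⟨⟨Q, hQ, hQk⟩, -⟩, hmin⟩ := h.step n hex
  exact (hmin Q hQk).trans_lt hQ

/-- No polyhedron with at most as many faces as a term of the sequence has a smaller Melzak
ratio. -/
theorem numFaces_lt_of_melzakRatio_lt (h : IsConstructedSequence P) (n : ℕ) {Q : ConvexPolyhedron}
    (hQ : Q.melzakRatio < (P n).melzakRatio) : (P n).numFaces < Q.numFaces := by
  suffices hle : (P n).numFaces ≤ Q.numFaces from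
    hle.lt_of_ne fun heq => hQ.not_ge (h.isMinimizerForFaces n Q heq.symm)
  induction n with
  | zero => exact h.start.numFaces_eq ▸ four_le_numFaces Q
  | succ n ih =>
    by_cases hex : ∃ Q : ConvexPolyhedron, Q.melzakRatio < (P n).melzakRatio
    · exact (h.step n hex).1.2 ⟨Q, hQ.trans (h.melzakRatio_succ_lt hex), rfl⟩
    · rw [h.stationary n hex] at hQ ⊢
      exact ih hQ

theorem antitone_melzakRatio (h : IsConstructedSequence P) :
    Antitone fun n => (P n).melzakRatio := by
  refine antitone_nat_of_succ_le fun n => ?_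
  by_cases hex : ∃ Q : ConvexPolyhedron, Q.melzakRatio < (P n).melzakRatio
  · exact (h.melzakRatio_succ_lt hex).le
  · rw [h.stationary n hex]

/-- Otherwise the number of faces of the terms would increase strictly and exceed that of `Q`. -/
theorem exists_melzakRatio_le (h : IsConstructedSequence P) (Q : ConvexPolyhedron) :
    ∃ n, (P n).melzakRatio ≤ Q.melzakRatio := by
  by_contra! hcon
  have hmono : StrictMono fun n => (P n).numFaces := strictMono_nat_of_lt_succ fun n =>
    h.numFaces_lt_of_melzakRatio_lt n (h.melzakRatio_succ_lt ⟨Q, hcon n⟩)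
  exact (h.numFaces_lt_of_melzakRatio_lt _ (hcon Q.numFaces)).not_ge (hmono.id_le Q.numFaces)

theorem isMinimizingSequence (h : IsConstructedSequence P) : IsMinimizingSequence P where
  tendsto_inf := by
    have hbdd : BddBelow (range fun Q : ConvexPolyhedron => Q.melzakRatio) :=
      ⟨0, forall_mem_range.2 fun Q => Q.melzakRatio_pos.le⟩
    have hbdd' : BddBelow (range fun n => (P n).melzakRatio) :=
      ⟨0, forall_mem_range.2 fun n => (P n).melzakRatio_pos.le⟩
    have : Nonempty ConvexPolyhedron := ⟨P 0⟩
    have heq : ⨅ Q : ConvexPolyhedron, Q.melzakRatio = ⨅ n, (P n).melzakRatio :=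
      le_antisymm (le_ciInf fun n => ciInf_le hbdd (P n)) (le_ciInf fun Q =>
        let ⟨n, hn⟩ := h.exists_melzakRatio_le Q
        (ciInf_le hbdd' n).trans hn)
    rw [heq]
    exact tendsto_atTop_ciInf h.antitone_melzakRatio hbdd'
  faces_lt n hn := by
    by_cases hex : ∃ Q : ConvexPolyhedron, Q.melzakRatio < (P n).melzakRatio
    · exact h.numFaces_lt_of_melzakRatio_lt n (h.melzakRatio_succ_lt hex)
    · rw [h.stationary n hex] at hn
      exact absurd (P n).isScaling_self hn
  minimizes := h.isMinimizerForFaces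

end IsConstructedSequence

end Melzak

theorem mainTheorem2 :
    (∃ P : ℕ → Melzak.ConvexPolyhedron, Melzak.IsConstructedSequence P) ∧
    (∀ P : ℕ → Melzak.ConvexPolyhedron,
      Melzak.IsConstructedSequence P → Melzak.IsMinimizingSequence P) ∧
    (∀ P : ℕ → Melzak.ConvexPolyhedron, Melzak.IsMinimizingSequence P →
      ∀ n, ∀ v ∈ (P n).vertices, (P n).degree v = 3) :=
  ⟨Melzak.exists_isConstructedSequence, fun _ h => h.isMinimizingSequence,
    fun _ h n _ hv => (h.minimizes n).degree_eq_three hv⟩
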